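/- Let $\varphi$ be a norm on $\mathbb R^d$ with dual norm $\varphi^o$. For a Lebesgue measurable set $F\subset\mathbb R^d$ let $$P_\varphi(F)=\int_{\partial F}\varphi(\nu)\,d\mathcal H^{d-1}:=\sup\Big\{\int_F \operatorname{div}X\,dx:\ X\in C^1_c(\mathbb R^d;\mathbb R^d),\ \varphi^o(X)\le 1\Big\}\in[0,+\infty]$$ be its anisotropic perimeter. Let $E^0\subset\mathbb R^d$ be a set of finite perimeter with $|E^0|<+\infty$. For $\tau>0$, a discrete flow with time step $\tau$ and initial datum $E^0$ is a sequence $(E^n_\tau)_{n\ge 0}$ of measurable sets with $E^0_\tau=E^0$ such that, for every $n\ge 1$, $$E^n_\tau\in\operatorname*{argmin}_{F\subset\mathbb R^d\text{ measurable}}\ P_\varphi(F)+\frac1{2\tau}\,|E^{n-1}_\tau\triangle F|^2 .$$ (a) For every $\tau>0$ there is at least one discrete flow with time step $\tau$ and initial datum $E^0$. (b) For each $\tau>0$ let $(E^n_\tau)_n$ be any discrete flow with time step $\tau$ and initial datum $E^0$, and put $u_\tau(x,t)=\chi_{E_\tau^{\lfloor t/\tau\rfloor}}(x)$ for $t\ge0$.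 Then there exist a sequence of positive numbers $\tau_k\to0$ and a family of measurable sets $E(t)$, $t\ge 0$, such that the function $u(x,t)=\chi_{E(t)}(x)$ is measurable in $(x,t)$, $$u\in L^\infty\big((0,+\infty);BV(\mathbb R^d)\big),\qquad u\in C^{1/2}\big([0,+\infty);L^1(\mathbb R^d)\big),$$ that is, $\sup_{t\ge0}\big(\|u(\cdot,t)\|_{L^1}+|Du(\cdot,t)|(\mathbb R^d)\big)<+\infty$ and there is a constant $C$ with $\|u(\cdot,t)-u(\cdot,s)\|_{L^1(\mathbb R^d)}\le C|t-s|^{1/2}$ for all $s,t\ge0$, and $$\lim_{k\to+\infty}\ \sup_{t\in[0,T]}\|u(\cdot,t)-u_{\tau_k}(\cdot,t)\|_{L^1(\mathbb R^d)}=0\qquad\text{for all } T>0.$$ -/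

import Mathlib

open MeasureTheory Set Filter Topology
open scoped ENNReal NNReal

noncomputable section

namespace L1Flow

/-- Divergence of a vector field `X` on `ℝ^d`: the sum of `∂ᵢ Xᵢ`. -/
def divergence {d : ℕ} (X : EuclideanSpace ℝ (Fin d) → EuclideanSpace ℝ (Fin d))
    (x : EuclideanSpace ℝ (Fin d)) : ℝ :=
  ∑ i : Fin d, (fderiv ℝ X x (EuclideanSpace.single i (1 : ℝ))) i

/-- Test fields: `C¹` vector fields with compact support and values in the set `K`. -/
def IsTestField {d : ℕ} (K : Set (EuclideanSpace ℝ (Fin d)))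
    (X : EuclideanSpace ℝ (Fin d) → EuclideanSpace ℝ (Fin d)) : Prop :=
  ContDiff ℝ 1 X ∧ HasCompactSupport X ∧ ∀ x, X x ∈ K

/-- `sup { ∫ f div X : X ∈ C¹_c(ℝ^d; ℝ^d), X(x) ∈ K for all x }`, as an extended nonnegative real
(the value for `X = 0` is `0`, so no information is lost when `0 ∈ K`). -/
def variationOver {d : ℕ} (K : Set (EuclideanSpace ℝ (Fin d)))
    (f : EuclideanSpace ℝ (Fin d) → ℝ) : ℝ≥0∞ :=
  ⨆ (X : EuclideanSpace ℝ (Fin d) → EuclideanSpace ℝ (Fin d)) (_ : IsTestField K X),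
    ENNReal.ofReal (∫ x, f x * divergence X x)

/-- The total variation `|Df|(ℝ^d)` of a locally integrable function `f`. -/
def totalVariation {d : ℕ} (f : EuclideanSpace ℝ (Fin d) → ℝ) : ℝ≥0∞ :=
  variationOver (Metric.closedBall 0 1) f

/-- The norm of `BV(ℝ^d)`: `‖f‖₁ + |Df|(ℝ^d)`. -/
def bvNorm {d : ℕ} (f : EuclideanSpace ℝ (Fin d) → ℝ) : ℝ≥0∞ :=
  eLpNorm f 1 volume + totalVariation f

/-- The characteristic function of `E`. -/
def chi {d : ℕ} (E : Set (EuclideanSpace ℝ (Fin d))) : EuclideanSpace ℝ (Fin d) → ℝ :=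
  E.indicator (fun _ => (1 : ℝ))

/-- The Wulff shape `{v : φ°(v) ≤ 1}`, where `φ°` is the dual norm
`φ°(v) = sup {⟨v, ξ⟩ : φ(ξ) ≤ 1}`; so `φ°(v) ≤ 1` says that `⟨v, ξ⟩ ≤ φ(ξ)` for all `ξ`. -/
def wulffShape {d : ℕ} (φ : Seminorm ℝ (EuclideanSpace ℝ (Fin d))) :
    Set (EuclideanSpace ℝ (Fin d)) :=
  {v | ∀ ξ, inner ℝ v ξ ≤ φ ξ}

/-- The anisotropic perimeter `P_φ(E) = ∫_{∂E} φ(ν) dH^{d-1}`, defined on all (Lebesgue)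
measurable sets by duality: `sup { ∫_E div X : X ∈ C¹_c(ℝ^d; ℝ^d), φ°(X) ≤ 1 }`. -/
def anisoPerimeter {d : ℕ} (φ : Seminorm ℝ (EuclideanSpace ℝ (Fin d)))
    (E : Set (EuclideanSpace ℝ (Fin d))) : ℝ≥0∞ :=
  variationOver (wulffShape φ) (chi E)

/-- Sets of finite perimeter: Lebesgue measurable sets whose characteristic function has finite
total variation. -/
def HasFinitePerimeter {d : ℕ} (E : Set (EuclideanSpace ℝ (Fin d))) : Prop :=
  NullMeasurableSet E volume ∧ totalVariation (chi E) < ∞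

/-- The functional `P_φ(F) + |E Δ F|² / (2τ)`. -/
def stepEnergy {d : ℕ} (φ : Seminorm ℝ (EuclideanSpace ℝ (Fin d))) (τ : ℝ)
    (E F : Set (EuclideanSpace ℝ (Fin d))) : ℝ≥0∞ :=
  anisoPerimeter φ F + volume (symmDiff E F) ^ 2 / ENNReal.ofReal (2 * τ)

/-- `F` minimizes `G ↦ P_φ(G) + |E Δ G|² / (2τ)` among all Lebesgue measurable sets. -/
def IsStepMinimizer {d : ℕ} (φ : Seminorm ℝ (EuclideanSpace ℝ (Fin d))) (τ : ℝ)
    (E F : Set (EuclideanSpace ℝ (Fin d))) : Prop :=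
  NullMeasurableSet F volume ∧
    ∀ G : Set (EuclideanSpace ℝ (Fin d)), NullMeasurableSet G volume →
      stepEnergy φ τ E F ≤ stepEnergy φ τ E G

/-- `S 0, S 1, S 2, …` are the iterates of the minimizing movement scheme with time step `τ` and
initial set `E₀`, for some choice of the minimizers. -/
def IsDiscreteFlow {d : ℕ} (φ : Seminorm ℝ (EuclideanSpace ℝ (Fin d))) (τ : ℝ)
    (E₀ : Set (EuclideanSpace ℝ (Fin d))) (S : ℕ → Set (EuclideanSpace ℝ (Fin d))) : Prop :=
  S 0 = E₀ ∧ ∀ n, IsStepMinimizer φ τ (S n) (S (n + 1))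

end L1Flow

end

namespace L1Flow

section
variable {d : ℕ}

local notation "𝔼" => EuclideanSpace ℝ (Fin d)

/-! ### Divergence -/

/-! Existence of a step minimizer is the direct method. A minimizing sequence has bounded perimeter
and stays at bounded distance from the previous set, so it has bounded volume and a subsequence
converges a.e. to a set (`exists_subseq_tendsto_ae`). Perimeter and distance are both lower
semicontinuous under a.e. convergence, so mass lost at infinity does no harm
(`exists_isStepMinimizer`).

For the limit τ → 0, comparing each step with the previous set bounds its squared displacement by 2τ
times the drop of perimeter. Telescoping and Cauchy–Schwarz make the flows 1/2-Hölder in time up to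
an error τ (`IsDiscreteFlow.volume_symmDiff_floor_le`), with perimeters bounded by the initial one.

Compactness in L¹ of the whole space needs two more facts. The volume is bounded uniformly in time:
for d ≥ 2 by an isoperimetric inequality, and on the line because the flow stays in an interval
containing the initial set up to a null set (`exists_volume_bound_flow`). On bounded time intervals
no mass escapes to infinity (`exists_tight_radius`): gluing the new set inside a sublevel set of
`height` to the old set outside gives a competitor whose extra perimeter is controlled by the
derivative in s of the volume moved below level s. Averaging over s in [R, 2R] makes the sum of
these derivatives over all steps of order 1/R. As a² + b² ≤ (a + b)², the displacement outside is
then quadratically small, and Cauchy–Schwarz bounds its sum independently of τ.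

A countable product of L¹-compact families gives convergence at all rational times, and the Hölder
estimate makes it locally uniform in time. Along a fast subsequence the limit is the pointwise
liminf of the sets, an explicit formula that yields joint measurability. The BV bound passes to the
limit by lower semicontinuity, the Hölder bound by the triangle inequality. -/

lemma continuous_divergence {X : 𝔼 → 𝔼} (hX : ContDiff ℝ 1 X) : Continuous (divergence X) := by
  unfold divergence
  refine continuous_finsetSum _ fun i _ => ?_
  have h : Continuous fun x => fderiv ℝ X x (EuclideanSpace.single i (1 : ℝ)) :=
    (hX.continuous_fderiv one_ne_zero).clm_apply continuous_const
  exact (EuclideanSpace.proj i : 𝔼 →L[ℝ] ℝ).continuous.comp h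

lemma divergence_eq_zero_of_fderiv {X : 𝔼 → 𝔼} {x : 𝔼} (h : fderiv ℝ X x = 0) :
    divergence X x = 0 := by
  simp [divergence, h]

lemma hasCompactSupport_divergence {X : 𝔼 → 𝔼} (hX : HasCompactSupport X) :
    HasCompactSupport (divergence X) := by
  refine (hX.fderiv ℝ).mono ?_
  intro x hx
  contrapose! hx
  simp only [Function.mem_support, not_not] at hx ⊢
  exact divergence_eq_zero_of_fderiv hx

lemma divergence_add {X Y : 𝔼 → 𝔼} (hX : Differentiable ℝ X) (hY : Differentiable ℝ Y) (x : 𝔼) :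
    divergence (X + Y) x = divergence X x + divergence Y x := by
  simp [divergence, fderiv_add (hX x) (hY x), Finset.sum_add_distrib]

lemma divergence_const_smul {X : 𝔼 → 𝔼} (hX : Differentiable ℝ X) (a : ℝ) (x : 𝔼) :
    divergence (a • X) x = a * divergence X x := by
  simp [divergence, fderiv_const_smul (hX x) a, Finset.mul_sum]

lemma sum_mul_apply_single (ℓ : 𝔼 →L[ℝ] ℝ) (v : 𝔼) :
    ∑ i, ℓ (EuclideanSpace.single i 1) * v i = ℓ v := by
  conv_rhs => rw [← (EuclideanSpace.basisFun (Fin d) ℝ).sum_repr v]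
  simp [map_sum, mul_comm]

lemma divergence_smul {η : 𝔼 → ℝ} {X : 𝔼 → 𝔼} (hη : Differentiable ℝ η)
    (hX : Differentiable ℝ X) (x : 𝔼) :
    divergence (fun y => η y • X y) x = η x * divergence X x + fderiv ℝ η x (X x) := by
  simp [divergence, fderiv_fun_smul (hη x) (hX x), Finset.sum_add_distrib, Finset.mul_sum,
    sum_mul_apply_single]

lemma divergence_smul_const {η : 𝔼 → ℝ} (hη : Differentiable ℝ η) (v : 𝔼) (x : 𝔼) :
    divergence (fun y => η y • v) x = fderiv ℝ η x v := by
  rw [divergence_smul hη (differentiable_const v)]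
  simp [divergence]

/-! ### Test fields -/

lemma IsTestField.differentiable {K : Set 𝔼} {X : 𝔼 → 𝔼} (hX : IsTestField K X) :
    Differentiable ℝ X :=
  hX.1.differentiable one_ne_zero

lemma IsTestField.continuous_divergence {K : Set 𝔼} {X : 𝔼 → 𝔼} (hX : IsTestField K X) :
    Continuous (divergence X) :=
  L1Flow.continuous_divergence hX.1

lemma IsTestField.integrable_divergence {K : Set 𝔼} {X : 𝔼 → 𝔼} (hX : IsTestField K X) :
    Integrable (divergence X) :=
  hX.continuous_divergence.integrable_of_hasCompactSupport (hasCompactSupport_divergence hX.2.1)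

lemma IsTestField.exists_divergence_bound {K : Set 𝔼} {X : 𝔼 → 𝔼} (hX : IsTestField K X) :
    ∃ C, ∀ x, |divergence X x| ≤ C :=
  (hasCompactSupport_divergence hX.2.1).exists_bound_of_continuous hX.continuous_divergence

lemma isTestField_zero {K : Set 𝔼} (h : (0 : 𝔼) ∈ K) : IsTestField K (0 : 𝔼 → 𝔼) :=
  ⟨contDiff_const, HasCompactSupport.zero, fun _ => h⟩

lemma IsTestField.add_of_disjoint {K : Set 𝔼} {X Y : 𝔼 → 𝔼} (hX : IsTestField K X)
    (hY : IsTestField K Y) (h : ∀ x, X x = 0 ∨ Y x = 0) : IsTestField K (X + Y) := by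
  refine ⟨hX.1.add hY.1, hX.2.1.add hY.2.1, fun x => ?_⟩
  rcases h x with h | h
  · simpa [h] using hY.2.2 x
  · simpa [h] using hX.2.2 x

lemma IsTestField.smul_cutoff {K : Set 𝔼} (hK : StarConvex ℝ 0 K) {X : 𝔼 → 𝔼}
    (hX : IsTestField K X) {η : 𝔼 → ℝ} (hη : ContDiff ℝ 1 η) (hη01 : ∀ x, η x ∈ Icc (0 : ℝ) 1) :
    IsTestField K (fun x => η x • X x) :=
  ⟨hη.smul hX.1, hX.2.1.smul_left (f := η), fun x =>
    starConvex_zero_iff.1 hK (hX.2.2 x) (hη01 x).1 (hη01 x).2⟩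

/-! ### Characteristic functions -/

lemma chi_apply_of_mem {E : Set 𝔼} {x : 𝔼} (h : x ∈ E) : chi E x = 1 := by simp [chi, h]

lemma chi_apply_of_notMem {E : Set 𝔼} {x : 𝔼} (h : x ∉ E) : chi E x = 0 := by simp [chi, h]

lemma chi_mem_Icc (E : Set 𝔼) (x : 𝔼) : chi E x ∈ Icc (0 : ℝ) 1 := by
  by_cases h : x ∈ E <;> simp [chi, h]

lemma abs_chi_le (E : Set 𝔼) (x : 𝔼) : |chi E x| ≤ 1 := by
  rw [abs_of_nonneg (chi_mem_Icc E x).1]; exact (chi_mem_Icc E x).2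

lemma chi_congr_ae {E F : Set 𝔼} (h : E =ᵐ[volume] F) : chi E =ᵐ[volume] chi F :=
  indicator_ae_eq_of_ae_eq_set h

lemma aestronglyMeasurable_chi {E : Set 𝔼} (hE : NullMeasurableSet E) :
    AEStronglyMeasurable (chi E) volume :=
  aestronglyMeasurable_const.indicator₀ hE

lemma integrable_chi {E : Set 𝔼} (hE : NullMeasurableSet E) (hv : volume E < ∞) :
    Integrable (chi E) := 
  IntegrableOn.integrable_indicator₀ (integrableOn_const hv.ne) hE

lemma integrable_chi_mul {E : Set 𝔼} (hE : NullMeasurableSet E) {g : 𝔼 → ℝ} (hg : Integrable g) :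
    Integrable (fun x => chi E x * g x) :=
  hg.bdd_mul (aestronglyMeasurable_chi hE) (Eventually.of_forall fun x => abs_chi_le E x)

lemma IsTestField.integrable_chi_mul {K : Set 𝔼} {X : 𝔼 → 𝔼} (hX : IsTestField K X) {E : Set 𝔼}
    (hE : NullMeasurableSet E) : Integrable (fun x => chi E x * divergence X x) :=
  L1Flow.integrable_chi_mul hE hX.integrable_divergence

lemma enorm_chi_sub (E F : Set 𝔼) (x : 𝔼) :
    ‖chi E x - chi F x‖ₑ = (symmDiff E F).indicator 1 x := by
  by_cases h : x ∈ E <;> by_cases h' : x ∈ F <;> simp [chi, h, h', mem_symmDiff]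

lemma abs_chi_sub (E F : Set 𝔼) (x : 𝔼) : |chi E x - chi F x| = chi (symmDiff E F) x := by
  by_cases h : x ∈ E <;> by_cases h' : x ∈ F <;> simp [chi, h, h', mem_symmDiff]

lemma nullMeasurableSet_symmDiff {E F : Set 𝔼} (hE : NullMeasurableSet E)
    (hF : NullMeasurableSet F) : NullMeasurableSet (symmDiff E F) :=
  (hE.diff hF).union (hF.diff hE)

lemma eLpNorm_chi_sub {E F : Set 𝔼} (hE : NullMeasurableSet E) (hF : NullMeasurableSet F) :
    eLpNorm (chi E - chi F) 1 volume = volume (symmDiff E F) := by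
  rw [eLpNorm_one_eq_lintegral_enorm]
  simp only [Pi.sub_apply, enorm_chi_sub]
  exact lintegral_indicator_one₀ (nullMeasurableSet_symmDiff hE hF)

lemma eLpNorm_chi {E : Set 𝔼} (hE : NullMeasurableSet E) :
    eLpNorm (chi E) 1 volume = volume E := by
  have h : chi (∅ : Set 𝔼) = 0 := by simp [chi]; rfl
  have := eLpNorm_chi_sub hE (nullMeasurableSet_empty (μ := (volume : Measure 𝔼)))
  rw [h, sub_zero] at this
  rw [this, ← bot_eq_empty, symmDiff_bot]

/-! ### Variation -/

lemma variationOver_congr_ae (K : Set 𝔼) {f g : 𝔼 → ℝ} (h : f =ᵐ[volume] g) :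
    variationOver K f = variationOver K g := by
  unfold variationOver
  refine iSup_congr fun X => iSup_congr fun _ => ?_
  congr 1
  exact integral_congr_ae (h.mono fun x hx => by simp [hx])

lemma IsTestField.ofReal_integral_le {K : Set 𝔼} {X : 𝔼 → 𝔼} (hX : IsTestField K X)
    (f : 𝔼 → ℝ) : ENNReal.ofReal (∫ x, f x * divergence X x) ≤ variationOver K f :=
  le_iSup₂ (f := fun (X : 𝔼 → 𝔼) (_ : IsTestField K X) =>
    ENNReal.ofReal (∫ x, f x * divergence X x)) X hX

lemma IsTestField.integral_le {K : Set 𝔼} {X : 𝔼 → 𝔼} (hX : IsTestField K X)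
    {f : 𝔼 → ℝ} (hf : variationOver K f ≠ ∞) :
    ∫ x, f x * divergence X x ≤ (variationOver K f).toReal :=
  (ENNReal.ofReal_le_iff_le_toReal hf).1 (hX.ofReal_integral_le f)

lemma variationOver_le {K : Set 𝔼} {f : 𝔼 → ℝ} {a : ℝ≥0∞}
    (h : ∀ X, IsTestField K X → ENNReal.ofReal (∫ x, f x * divergence X x) ≤ a) :
    variationOver K f ≤ a :=
  iSup₂_le h

lemma variationOver_mul_le {K K' : Set 𝔼} {a : ℝ} (ha : 0 ≤ a) (h : ∀ v ∈ K, a • v ∈ K')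
    (f : 𝔼 → ℝ) : ENNReal.ofReal a * variationOver K f ≤ variationOver K' f := by
  unfold variationOver
  rw [ENNReal.mul_iSup]
  refine iSup_le fun X => ?_
  rw [ENNReal.mul_iSup]
  refine iSup_le fun hX => ?_
  have hX' : IsTestField K' (a • X) :=
    ⟨contDiff_const.smul hX.1, hX.2.1.smul_left (f := fun _ => a), fun x => h _ (hX.2.2 x)⟩
  refine le_trans (le_of_eq ?_) (hX'.ofReal_integral_le f)
  rw [← ENNReal.ofReal_mul ha, ← integral_const_mul]
  congr 2
  ext x
  rw [divergence_const_smul hX.differentiable]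
  ring

/-! ### The Wulff shape -/

lemma zero_mem_wulffShape (φ : Seminorm ℝ 𝔼) : (0 : 𝔼) ∈ wulffShape φ := by
  intro ξ; simp

/-- Star-shapedness about 0 is the property of the constraint set that cutoffs need: multiplying a
test field by a function with values in [0, 1] keeps it admissible. -/
lemma starConvex_wulffShape (φ : Seminorm ℝ 𝔼) : StarConvex ℝ 0 (wulffShape φ) := by
  rw [starConvex_zero_iff]
  intro v hv a ha ha' ξ
  rw [real_inner_smul_left]
  have h1 := mul_le_mul_of_nonneg_left (hv ξ) ha
  have h2 := mul_le_of_le_one_left (apply_nonneg φ ξ) ha'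
  linarith

lemma exists_seminorm_le (φ : Seminorm ℝ 𝔼) : ∃ C, 0 < C ∧ ∀ x, φ x ≤ C * ‖x‖ := by
  refine ⟨∑ i, φ (EuclideanSpace.single i 1) + 1, by positivity, fun x => ?_⟩
  have h : φ x ≤ ∑ i, φ (EuclideanSpace.single i 1) * ‖x‖ := by
    conv_lhs => rw [← (EuclideanSpace.basisFun (Fin d) ℝ).sum_repr x]
    refine (Finset.le_sum_of_subadditive φ (map_zero φ).le (map_add_le_add φ) _ _).trans (Finset.sum_le_sum fun i _ => ?_)
    rw [map_smul_eq_mul, mul_comm]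
    simp only [EuclideanSpace.basisFun_repr, EuclideanSpace.basisFun_apply]
    gcongr
    exact PiLp.norm_apply_le x i
  rw [← Finset.sum_mul] at h
  nlinarith [norm_nonneg x]

lemma exists_wulffShape_subset (φ : Seminorm ℝ 𝔼) :
    ∃ C, 0 < C ∧ wulffShape φ ⊆ Metric.closedBall 0 C := by
  obtain ⟨C, hC, h⟩ := exists_seminorm_le φ
  refine ⟨C, hC, fun v hv => ?_⟩
  rw [mem_closedBall_zero_iff]
  have h1 := (hv v).trans (h v)
  rw [real_inner_self_eq_norm_sq] at h1
  by_contra! hlt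
  nlinarith [norm_nonneg v]

lemma exists_le_seminorm (φ : Seminorm ℝ 𝔼) (hφ : ∀ x, φ x = 0 → x = 0) :
    ∃ c, 0 < c ∧ ∀ x, c * ‖x‖ ≤ φ x := by
  obtain ⟨C, hC, h⟩ := exists_seminorm_le φ
  have hcont : Continuous φ := by
    refine (LipschitzWith.of_le_add_mul ⟨C, hC.le⟩ fun x y => ?_).continuous
    have h1 := map_add_le_add φ y (x - y)
    have h2 := h (x - y)
    rw [add_sub_cancel] at h1
    rw [dist_eq_norm]
    exact h1.trans (by gcongr; exact h2)
  -- The sphere is empty only in dimension zero; otherwise the constant is the minimum of φ on it.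
  rcases (Metric.sphere (0 : 𝔼) 1).eq_empty_or_nonempty with he | hne
  · refine ⟨1, one_pos, fun x => ?_⟩
    by_cases hx : x = 0
    · simp [hx]
    · exfalso
      have : (‖x‖⁻¹ • x) ∈ Metric.sphere (0 : 𝔼) 1 := by
        simp [norm_smul, hx]
      rw [he] at this; exact this
  · obtain ⟨z, hz, hmin⟩ := (isCompact_sphere (0 : 𝔼) 1).exists_isMinOn hne hcont.continuousOn
    have hz1 : ‖z‖ = 1 := by simpa using hz
    refine ⟨φ z, lt_of_le_of_ne (apply_nonneg φ z) fun h0 => ?_, fun x => ?_⟩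
    · rw [hφ z h0.symm] at hz1; simp at hz1
    · by_cases hx : x = 0
      · simp [hx]
      · have hm : (‖x‖⁻¹ • x) ∈ Metric.sphere (0 : 𝔼) 1 := by simp [norm_smul, hx]
        have h1 := hmin hm
        simp only [mem_ofPred_eq] at h1
        rw [map_smul_eq_mul, norm_inv, norm_norm] at h1
        have hpos : 0 < ‖x‖ := norm_pos_iff.2 hx
        calc φ z * ‖x‖ ≤ ‖x‖⁻¹ * φ x * ‖x‖ := by gcongr
          _ = φ x := by field_simp

lemma exists_closedBall_subset_wulffShape (φ : Seminorm ℝ 𝔼) (hφ : ∀ x, φ x = 0 → x = 0) :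
    ∃ c, 0 < c ∧ Metric.closedBall 0 c ⊆ wulffShape φ := by
  obtain ⟨c, hc, h⟩ := exists_le_seminorm φ hφ
  refine ⟨c, hc, fun v hv ξ => ?_⟩
  rw [mem_closedBall_zero_iff] at hv
  calc inner ℝ v ξ ≤ ‖v‖ * ‖ξ‖ := real_inner_le_norm v ξ
    _ ≤ c * ‖ξ‖ := by gcongr
    _ ≤ φ ξ := h ξ

lemma exists_anisoPerimeter_le (φ : Seminorm ℝ 𝔼) :
    ∃ C, 0 < C ∧ ∀ E, anisoPerimeter φ E ≤ ENNReal.ofReal C * totalVariation (chi E) := by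
  obtain ⟨C, hC, h⟩ := exists_wulffShape_subset φ
  refine ⟨C, hC, fun E => ?_⟩
  have h1 : ENNReal.ofReal C⁻¹ * anisoPerimeter φ E ≤ totalVariation (chi E) := by
    refine variationOver_mul_le (by positivity) (fun v hv => ?_) _
    have := h hv
    rw [mem_closedBall_zero_iff] at this ⊢
    rw [norm_smul, norm_inv, Real.norm_of_nonneg hC.le]
    exact (inv_mul_le_iff₀ hC).2 (by simpa using this)
  calc anisoPerimeter φ E
      = ENNReal.ofReal C * (ENNReal.ofReal C⁻¹ * anisoPerimeter φ E) := by
        rw [← mul_assoc, ← ENNReal.ofReal_mul hC.le, mul_inv_cancel₀ hC.ne']; simp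
    _ ≤ _ := by gcongr

lemma exists_totalVariation_le (φ : Seminorm ℝ 𝔼) (hφ : ∀ x, φ x = 0 → x = 0) :
    ∃ C, 0 < C ∧ ∀ E, totalVariation (chi E) ≤ ENNReal.ofReal C * anisoPerimeter φ E := by
  obtain ⟨c, hc, h⟩ := exists_closedBall_subset_wulffShape φ hφ
  refine ⟨c⁻¹, by positivity, fun E => ?_⟩
  have h1 : ENNReal.ofReal c * totalVariation (chi E) ≤ anisoPerimeter φ E := by
    refine variationOver_mul_le hc.le (fun v hv => h ?_) _
    rw [mem_closedBall_zero_iff] at hv ⊢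
    rw [norm_smul, Real.norm_of_nonneg hc.le]
    exact mul_le_of_le_one_right hc.le hv
  calc totalVariation (chi E)
      = ENNReal.ofReal c⁻¹ * (ENNReal.ofReal c * totalVariation (chi E)) := by
        rw [← mul_assoc, ← ENNReal.ofReal_mul (by positivity), inv_mul_cancel₀ hc.ne']; simp
    _ ≤ _ := by gcongr

end

section
variable {d : ℕ}

local notation "𝔼" => EuclideanSpace ℝ (Fin d)

/-! ### Translations -/

/-- The field g(· − a) h/‖h‖ is admissible, and its divergence is the derivative of g(· − a) in the
direction h/‖h‖. -/
lemma integral_mul_fderiv_le {f : 𝔼 → ℝ} (hTV : totalVariation f ≠ ∞) {g : 𝔼 → ℝ}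
    (hg : ContDiff ℝ 1 g) (hgs : HasCompactSupport g) (hg1 : ∀ x, |g x| ≤ 1) (a h : 𝔼) :
    ∫ x, f x * fderiv ℝ g (x - a) h ≤ ‖h‖ * (totalVariation f).toReal := by
  by_cases hh : h = 0
  · simp [hh]
  have hpos : 0 < ‖h‖ := norm_pos_iff.2 hh
  have hga : ContDiff ℝ 1 (fun x => g (x - a)) := hg.comp (contDiff_id.sub contDiff_const)
  have hX : IsTestField (Metric.closedBall 0 1) (fun x => g (x - a) • (‖h‖⁻¹ • h)) := by
    refine ⟨hga.smul contDiff_const, ?_, fun x => ?_⟩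
    · refine HasCompactSupport.smul_right (f := fun x => g (x - a)) ?_
      exact hgs.comp_homeomorph (Homeomorph.subRight a)
    · rw [mem_closedBall_zero_iff, norm_smul, norm_smul, norm_inv, norm_norm,
        inv_mul_cancel₀ hpos.ne', mul_one]
      exact hg1 _
  have h1 := hX.integral_le hTV
  have h2 : ∀ x, divergence (fun x => g (x - a) • (‖h‖⁻¹ • h)) x
      = ‖h‖⁻¹ * fderiv ℝ g (x - a) h := by
    intro x
    rw [divergence_smul_const (hga.differentiable one_ne_zero), fderiv_comp_sub, map_smul, smul_eq_mul]
  simp only [h2] at h1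
  have h3 : ∫ x, f x * (‖h‖⁻¹ * fderiv ℝ g (x - a) h)
      = ‖h‖⁻¹ * ∫ x, f x * fderiv ℝ g (x - a) h := by
    rw [← integral_const_mul]; congr 1; ext x; ring
  rw [h3, inv_mul_le_iff₀ hpos] at h1
  exact h1

/-- Mean value inequality for s ↦ ∫ f(x) g(x − s h) dx on [0, 1], whose derivative is bounded by
`integral_mul_fderiv_le` applied to −h. -/
lemma integral_mul_translate_sub_le {f : 𝔼 → ℝ} (hf : Integrable f) (hTV : totalVariation f ≠ ∞)
    {g : 𝔼 → ℝ} (hg : ContDiff ℝ 1 g) (hgs : HasCompactSupport g) (hg1 : ∀ x, |g x| ≤ 1) (h : 𝔼) :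
    ∫ x, f x * (g (x - h) - g x) ≤ ‖h‖ * (totalVariation f).toReal := by
  have hgd : Differentiable ℝ g := hg.differentiable one_ne_zero
  have hcf : Continuous (fderiv ℝ g) := hg.continuous_fderiv one_ne_zero
  obtain ⟨L, hL⟩ := (hgs.fderiv ℝ).exists_bound_of_continuous hcf
  have hint : ∀ a : 𝔼, Integrable fun x => f x * g (x - a) := fun a =>
    hf.mul_bdd (c := 1) (hg.continuous.comp (continuous_id.sub continuous_const)).aestronglyMeasurable
      (Eventually.of_forall fun x => hg1 _)
  have hder : ∀ s : ℝ, HasDerivAt (fun s : ℝ => ∫ x, f x * g (x - s • h))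
      (∫ x, f x * fderiv ℝ g (x - s • h) (-h)) s := by
    intro s
    refine (hasDerivAt_integral_of_dominated_loc_of_deriv_le (s := univ)
      (F := fun s x => f x * g (x - s • h))
      (F' := fun s x => f x * fderiv ℝ g (x - s • h) (-h))
      (bound := fun x => |f x| * (L * ‖h‖)) univ_mem (Eventually.of_forall fun t => (hint _).1)
      (hint _) ?_ ?_ (hf.abs.mul_const _) ?_).2
    · refine hf.1.mul (Continuous.aestronglyMeasurable ?_)
      exact (hcf.comp (continuous_id.sub continuous_const)).clm_apply continuous_const
    · refine Eventually.of_forall fun x t _ => ?_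
      rw [norm_mul, Real.norm_eq_abs]
      gcongr
      refine ((fderiv ℝ g _).le_opNorm _).trans ?_
      rw [norm_neg]
      gcongr
      exact hL _
    · refine Eventually.of_forall fun x t _ => HasDerivAt.const_mul _ ?_
      have h1 : HasDerivAt (fun s : ℝ => x - s • h) (-h) t := by
        simpa using ((hasDerivAt_id t).smul_const h).const_sub x
      exact (hgd (x - t • h)).hasFDerivAt.comp_hasDerivAt t h1
  have key := image_sub_le_mul_sub_of_deriv_le (fun s => (hder s).differentiableAt)
    (C := ‖h‖ * (totalVariation f).toReal) (fun s => by
      rw [(hder s).deriv]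
      simpa using integral_mul_fderiv_le hTV hg hgs hg1 (s • h) (-h)) (zero_le_one (α := ℝ))
  simp only [one_smul, zero_smul, sub_zero, mul_one] at key
  refine le_trans (le_of_eq ?_) key
  have h0 := hint 0
  simp only [sub_zero] at h0
  rw [← integral_sub (hint h) h0]
  congr 1; ext x; ring

/-- Mollify, then multiply by an expanding cutoff. This lets a merely measurable bounded function
play the role of g in the translation estimate. -/
lemma exists_contDiff_tendsto_ae {w : 𝔼 → ℝ} (hw : Integrable w) (hw1 : ∀ x, |w x| ≤ 1) :
    ∃ g : ℕ → 𝔼 → ℝ, (∀ k, ContDiff ℝ 1 (g k)) ∧ (∀ k, HasCompactSupport (g k)) ∧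
      (∀ k x, |g k x| ≤ 1) ∧ ∀ᵐ x, Tendsto (fun k => g k x) atTop (𝓝 (w x)) := by
  -- The ratio 2 of outer to inner radius is kept fixed, as Lebesgue differentiation along these
  -- kernels requires (`K := 2` below).
  let ρ : ℕ → ContDiffBump (0 : 𝔼) := fun k =>
    ⟨1 / (k + 1 : ℝ), 2 * (1 / (k + 1 : ℝ)), by positivity, by
      have : (0 : ℝ) < 1 / (k + 1 : ℝ) := by positivity
      linarith⟩
  let ζ : ℕ → ContDiffBump (0 : 𝔼) := fun k => ⟨k + 1, k + 2, by positivity, by linarith⟩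
  let c : ℕ → 𝔼 → ℝ := fun k =>
    MeasureTheory.convolution ((ρ k).normed volume) w (ContinuousLinearMap.lsmul ℝ ℝ) volume
  have hc : ∀ k x, |c k x| ≤ 1 := by
    intro k x
    have h1 : ‖c k x‖ ≤ ∫ t, (ρ k).normed volume t := by
      refine norm_integral_le_of_norm_le (ρ k).integrable_normed (Eventually.of_forall fun t => ?_)
      simp only [ContinuousLinearMap.lsmul_apply, norm_smul]
      rw [Real.norm_of_nonneg ((ρ k).nonneg_normed t)]
      exact mul_le_of_le_one_right ((ρ k).nonneg_normed t) (hw1 _)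
    rwa [(ρ k).integral_normed] at h1
  refine ⟨fun k x => ζ k x * c k x, fun k => ?_, fun k => ?_, fun k x => ?_, ?_⟩
  · refine (ζ k).contDiff.mul ?_
    exact (ρ k).hasCompactSupport_normed.contDiff_convolution_left (n := 1) _ (ρ k).contDiff_normed
      hw.locallyIntegrable
  · exact (ζ k).hasCompactSupport.mul_right
  · rw [abs_mul]
    refine mul_le_one₀ ?_ (abs_nonneg _) (hc k x)
    rw [abs_of_nonneg (ζ k).nonneg]; exact (ζ k).le_one
  · have hr : Tendsto (fun k => (ρ k).rOut) atTop (𝓝 0) := by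
      have := (tendsto_one_div_add_atTop_nhds_zero_nat (𝕜 := ℝ)).const_mul 2
      rwa [mul_zero] at this
    filter_upwards [ContDiffBump.ae_convolution_tendsto_right_of_locallyIntegrable (K := 2) hr
      (Eventually.of_forall fun k => le_rfl) hw.locallyIntegrable] with x hx
    refine Tendsto.congr' ?_ hx
    obtain ⟨m, hm⟩ := exists_nat_ge ‖x‖
    filter_upwards [eventually_ge_atTop m] with k hk
    have : ζ k x = 1 := by
      refine (ζ k).one_of_mem_closedBall ?_
      rw [mem_closedBall_zero_iff]
      have : (m : ℝ) ≤ k := by exact_mod_cast hk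
      change ‖x‖ ≤ (k : ℝ) + 1
      linarith
    rw [this, one_mul]

/-- By duality: g is taken to approximate the difference of the translate and the original. That
difference has values in {−1, 0, 1}, so its square is its modulus and the pairing tends to the L¹
norm. -/
lemma lintegral_translate_sub_le {E : Set 𝔼} (hE : NullMeasurableSet E) (hv : volume E < ∞)
    (hTV : totalVariation (chi E) ≠ ∞) (h : 𝔼) :
    ∫⁻ x, ‖chi E (x + h) - chi E x‖ₑ ≤ ENNReal.ofReal ‖h‖ * totalVariation (chi E) := by
  have hf := integrable_chi hE hv
  have hfh : Integrable fun x => chi E (x + h) := hf.comp_add_right h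
  have hw : Integrable fun x => chi E (x + h) - chi E x := hfh.sub hf
  have hcases : ∀ x, (chi E (x + h) - chi E x) * (chi E (x + h) - chi E x)
      = |chi E (x + h) - chi E x| := by
    intro x
    by_cases h1 : x ∈ E <;> by_cases h2 : x + h ∈ E <;> simp [chi, h1, h2]
  have hw1 : ∀ x, |chi E (x + h) - chi E x| ≤ 1 := by
    intro x
    by_cases h1 : x ∈ E <;> by_cases h2 : x + h ∈ E <;> simp [chi, h1, h2]
  obtain ⟨g, hg, hgs, hg1, hlim⟩ := exists_contDiff_tendsto_ae hw hw1
  have hkey : ∀ k, ∫ x, (chi E (x + h) - chi E x) * g k x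
      ≤ ‖h‖ * (totalVariation (chi E)).toReal := by
    intro k
    have hb : ∀ {f : 𝔼 → ℝ}, Integrable f → ∀ a : 𝔼, Integrable fun x => f x * g k (x + a) :=
      fun hf a => hf.mul_bdd (c := 1)
        ((hg k).continuous.comp (continuous_id.add continuous_const)).aestronglyMeasurable
        (Eventually.of_forall fun x => hg1 k _)
    refine le_trans (le_of_eq ?_) (integral_mul_translate_sub_le hf hTV (hg k) (hgs k) (hg1 k) h)
    have e1 : ∫ x, chi E (x + h) * g k x = ∫ x, chi E x * g k (x - h) := by
      rw [← integral_add_right_eq_self (fun x => chi E x * g k (x - h)) h]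
      simp
    have i1 : Integrable fun x => chi E (x + h) * g k x := by simpa using hb hfh 0
    have i2 : Integrable fun x => chi E x * g k x := by simpa using hb hf 0
    have i3 : Integrable fun x => chi E x * g k (x - h) := by
      simpa [sub_eq_add_neg] using hb hf (-h)
    simp only [sub_mul, mul_sub]
    rw [integral_sub i1 i2, integral_sub i3 i2, e1]
  have hconv : Tendsto (fun k => ∫ x, (chi E (x + h) - chi E x) * g k x) atTop
      (𝓝 (∫ x, |chi E (x + h) - chi E x|)) := by
    refine tendsto_integral_of_dominated_convergence (fun x => |chi E (x + h) - chi E x|)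
      (fun k => hw.1.mul (hg k).continuous.aestronglyMeasurable) hw.abs (fun k => ?_) ?_
    · refine Eventually.of_forall fun x => ?_
      rw [norm_mul, Real.norm_eq_abs]
      exact mul_le_of_le_one_right (abs_nonneg _) (hg1 k x)
    · filter_upwards [hlim] with x hx
      rw [← hcases]
      exact hx.const_mul _
  have hfin := le_of_tendsto' hconv hkey
  have h1 : ∫⁻ x, ‖chi E (x + h) - chi E x‖ₑ
      = ENNReal.ofReal (∫ x, |chi E (x + h) - chi E x|) := by
    rw [ofReal_integral_eq_lintegral_ofReal hw.abs (Eventually.of_forall fun x => abs_nonneg _)]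
    refine lintegral_congr fun x => ?_
    rw [← Real.norm_eq_abs, ofReal_norm]
  rw [h1]
  calc ENNReal.ofReal (∫ x, |chi E (x + h) - chi E x|)
      ≤ ENNReal.ofReal (‖h‖ * (totalVariation (chi E)).toReal) := ENNReal.ofReal_le_ofReal hfin
    _ = _ := by rw [ENNReal.ofReal_mul (norm_nonneg _), ENNReal.ofReal_toReal hTV]

/-! ### An isoperimetric inequality -/

/-- For each h, |E| is at most the translation error plus |E ∩ (E − h)|. Integrating over ‖h‖ ≤ r,
the first term is controlled by the total variation, while the integral of the second over all h is
|E|² by Tonelli. -/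
lemma volume_mul_volume_ball_le {E : Set 𝔼} (hE : MeasurableSet E) (hv : volume E < ∞)
    (hTV : totalVariation (chi E) ≠ ∞) {r : ℝ} :
    volume E * volume (Metric.closedBall (0 : 𝔼) r)
      ≤ volume (Metric.closedBall (0 : 𝔼) r) * (ENNReal.ofReal r * totalVariation (chi E))
        + volume E * volume E := by
  have hm : Measurable (E.indicator (1 : 𝔼 → ℝ≥0∞)) := measurable_one.indicator hE
  have hmc : Measurable (chi E) := measurable_const.indicator hE
  have hm2 : Measurable fun p : 𝔼 × 𝔼 =>
      E.indicator (1 : 𝔼 → ℝ≥0∞) p.2 * E.indicator (1 : 𝔼 → ℝ≥0∞) (p.2 + p.1) :=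
    (hm.comp measurable_snd).mul (hm.comp (measurable_snd.add measurable_fst))
  have hpt : ∀ h x : 𝔼, E.indicator (1 : 𝔼 → ℝ≥0∞) x ≤ ‖chi E (x + h) - chi E x‖ₑ
      + E.indicator (1 : 𝔼 → ℝ≥0∞) x * E.indicator (1 : 𝔼 → ℝ≥0∞) (x + h) := by
    intro h x
    by_cases h1 : x ∈ E <;> by_cases h2 : x + h ∈ E <;> simp [chi, h1, h2]
  have hstep : ∀ h : 𝔼, ‖h‖ ≤ r → volume E ≤ ENNReal.ofReal r * totalVariation (chi E)
      + ∫⁻ x, E.indicator (1 : 𝔼 → ℝ≥0∞) x * E.indicator (1 : 𝔼 → ℝ≥0∞) (x + h) := by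
    intro h hh
    calc volume E = ∫⁻ x, E.indicator (1 : 𝔼 → ℝ≥0∞) x := (lintegral_indicator_one hE).symm
      _ ≤ ∫⁻ x, (‖chi E (x + h) - chi E x‖ₑ
          + E.indicator (1 : 𝔼 → ℝ≥0∞) x * E.indicator (1 : 𝔼 → ℝ≥0∞) (x + h)) :=
          lintegral_mono (hpt h)
      _ = (∫⁻ x, ‖chi E (x + h) - chi E x‖ₑ)
          + ∫⁻ x, E.indicator (1 : 𝔼 → ℝ≥0∞) x * E.indicator (1 : 𝔼 → ℝ≥0∞) (x + h) := by
          refine lintegral_add_left ?_ _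
          exact ((hmc.comp (measurable_id.add measurable_const)).sub hmc).enorm
      _ ≤ _ := by
          gcongr
          refine (lintegral_translate_sub_le hE.nullMeasurableSet hv hTV h).trans ?_
          gcongr
  calc volume E * volume (Metric.closedBall (0 : 𝔼) r)
      = ∫⁻ h in Metric.closedBall (0 : 𝔼) r, volume E := by simp
    _ ≤ ∫⁻ h in Metric.closedBall (0 : 𝔼) r, (ENNReal.ofReal r * totalVariation (chi E)
      + ∫⁻ x, E.indicator (1 : 𝔼 → ℝ≥0∞) x * E.indicator (1 : 𝔼 → ℝ≥0∞) (x + h)) := by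
        refine setLIntegral_mono' Metric.isClosed_closedBall.measurableSet fun h hh => hstep h ?_
        simpa using hh
    _ = volume (Metric.closedBall (0 : 𝔼) r) * (ENNReal.ofReal r * totalVariation (chi E))
      + ∫⁻ h in Metric.closedBall (0 : 𝔼) r,
        ∫⁻ x, E.indicator (1 : 𝔼 → ℝ≥0∞) x * E.indicator (1 : 𝔼 → ℝ≥0∞) (x + h) := by
        rw [lintegral_add_left measurable_const]
        simp [mul_comm]
    _ ≤ volume (Metric.closedBall (0 : 𝔼) r) * (ENNReal.ofReal r * totalVariation (chi E))
      + ∫⁻ h, ∫⁻ x, E.indicator (1 : 𝔼 → ℝ≥0∞) x * E.indicator (1 : 𝔼 → ℝ≥0∞) (x + h) := by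
        gcongr
        exact Measure.restrict_le_self
    _ = _ := by
        congr 1
        rw [lintegral_lintegral_swap hm2.aemeasurable]
        calc ∫⁻ x, ∫⁻ h, E.indicator (1 : 𝔼 → ℝ≥0∞) x * E.indicator (1 : 𝔼 → ℝ≥0∞) (x + h)
            = ∫⁻ x, E.indicator (1 : 𝔼 → ℝ≥0∞) x * volume E := by
              refine lintegral_congr fun x => ?_
              have hmx : Measurable fun h => E.indicator (1 : 𝔼 → ℝ≥0∞) (x + h) :=
                hm.comp (measurable_const.add measurable_id)
              rw [lintegral_const_mul _ hmx,
                lintegral_add_left_eq_self (fun h => E.indicator (1 : 𝔼 → ℝ≥0∞) h) x,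
                lintegral_indicator_one hE]
          _ = volume E * volume E := by
              rw [lintegral_mul_const _ hm, lintegral_indicator_one hE]

/-- With r chosen so that the ball of radius r has volume 2|E|, the quadratic term of
`volume_mul_volume_ball_le` is absorbed into the left side, leaving |E| ≤ 2 r P. Dividing the volume
of the ball by r gives the last inequality. -/
lemma exists_isoperimetric_radius (hd : d ≠ 0) {E : Set 𝔼} (hE : NullMeasurableSet E)
    (hv : volume E < ∞) (h0 : volume E ≠ 0) (hTV : totalVariation (chi E) ≠ ∞) :
    ∃ r : ℝ, 0 < r ∧ volume.real (Metric.ball (0 : 𝔼) 1) * r ^ d = 2 * volume.real E ∧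
      volume.real (Metric.ball (0 : 𝔼) 1) * r ^ (d - 1) ≤ 4 * (totalVariation (chi E)).toReal := by
  obtain ⟨E', -, hE', hEE'⟩ := hE.exists_measurable_superset_ae_eq
  have hTVE : totalVariation (chi E) = totalVariation (chi E') :=
    variationOver_congr_ae _ (chi_congr_ae hEE'.symm)
  rw [hTVE] at hTV ⊢
  have hvE : volume.real E = volume.real E' := measureReal_congr hEE'.symm
  rw [hvE]
  rw [← measure_congr hEE'] at hv h0
  set ω := volume.real (Metric.ball (0 : 𝔼) 1) with hω
  set m := volume.real E' with hm
  set P := (totalVariation (chi E')).toReal with hP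
  have hω0 : 0 < ω := ENNReal.toReal_pos (Metric.measure_ball_pos _ _ one_pos).ne'
    measure_ball_lt_top.ne
  have hm0 : 0 < m := ENNReal.toReal_pos h0 hv.ne
  refine ⟨(2 * m / ω) ^ ((d : ℝ)⁻¹), by positivity, ?_, ?_⟩
  · rw [Real.rpow_inv_natCast_pow (by positivity) hd]
    field_simp
  set r := (2 * m / ω) ^ ((d : ℝ)⁻¹) with hr
  have hr0 : 0 < r := by positivity
  have hrd : ω * r ^ d = 2 * m := by
    rw [hr, Real.rpow_inv_natCast_pow (by positivity) hd]
    field_simp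
  have hball : volume.real (Metric.closedBall (0 : 𝔼) r) = ω * r ^ d := by
    rw [measureReal_def, Measure.addHaar_closedBall _ _ hr0.le, ENNReal.toReal_mul,
      ENNReal.toReal_ofReal (by positivity), finrank_euclideanSpace_fin, mul_comm]
    rfl
  have key := volume_mul_volume_ball_le hE' hv hTV (r := r)
  have key' : m * (ω * r ^ d) ≤ (ω * r ^ d) * (r * P) + m * m := by
    have f1 : volume (Metric.closedBall (0 : 𝔼) r) *
        (ENNReal.ofReal r * totalVariation (chi E')) ≠ ∞ :=
      ENNReal.mul_ne_top measure_closedBall_lt_top.ne (ENNReal.mul_ne_top ENNReal.ofReal_ne_top hTV)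
    have f2 : volume E' * volume E' ≠ ∞ := ENNReal.mul_ne_top hv.ne hv.ne
    have h := ENNReal.toReal_mono (ENNReal.add_ne_top.2 ⟨f1, f2⟩) key
    rw [ENNReal.toReal_add f1 f2] at h
    simp only [ENNReal.toReal_mul, ENNReal.toReal_ofReal hr0.le] at h
    rw [← hball]
    exact h
  rw [hrd] at key'
  have h1 : m ≤ 2 * (r * P) := by
    by_contra! hlt
    nlinarith
  have h2 : r * (ω * r ^ (d - 1)) = ω * r ^ d := by
    conv_rhs => rw [← Nat.sub_add_cancel (Nat.one_le_iff_ne_zero.2 hd), pow_succ]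
    ring
  have h3 : r * (ω * r ^ (d - 1)) ≤ r * (4 * P) := by
    rw [h2, hrd]; linarith
  exact le_of_mul_le_mul_left h3 hr0

/-- In dimension at least two, the volume is bounded in terms of the perimeter. -/
lemma exists_volume_bound (hd : 2 ≤ d) (M : ℝ) : ∃ V : ℝ≥0, ∀ E : Set 𝔼, NullMeasurableSet E →
    volume E < ∞ → totalVariation (chi E) ≤ ENNReal.ofReal M → volume E ≤ V := by
  set ω := volume.real (Metric.ball (0 : 𝔼) 1) with hω
  have hω0 : 0 < ω := ENNReal.toReal_pos (Metric.measure_ball_pos _ _ one_pos).ne'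
    measure_ball_lt_top.ne
  refine ⟨Real.toNNReal (ω * (max 1 (4 * max M 0 / ω)) ^ d / 2), fun E hE hv hTV => ?_⟩
  by_cases h0 : volume E = 0
  · simp [h0]
  have hTV' : totalVariation (chi E) ≠ ∞ := (hTV.trans_lt ENNReal.ofReal_lt_top).ne
  obtain ⟨r, hr0, h1, h2⟩ := exists_isoperimetric_radius (by omega) hE hv h0 hTV'
  have hP : (totalVariation (chi E)).toReal ≤ max M 0 := by
    have := ENNReal.toReal_mono ENNReal.ofReal_ne_top hTV
    rwa [ENNReal.toReal_ofReal'] at this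
  have hr : r ≤ max 1 (4 * max M 0 / ω) := by
    rcases le_total r 1 with h | h
    · exact le_max_of_le_left h
    · refine le_max_of_le_right ?_
      rw [le_div_iff₀ hω0]
      -- Here d ≥ 2 enters: on the line the power is 1 and the perimeter gives no bound on r.
      have : r ≤ r ^ (d - 1) := le_self_pow₀ h (by omega)
      nlinarith
  rw [← ENNReal.ofReal_toReal hv.ne]
  refine ENNReal.ofReal_le_ofReal ?_
  change volume.real E ≤ _
  have : r ^ d ≤ (max 1 (4 * max M 0 / ω)) ^ d := by gcongr
  nlinarith

/-- On the line, sets of finite volume and small perimeter are negligible. -/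
lemma exists_volume_eq_zero_of_dim_one (hd : d = 1) : ∃ c : ℝ, 0 < c ∧ ∀ E : Set 𝔼,
    NullMeasurableSet E → volume E < ∞ → totalVariation (chi E) < ENNReal.ofReal c →
      volume E = 0 := by
  set ω := volume.real (Metric.ball (0 : 𝔼) 1) with hω
  have hω0 : 0 < ω := ENNReal.toReal_pos (Metric.measure_ball_pos _ _ one_pos).ne'
    measure_ball_lt_top.ne
  refine ⟨ω / 4, by positivity, fun E hE hv hTV => ?_⟩
  by_contra h0
  have hTV' : totalVariation (chi E) ≠ ∞ := (hTV.trans ENNReal.ofReal_lt_top).ne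
  obtain ⟨r, hr0, -, h2⟩ := exists_isoperimetric_radius (by omega) hE hv h0 hTV'
  have := (ENNReal.lt_ofReal_iff_toReal_lt hTV').1 hTV
  subst hd
  -- For d = 1 the power of r disappears, so a non-negligible set has perimeter at least ω / 4
  -- whatever its volume.
  simp only [Nat.sub_self, pow_zero, mul_one] at h2
  linarith

end

section
variable {d : ℕ}

local notation "𝔼" => EuclideanSpace ℝ (Fin d)

/-! ### Lower semicontinuity -/

/-- For a fixed test field the integral is continuous under a.e. convergence, dominated by the
modulus of the divergence; a supremum of continuous functionals is lower semicontinuous. -/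
lemma variationOver_chi_le_of_tendsto {K : Set 𝔼} {F : ℕ → Set 𝔼} {G : Set 𝔼}
    (hF : ∀ n, NullMeasurableSet (F n))
    (hlim : ∀ᵐ x, Tendsto (fun n => chi (F n) x) atTop (𝓝 (chi G x))) {a : ℕ → ℝ≥0∞} {p : ℝ≥0∞}
    (ha : ∀ n, variationOver K (chi (F n)) ≤ a n) (hp : Tendsto a atTop (𝓝 p)) :
    variationOver K (chi G) ≤ p := by
  refine variationOver_le fun X hX => ?_
  have hconv : Tendsto (fun n => ∫ x, chi (F n) x * divergence X x) atTop
      (𝓝 (∫ x, chi G x * divergence X x)) := by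
    refine tendsto_integral_of_dominated_convergence (fun x => |divergence X x|)
      (fun n => (hX.integrable_chi_mul (hF n)).1) hX.integrable_divergence.abs (fun n => ?_) ?_
    · refine Eventually.of_forall fun x => ?_
      rw [norm_mul, Real.norm_eq_abs, Real.norm_eq_abs]
      exact mul_le_of_le_one_left (abs_nonneg _) (abs_chi_le _ x)
    · filter_upwards [hlim] with x hx using hx.mul_const _
  exact le_of_tendsto_of_tendsto' (ENNReal.continuous_ofReal.continuousAt.tendsto.comp hconv) hp
    fun n => (hX.ofReal_integral_le _).trans (ha n)

lemma lintegral_enorm_chi {E : Set 𝔼} (hE : NullMeasurableSet E) :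
    ∫⁻ x, ‖chi E x‖ₑ = volume E := by
  rw [← eLpNorm_one_eq_lintegral_enorm, eLpNorm_chi hE]

/-- Fatou's lemma; mass may be lost at infinity. -/
lemma volume_le_of_tendsto {F : ℕ → Set 𝔼} {G : Set 𝔼} (hF : ∀ n, NullMeasurableSet (F n))
    (hG : NullMeasurableSet G)
    (hlim : ∀ᵐ x, Tendsto (fun n => chi (F n) x) atTop (𝓝 (chi G x))) {a : ℕ → ℝ≥0∞} {p : ℝ≥0∞}
    (ha : ∀ n, volume (F n) ≤ a n) (hp : Tendsto a atTop (𝓝 p)) : volume G ≤ p := by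
  calc volume G = ∫⁻ x, ‖chi G x‖ₑ := (lintegral_enorm_chi hG).symm
    _ = ∫⁻ x, liminf (fun n => ‖chi (F n) x‖ₑ) atTop := by
        refine lintegral_congr_ae ?_
        filter_upwards [hlim] with x hx
        exact ((continuous_enorm.tendsto _).comp hx).liminf_eq.symm
    _ ≤ liminf (fun n => ∫⁻ x, ‖chi (F n) x‖ₑ) atTop :=
        lintegral_liminf_le' fun n => (aestronglyMeasurable_chi (hF n)).enorm
    _ ≤ liminf a atTop := by
        refine liminf_le_liminf (Eventually.of_forall fun n => ?_)
        rw [lintegral_enorm_chi (hF n)]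
        exact ha n
    _ = p := hp.liminf_eq

lemma tendsto_chi_symmDiff {F : ℕ → Set 𝔼} {G E : Set 𝔼} {x : 𝔼}
    (h : Tendsto (fun n => chi (F n) x) atTop (𝓝 (chi G x))) :
    Tendsto (fun n => chi (symmDiff E (F n)) x) atTop (𝓝 (chi (symmDiff E G) x)) := by
  simp only [← abs_chi_sub]
  exact (h.const_sub _).abs

lemma tendsto_chi_inter {F : ℕ → Set 𝔼} {G E : Set 𝔼} {x : 𝔼}
    (h : Tendsto (fun n => chi (F n) x) atTop (𝓝 (chi G x))) :
    Tendsto (fun n => chi (F n ∩ E) x) atTop (𝓝 (chi (G ∩ E) x)) := by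
  have : ∀ A : Set 𝔼, chi (A ∩ E) x = chi A x * chi E x := by
    intro A
    by_cases h1 : x ∈ A <;> by_cases h2 : x ∈ E <;> simp [chi, h1, h2]
  simp only [this]
  exact h.mul_const _

/-! ### Compactness -/

/-- The mollification of `f` with a bump function. -/
noncomputable def mollify (ρ : ContDiffBump (0 : 𝔼)) (f : 𝔼 → ℝ) (x : 𝔼) : ℝ :=
  ∫ t, f t * ρ.normed volume (x - t)

lemma mollify_eq_convolution (ρ : ContDiffBump (0 : 𝔼)) (f : 𝔼 → ℝ) :
    mollify ρ f = MeasureTheory.convolution (ρ.normed volume) f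
      (ContinuousLinearMap.lsmul ℝ ℝ) volume := by
  ext x
  rw [convolution_eq_swap]
  simp [mollify, mul_comm]

lemma continuous_mollify (ρ : ContDiffBump (0 : 𝔼)) {f : 𝔼 → ℝ} (hf : LocallyIntegrable f) :
    Continuous (mollify ρ f) := by
  rw [mollify_eq_convolution]
  exact ρ.hasCompactSupport_normed.continuous_convolution_left _ ρ.continuous_normed hf

lemma integral_normed_sub (ρ : ContDiffBump (0 : 𝔼)) (x : 𝔼) :
    ∫ t, ρ.normed volume (x - t) = 1 := by
  rw [integral_sub_left_eq_self (fun t => ρ.normed volume t) volume x, ρ.integral_normed]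

lemma integrable_normed_sub (ρ : ContDiffBump (0 : 𝔼)) (x : 𝔼) :
    Integrable fun t => ρ.normed volume (x - t) :=
  ρ.integrable_normed.comp_sub_left x

lemma abs_mollify_le (ρ : ContDiffBump (0 : 𝔼)) {f : 𝔼 → ℝ} (hf : ∀ x, |f x| ≤ 1) (x : 𝔼) :
    |mollify ρ f x| ≤ 1 := by
  rw [← integral_normed_sub ρ x, ← Real.norm_eq_abs, mollify]
  refine norm_integral_le_of_norm_le (integrable_normed_sub ρ x) (Eventually.of_forall fun t => ?_)
  rw [norm_mul, Real.norm_of_nonneg (ρ.nonneg_normed _)]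
  exact mul_le_of_le_one_left (ρ.nonneg_normed _) (hf t)

/-- The mollification error is at most an average of translation errors over vectors shorter than
the outer radius; apply Tonelli and `lintegral_translate_sub_le`. The bound depends on the set only
through its variation. -/
lemma lintegral_mollify_sub_le (ρ : ContDiffBump (0 : 𝔼)) {E : Set 𝔼} (hE : MeasurableSet E)
    (hv : volume E < ∞) (hTV : totalVariation (chi E) ≠ ∞) :
    ∫⁻ x, ‖mollify ρ (chi E) x - chi E x‖ₑ
      ≤ ENNReal.ofReal ρ.rOut * totalVariation (chi E) := by
  have hmc : Measurable (chi E) := measurable_const.indicator hE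
  have hmρ : Measurable fun t => ENNReal.ofReal (ρ.normed volume t) :=
    ρ.continuous_normed.measurable.ennreal_ofReal
  have hpt : ∀ x, ‖mollify ρ (chi E) x - chi E x‖ₑ
      ≤ ∫⁻ t, ENNReal.ofReal (ρ.normed volume t) * ‖chi E (x + -t) - chi E x‖ₑ := by
    intro x
    have e0 : mollify ρ (chi E) x = ∫ t, chi E (x + -t) * ρ.normed volume t := by
      rw [mollify, ← integral_sub_left_eq_self _ volume x]
      simp [sub_eq_add_neg]
    have e1 : mollify ρ (chi E) x - chi E x
        = ∫ t, (chi E (x + -t) - chi E x) * ρ.normed volume t := by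
      have i1 : Integrable fun t => chi E (x + -t) * ρ.normed volume t :=
        ρ.integrable_normed.bdd_mul (c := 1)
          (hmc.comp (measurable_const.add measurable_neg)).aestronglyMeasurable
          (Eventually.of_forall fun t => abs_chi_le E _)
      simp only [sub_mul]
      rw [integral_sub i1 (ρ.integrable_normed.const_mul _), integral_const_mul, ρ.integral_normed,
        mul_one, e0]
    rw [e1]
    refine (enorm_integral_le_lintegral_enorm _).trans (lintegral_mono fun t => ?_)
    rw [enorm_mul, mul_comm, Real.enorm_of_nonneg (ρ.nonneg_normed t)]
  have hm2 : Measurable fun p : 𝔼 × 𝔼 =>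
      ENNReal.ofReal (ρ.normed volume p.2) * ‖chi E (p.1 + -p.2) - chi E p.1‖ₑ := by
    refine (hmρ.comp measurable_snd).mul ?_
    exact ((hmc.comp (measurable_fst.add measurable_snd.neg)).sub
      (hmc.comp measurable_fst)).enorm
  calc ∫⁻ x, ‖mollify ρ (chi E) x - chi E x‖ₑ
      ≤ ∫⁻ x, ∫⁻ t, ENNReal.ofReal (ρ.normed volume t) * ‖chi E (x + -t) - chi E x‖ₑ :=
        lintegral_mono hpt
    _ = ∫⁻ t, ∫⁻ x, ENNReal.ofReal (ρ.normed volume t) * ‖chi E (x + -t) - chi E x‖ₑ :=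
        lintegral_lintegral_swap hm2.aemeasurable
    _ ≤ ∫⁻ t, ENNReal.ofReal (ρ.normed volume t)
          * (ENNReal.ofReal ρ.rOut * totalVariation (chi E)) := by
        refine lintegral_mono fun t => ?_
        have hmx : Measurable fun x => ‖chi E (x + -t) - chi E x‖ₑ :=
          ((hmc.comp (measurable_id.add measurable_const)).sub hmc).enorm
        rw [lintegral_const_mul _ hmx]
        by_cases ht : ρ.normed volume t = 0
        · simp [ht]
        · have ht' : t ∈ Function.support (ρ.normed volume) := ht
          rw [ρ.support_normed_eq, mem_ball_zero_iff] at ht'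
          gcongr
          refine (lintegral_translate_sub_le hE.nullMeasurableSet hv hTV (-t)).trans ?_
          rw [norm_neg]
          gcongr
    _ = _ := by
        rw [lintegral_mul_const _ hmρ, ← ofReal_integral_eq_lintegral_ofReal ρ.integrable_normed
          (Eventually.of_forall ρ.nonneg_normed), ρ.integral_normed]
        simp

/-- Sequential Banach–Alaoglu, transported from the dual by the Riesz isomorphism. -/
lemma exists_subseq_tendsto_inner {H : Type*} [NormedAddCommGroup H] [InnerProductSpace ℝ H]
    [CompleteSpace H] [TopologicalSpace.SeparableSpace H] {f : ℕ → H} {C : ℝ}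
    (hf : ∀ n, ‖f n‖ ≤ C) : ∃ (g : H) (φ : ℕ → ℕ), StrictMono φ ∧
      ∀ h : H, Tendsto (fun n => inner ℝ (f (φ n)) h) atTop (𝓝 (inner ℝ g h)) := by
  let u : ℕ → WeakDual ℝ H := fun n =>
    StrongDual.toWeakDual (InnerProductSpace.toDual ℝ H (f n) : StrongDual ℝ H)
  have hmem : ∀ n, u n ∈ (fun y : WeakDual ℝ H => (WeakDual.toStrongDual y : StrongDual ℝ H)) ⁻¹'
      Metric.closedBall (0 : StrongDual ℝ H) C := by
    intro n
    rw [mem_preimage, mem_closedBall_zero_iff]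
    exact ((InnerProductSpace.toDual ℝ H).norm_map (f n)).le.trans (hf n)
  obtain ⟨ℓ, -, φ, hφ, hlim⟩ := WeakDual.isSeqCompact_closedBall ℝ H 0 C hmem
  refine ⟨(InnerProductSpace.toDual ℝ H).symm (WeakDual.toStrongDual ℓ), φ, hφ, fun h => ?_⟩
  rw [InnerProductSpace.toDual_symm_apply]
  exact ((WeakDual.eval_continuous h).tendsto ℓ).comp hlim

/-- Against a finite measure with the same null sets, uniformly bounded functions that converge a.e.
also converge in L¹, with a constant as dominating function; bounds of integrals against Lebesgue
measure remain valid. -/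
lemma exists_finite_measure_le_volume : ∃ μ : Measure 𝔼, IsFiniteMeasure μ ∧ μ ≤ volume ∧
    (volume : Measure 𝔼) ≪ μ := by
  obtain ⟨g, hg0, hgm, hg⟩ := exists_pos_lintegral_lt_of_sigmaFinite (volume : Measure 𝔼)
    (one_ne_zero (α := ℝ≥0∞))
  have hwm : Measurable fun x => min (g x : ℝ≥0∞) 1 := hgm.coe_nnreal_ennreal.min measurable_const
  refine ⟨volume.withDensity fun x => min (g x : ℝ≥0∞) 1, ?_, ?_, ?_⟩
  · refine isFiniteMeasure_withDensity ?_
    exact ((lintegral_mono fun x => min_le_left _ _).trans_lt (hg.trans ENNReal.one_lt_top)).ne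
  · calc volume.withDensity (fun x => min (g x : ℝ≥0∞) 1) ≤ volume.withDensity 1 :=
          withDensity_mono (Eventually.of_forall fun x => min_le_right _ _)
      _ = volume := withDensity_one
  · refine withDensity_absolutelyContinuous' hwm.aemeasurable (Eventually.of_forall fun x => ?_)
    simp [(hg0 x).ne']

/-- A subsequence of the characteristic functions converges weakly in L² to some g. Translated
mollifier kernels lie in L², so the mollifications converge pointwise, and the mollification error
is uniform in n by the bound on the variation. Hence there is strong convergence in L¹(μ), with μ
finite and equivalent to Lebesgue measure, and a further subsequence converges a.e. -/
lemma exists_subseq_tendsto_ae_of_measurable {F : ℕ → Set 𝔼} (hF : ∀ n, MeasurableSet (F n))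
    {V M : ℝ≥0} (hV : ∀ n, volume (F n) ≤ V) (hM : ∀ n, totalVariation (chi (F n)) ≤ M) :
    ∃ (G : Set 𝔼) (φ : ℕ → ℕ), StrictMono φ ∧ MeasurableSet G ∧
      ∀ᵐ x, Tendsto (fun n => chi (F (φ n)) x) atTop (𝓝 (chi G x)) := by
  have hVt : ∀ n, volume (F n) < ∞ := fun n => (hV n).trans_lt ENNReal.coe_lt_top
  have hMt : ∀ n, totalVariation (chi (F n)) ≠ ∞ :=
    fun n => ((hM n).trans_lt ENNReal.coe_lt_top).ne
  let f : ℕ → Lp ℝ 2 (volume : Measure 𝔼) := fun n =>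
    indicatorConstLp 2 (hF n) (hVt n).ne (1 : ℝ)
  have hfn : ∀ n, ‖f n‖ ≤ (V : ℝ) ^ (1 / (2 : ℝ≥0∞).toReal) := by
    intro n
    refine (norm_indicatorConstLp (by norm_num) (by norm_num)).le.trans ?_
    rw [norm_one, one_mul]
    gcongr
    exact ENNReal.toReal_le_coe_of_le_coe (hV n)
  have : Fact ((2 : ℝ≥0∞) ≠ ∞) := ⟨by norm_num⟩
  obtain ⟨g, φ, hφ, hweak⟩ := exists_subseq_tendsto_inner hfn
  have hgli : LocallyIntegrable g := (Lp.memLp g).locallyIntegrable (by norm_num)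
  have hmoll : ∀ (ρ : ContDiffBump (0 : 𝔼)) x,
      Tendsto (fun n => mollify ρ (chi (F (φ n))) x) atTop (𝓝 (mollify ρ g x)) := by
    intro ρ x
    have hk : MemLp (fun t => ρ.normed volume (x - t)) 2 (volume : Measure 𝔼) := by
      refine Continuous.memLp_of_hasCompactSupport
        (ρ.continuous_normed.comp (continuous_const.sub continuous_id)) ?_
      exact ρ.hasCompactSupport_normed.comp_homeomorph (Homeomorph.subLeft x)
    have hin : ∀ u : Lp ℝ 2 (volume : Measure 𝔼), inner ℝ u (hk.toLp _) = mollify ρ u x := by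
      intro u
      rw [L2.inner_def, mollify]
      refine integral_congr_ae ?_
      filter_upwards [hk.coeFn_toLp] with t ht
      rw [ht]
      simp [mul_comm]
    have h1 := hweak (hk.toLp _)
    simp only [hin] at h1
    refine h1.congr fun n => ?_
    refine integral_congr_ae ?_
    filter_upwards [indicatorConstLp_coeFn (p := 2) (hs := hF (φ n)) (hμs := (hVt (φ n)).ne)
      (c := (1 : ℝ))] with t ht
    rw [show f (φ n) t = chi (F (φ n)) t from ht]
  have hmoll1 : ∀ (ρ : ContDiffBump (0 : 𝔼)) x, |mollify ρ g x| ≤ 1 := fun ρ x =>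
    le_of_tendsto' (hmoll ρ x).abs fun n => abs_mollify_le ρ (abs_chi_le _) x
  let ρ : ℕ → ContDiffBump (0 : 𝔼) := fun k =>
    ⟨1 / (k + 1 : ℝ), 2 * (1 / (k + 1 : ℝ)), by positivity, by
      have : (0 : ℝ) < 1 / (k + 1 : ℝ) := by positivity
      linarith⟩
  have hr : Tendsto (fun k => (ρ k).rOut) atTop (𝓝 0) := by
    have := (tendsto_one_div_add_atTop_nhds_zero_nat (𝕜 := ℝ)).const_mul 2
    rwa [mul_zero] at this
  have hae : ∀ᵐ x, Tendsto (fun k => mollify (ρ k) g x) atTop (𝓝 (g x)) := by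
    simp only [mollify_eq_convolution]
    exact ContDiffBump.ae_convolution_tendsto_right_of_locallyIntegrable (K := 2) hr
      (Eventually.of_forall fun k => le_rfl) hgli
  have hg1 : ∀ᵐ x, |g x| ≤ 1 := by
    filter_upwards [hae] with x hx using le_of_tendsto' hx.abs fun k => hmoll1 _ x
  obtain ⟨μ, hμf, hμle, hμac⟩ := exists_finite_measure_le_volume (d := d)
  have hμac' : μ ≪ volume := Measure.absolutelyContinuous_of_le hμle
  have hgm : Measurable g := (Lp.stronglyMeasurable g).measurable
  have hfm : ∀ n, Measurable (chi (F n)) := fun n => measurable_const.indicator (hF n)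
  have hcg : ∀ k, Measurable (mollify (ρ k) g) := fun k => (continuous_mollify _ hgli).measurable
  have hcf : ∀ k n, Measurable (mollify (ρ k) (chi (F n))) := fun k n =>
    (continuous_mollify _
      (integrable_chi (hF n).nullMeasurableSet (hVt n)).locallyIntegrable).measurable
  have hb2 : ∀ a b : ℝ, |a| ≤ 1 → |b| ≤ 1 → ‖a - b‖ₑ ≤ 2 := by
    intro a b ha hb
    rw [← ofReal_norm, Real.norm_eq_abs]
    refine (ENNReal.ofReal_le_ofReal ((abs_sub _ _).trans (add_le_add ha hb))).trans ?_
    norm_num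
  have hfin : ∫⁻ _, (2 : ℝ≥0∞) ∂μ ≠ ∞ := by
    rw [lintegral_const]
    exact ENNReal.mul_ne_top (by norm_num) (measure_ne_top μ _)
  have hB : ∀ k, Tendsto (fun n => ∫⁻ x, ‖mollify (ρ k) (chi (F (φ n))) x - mollify (ρ k) g x‖ₑ ∂μ)
      atTop (𝓝 0) := by
    intro k
    have : Tendsto (fun n => ∫⁻ x, ‖mollify (ρ k) (chi (F (φ n))) x - mollify (ρ k) g x‖ₑ ∂μ)
      atTop (𝓝 (∫⁻ x, 0 ∂μ)) := by
      refine tendsto_lintegral_of_dominated_convergence (fun _ => 2)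
        (fun n => ((hcf k _).sub (hcg k)).enorm) (fun n => Eventually.of_forall fun x =>
          hb2 _ _ (abs_mollify_le _ (abs_chi_le _) x) (hmoll1 _ x)) hfin ?_
      refine Eventually.of_forall fun x => ?_
      have h1 := ((hmoll (ρ k) x).sub_const (mollify (ρ k) g x)).enorm
      simpa using h1
    simpa using this
  have hC : Tendsto (fun k => ∫⁻ x, ‖mollify (ρ k) g x - g x‖ₑ ∂μ) atTop (𝓝 0) := by
    have : Tendsto (fun k => ∫⁻ x, ‖mollify (ρ k) g x - g x‖ₑ ∂μ)
      atTop (𝓝 (∫⁻ x, 0 ∂μ)) := by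
      refine tendsto_lintegral_of_dominated_convergence (fun _ => 2)
        (fun k => ((hcg k).sub hgm).enorm) (fun k => ?_) hfin ?_
      · filter_upwards [hμac'.ae_le hg1] with x hx using hb2 _ _ (hmoll1 _ x) hx
      · filter_upwards [hμac'.ae_le hae] with x hx
        have h1 := (hx.sub_const (g x)).enorm
        simpa using h1
    simpa using this
  have hR : Tendsto (fun k => ENNReal.ofReal (ρ k).rOut * M) atTop (𝓝 0) := by
    have h1 := ENNReal.continuous_ofReal.continuousAt.tendsto.comp hr
    have h2 := ENNReal.Tendsto.mul_const (b := (M : ℝ≥0∞)) h1 (Or.inr ENNReal.coe_ne_top)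
    simpa using h2
  -- Three-term estimate: k is fixed first, from the uniform mollification error and the convergence
  -- of the mollified g to g; then n is sent to infinity.
  have hL1 : Tendsto (fun n => ∫⁻ x, ‖chi (F (φ n)) x - g x‖ₑ ∂μ) atTop (𝓝 0) := by
    rw [ENNReal.tendsto_nhds_zero]
    intro ε hε
    have hε3 : 0 < ε / 3 := ENNReal.div_pos hε.ne' (by norm_num)
    obtain ⟨k, hk1, hk2⟩ := ((ENNReal.tendsto_nhds_zero.1 hR _ hε3).and
      (ENNReal.tendsto_nhds_zero.1 hC _ hε3)).exists
    filter_upwards [ENNReal.tendsto_nhds_zero.1 (hB k) _ hε3] with n hn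
    calc ∫⁻ x, ‖chi (F (φ n)) x - g x‖ₑ ∂μ
        ≤ ∫⁻ x, (‖mollify (ρ k) (chi (F (φ n))) x - chi (F (φ n)) x‖ₑ
          + (‖mollify (ρ k) (chi (F (φ n))) x - mollify (ρ k) g x‖ₑ
            + ‖mollify (ρ k) g x - g x‖ₑ)) ∂μ := by
          refine lintegral_mono fun x => ?_
          rw [enorm_sub_rev (mollify (ρ k) (chi (F (φ n))) x) (chi (F (φ n)) x)]
          refine le_trans (le_of_eq ?_) ((enorm_add_le _ _).trans
            (add_le_add_right (enorm_add_le _ _) _))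
          congr 1; ring
      _ = (∫⁻ x, ‖mollify (ρ k) (chi (F (φ n))) x - chi (F (φ n)) x‖ₑ ∂μ)
          + ((∫⁻ x, ‖mollify (ρ k) (chi (F (φ n))) x - mollify (ρ k) g x‖ₑ ∂μ)
            + ∫⁻ x, ‖mollify (ρ k) g x - g x‖ₑ ∂μ) := by
          have m1 : Measurable fun x => ‖mollify (ρ k) (chi (F (φ n))) x - chi (F (φ n)) x‖ₑ :=
            ((hcf k _).sub (hfm _)).enorm
          have m2 : Measurable fun x => ‖mollify (ρ k) (chi (F (φ n))) x - mollify (ρ k) g x‖ₑ :=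
            ((hcf k _).sub (hcg k)).enorm
          rw [lintegral_add_left m1, lintegral_add_left m2]
      _ ≤ ε / 3 + (ε / 3 + ε / 3) := by
          gcongr
          calc ∫⁻ x, ‖mollify (ρ k) (chi (F (φ n))) x - chi (F (φ n)) x‖ₑ ∂μ
              ≤ ∫⁻ x, ‖mollify (ρ k) (chi (F (φ n))) x - chi (F (φ n)) x‖ₑ :=
                lintegral_mono' hμle le_rfl
            _ ≤ ENNReal.ofReal (ρ k).rOut * totalVariation (chi (F (φ n))) :=
                lintegral_mollify_sub_le _ (hF _) (hVt _) (hMt _)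
            _ ≤ ENNReal.ofReal (ρ k).rOut * M := by gcongr; exact hM _
            _ ≤ ε / 3 := hk1
      _ = ε := by rw [← add_assoc, ENNReal.add_thirds]
  have hmeas : TendstoInMeasure μ (fun n => chi (F (φ n))) atTop g := by
    refine tendstoInMeasure_of_tendsto_eLpNorm one_ne_zero
      (fun n => (hfm _).aestronglyMeasurable) hgm.aestronglyMeasurable ?_
    simpa only [eLpNorm_one_eq_lintegral_enorm, Pi.sub_apply] using hL1
  obtain ⟨ψ, hψ, hlim⟩ := hmeas.exists_seq_tendsto_ae
  -- As an a.e. limit of functions with values in the closed set {0, 1}, g is a.e. the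
  -- characteristic function of this level set.
  refine ⟨{x | g x = 1}, φ ∘ ψ, hφ.comp hψ, hgm (measurableSet_singleton 1), ?_⟩
  filter_upwards [hμac.ae_le hlim] with x hx
  have h01 : g x ∈ ({0, 1} : Set ℝ) := by
    refine (Set.toFinite {(0 : ℝ), 1}).isClosed.mem_of_tendsto hx (Eventually.of_forall fun n => ?_)
    by_cases h : x ∈ F (φ (ψ n)) <;> simp [chi, h]
  have : chi {x | g x = 1} x = g x := by
    rcases h01 with h | h
    · simp [chi, h]
    · rw [mem_singleton_iff] at h
      simp [chi, h]
  rw [this]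
  exact hx

lemma exists_subseq_tendsto_ae {F : ℕ → Set 𝔼} (hF : ∀ n, NullMeasurableSet (F n))
    {V M : ℝ≥0} (hV : ∀ n, volume (F n) ≤ V) (hM : ∀ n, totalVariation (chi (F n)) ≤ M) :
    ∃ (G : Set 𝔼) (φ : ℕ → ℕ), StrictMono φ ∧ MeasurableSet G ∧
      ∀ᵐ x, Tendsto (fun n => chi (F (φ n)) x) atTop (𝓝 (chi G x)) := by
  choose F' _ hF' hFF' using fun n => (hF n).exists_measurable_superset_ae_eq
  obtain ⟨G, φ, hφ, hG, hlim⟩ := exists_subseq_tendsto_ae_of_measurable hF' (V := V) (M := M)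
    (fun n => (measure_congr (hFF' n)).le.trans (hV n))
    (fun n => (variationOver_congr_ae _ (chi_congr_ae (hFF' n))).le.trans (hM n))
  refine ⟨G, φ, hφ, hG, ?_⟩
  have hall : ∀ᵐ x, ∀ n, chi (F' n) x = chi (F n) x :=
    ae_all_iff.2 fun n => chi_congr_ae (hFF' n)
  filter_upwards [hlim, hall] with x hx hx'
  simpa only [hx'] using hx

end

section
variable {d : ℕ}

local notation "𝔼" => EuclideanSpace ℝ (Fin d)

/-! ### Existence of minimizers -/

lemma stepEnergy_self (φ : Seminorm ℝ 𝔼) (τ : ℝ) (E : Set 𝔼) :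
    stepEnergy φ τ E E = anisoPerimeter φ E := by
  simp [stepEnergy]

lemma volume_le_add_symmDiff (E F : Set 𝔼) : volume F ≤ volume E + volume (symmDiff E F) := by
  refine (measure_mono fun x hx => ?_).trans (measure_union_le _ _)
  by_cases h : x ∈ E
  · exact Or.inl h
  · exact Or.inr (Or.inr ⟨hx, h⟩)

/-- Only finiteness matters here, so the crude bound v ≤ v² + 1 replaces a square root. -/
lemma volume_symmDiff_le_of_stepEnergy_le {φ : Seminorm ℝ 𝔼} {τ : ℝ} (hτ : 0 < τ) {E F : Set 𝔼}
    {A : ℝ≥0∞} (h : stepEnergy φ τ E F ≤ A) :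
    volume (symmDiff E F) ≤ A * ENNReal.ofReal (2 * τ) + 1 := by
  have hc0 : ENNReal.ofReal (2 * τ) ≠ 0 := by simpa using hτ
  have h1 : volume (symmDiff E F) ^ 2 ≤ A * ENNReal.ofReal (2 * τ) :=
    (ENNReal.div_le_iff hc0 ENNReal.ofReal_ne_top).1 (le_add_self.trans h)
  rcases le_total (volume (symmDiff E F)) 1 with h2 | h2
  · exact h2.trans le_add_self
  · exact ((le_self_pow₀ h2 two_ne_zero).trans h1).trans le_self_add

lemma exists_isStepMinimizer {φ : Seminorm ℝ 𝔼} (hφ : ∀ x, φ x = 0 → x = 0) {τ : ℝ} (hτ : 0 < τ)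
    {E : Set 𝔼} (hE : NullMeasurableSet E) (hv : volume E < ∞) (hP : anisoPerimeter φ E ≠ ∞) :
    ∃ F, IsStepMinimizer φ τ E F := by
  have hc0 : ENNReal.ofReal (2 * τ) ≠ 0 := by simpa using hτ
  obtain ⟨C, hC, hTV⟩ := exists_totalVariation_le φ hφ
  obtain ⟨u, hu, hlim, hmem⟩ := exists_seq_tendsto_sInf
    (S := stepEnergy φ τ E '' {F | NullMeasurableSet F volume}) ⟨_, E, hE, rfl⟩ (OrderBot.bddBelow _)
  set m := sInf (stepEnergy φ τ E '' {F | NullMeasurableSet F volume}) with hm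
  have hm_le : ∀ G, NullMeasurableSet G → m ≤ stepEnergy φ τ E G := fun G hG =>
    sInf_le ⟨G, hG, rfl⟩
  have hm_top : m < ∞ := (hm_le E hE).trans_lt (by rw [stepEnergy_self]; exact hP.lt_top)
  -- The minimizing values decrease, so from the index N on all energies are at most the finite
  -- value `u N`.
  obtain ⟨N, hN⟩ := (hlim.eventually_lt_const hm_top).exists
  choose F hF hFu using fun n => hmem (n + N)
  have hub : ∀ n, stepEnergy φ τ E (F n) ≤ u N := fun n => by
    rw [hFu]; exact hu (Nat.le_add_left _ _)
  have hVt : volume E + (u N * ENNReal.ofReal (2 * τ) + 1) ≠ ∞ :=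
    ENNReal.add_ne_top.2 ⟨hv.ne, ENNReal.add_ne_top.2
      ⟨ENNReal.mul_ne_top hN.ne ENNReal.ofReal_ne_top, ENNReal.one_ne_top⟩⟩
  have hMt : ENNReal.ofReal C * u N ≠ ∞ := ENNReal.mul_ne_top ENNReal.ofReal_ne_top hN.ne
  obtain ⟨G, ψ, hψ, hG, hae⟩ := exists_subseq_tendsto_ae (F := F) hF
    (V := (volume E + (u N * ENNReal.ofReal (2 * τ) + 1)).toNNReal)
    (M := (ENNReal.ofReal C * u N).toNNReal)
    (fun n => by
      rw [ENNReal.coe_toNNReal hVt]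
      exact (volume_le_add_symmDiff E (F n)).trans
        (add_le_add_right (volume_symmDiff_le_of_stepEnergy_le hτ (hub n)) _))
    (fun n => by
      rw [ENNReal.coe_toNNReal hMt]
      refine (hTV _).trans ?_
      gcongr
      exact le_self_add.trans (hub n))
  -- The extended half-line is compact, so perimeter and distance converge separately along a
  -- subsequence, and lower semicontinuity applies to each term.
  obtain ⟨⟨p, v⟩, θ, hθ, hpv⟩ := CompactSpace.tendsto_subseq fun n =>
    (anisoPerimeter φ (F (ψ n)), volume (symmDiff E (F (ψ n))))
  have hp : Tendsto (fun n => anisoPerimeter φ (F (ψ (θ n)))) atTop (𝓝 p) :=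
    (continuous_fst.tendsto _).comp hpv
  have hvv : Tendsto (fun n => volume (symmDiff E (F (ψ (θ n))))) atTop (𝓝 v) :=
    (continuous_snd.tendsto _).comp hpv
  have hen : Tendsto (fun n => stepEnergy φ τ E (F (ψ (θ n)))) atTop
      (𝓝 (p + v ^ 2 / ENNReal.ofReal (2 * τ))) :=
    hp.add (((ENNReal.continuous_div_const _ hc0).tendsto _).comp
      (((ENNReal.continuous_pow 2).tendsto v).comp hvv))
  have hen' : Tendsto (fun n => stepEnergy φ τ E (F (ψ (θ n)))) atTop (𝓝 m) := by
    simp only [hFu]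
    exact hlim.comp ((tendsto_add_atTop_nat N).comp (hψ.tendsto_atTop.comp hθ.tendsto_atTop))
  have hmeq := tendsto_nhds_unique hen hen'
  have hae' : ∀ᵐ x, Tendsto (fun n => chi (F (ψ (θ n))) x) atTop (𝓝 (chi G x)) := by
    filter_upwards [hae] with x hx using hx.comp hθ.tendsto_atTop
  refine ⟨G, hG.nullMeasurableSet, fun H hH => le_trans ?_ (hm_le H hH)⟩
  rw [← hmeq]
  refine add_le_add (variationOver_chi_le_of_tendsto (fun n => hF _) hae' (fun n => le_rfl) hp) ?_
  gcongr
  refine volume_le_of_tendsto (fun n => nullMeasurableSet_symmDiff hE (hF (ψ (θ n))))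
    (nullMeasurableSet_symmDiff hE hG.nullMeasurableSet) ?_ (fun n => le_rfl) hvv
  filter_upwards [hae'] with x hx using tendsto_chi_symmDiff hx

lemma IsStepMinimizer.stepEnergy_le {φ : Seminorm ℝ 𝔼} {τ : ℝ} {E F : Set 𝔼}
    (h : IsStepMinimizer φ τ E F) (hE : NullMeasurableSet E) :
    stepEnergy φ τ E F ≤ anisoPerimeter φ E :=
  (h.2 E hE).trans (stepEnergy_self φ τ E).le

lemma IsStepMinimizer.anisoPerimeter_le {φ : Seminorm ℝ 𝔼} {τ : ℝ} {E F : Set 𝔼}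
    (h : IsStepMinimizer φ τ E F) (hE : NullMeasurableSet E) :
    anisoPerimeter φ F ≤ anisoPerimeter φ E :=
  le_self_add.trans (h.stepEnergy_le hE)

lemma IsStepMinimizer.volume_symmDiff_lt_top {φ : Seminorm ℝ 𝔼} {τ : ℝ} (hτ : 0 < τ)
    {E F : Set 𝔼} (h : IsStepMinimizer φ τ E F) (hE : NullMeasurableSet E)
    (hP : anisoPerimeter φ E ≠ ∞) : volume (symmDiff E F) < ∞ := by
  refine (volume_symmDiff_le_of_stepEnergy_le hτ (h.stepEnergy_le hE)).trans_lt ?_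
  exact (ENNReal.add_ne_top.2
    ⟨ENNReal.mul_ne_top hP ENNReal.ofReal_ne_top, ENNReal.one_ne_top⟩).lt_top

lemma IsStepMinimizer.volume_lt_top {φ : Seminorm ℝ 𝔼} {τ : ℝ} (hτ : 0 < τ) {E F : Set 𝔼}
    (h : IsStepMinimizer φ τ E F) (hE : NullMeasurableSet E) (hv : volume E < ∞)
    (hP : anisoPerimeter φ E ≠ ∞) : volume F < ∞ :=
  (volume_le_add_symmDiff E F).trans_lt
    (ENNReal.add_lt_top.2 ⟨hv, h.volume_symmDiff_lt_top hτ hE hP⟩)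

/-- A set of finite volume and finite anisotropic perimeter. -/
def IsAdmissible (φ : Seminorm ℝ 𝔼) (E : Set 𝔼) : Prop :=
  NullMeasurableSet E ∧ volume E < ∞ ∧ anisoPerimeter φ E ≠ ∞

lemma IsStepMinimizer.isAdmissible {φ : Seminorm ℝ 𝔼} {τ : ℝ} (hτ : 0 < τ) {E F : Set 𝔼}
    (h : IsStepMinimizer φ τ E F) (hE : IsAdmissible φ E) : IsAdmissible φ F :=
  ⟨h.1, h.volume_lt_top hτ hE.1 hE.2.1 hE.2.2,
    ((h.anisoPerimeter_le hE.1).trans_lt hE.2.2.lt_top).ne⟩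

lemma HasFinitePerimeter.isAdmissible (φ : Seminorm ℝ 𝔼) {E : Set 𝔼} (hE : HasFinitePerimeter E)
    (hv : volume E < ∞) : IsAdmissible φ E := by
  obtain ⟨C, -, h⟩ := exists_anisoPerimeter_le φ
  exact ⟨hE.1, hv, ((h E).trans_lt (ENNReal.mul_lt_top ENNReal.ofReal_lt_top hE.2)).ne⟩

lemma exists_isDiscreteFlow {φ : Seminorm ℝ 𝔼} (hφ : ∀ x, φ x = 0 → x = 0) {τ : ℝ} (hτ : 0 < τ)
    {E₀ : Set 𝔼} (hE₀ : IsAdmissible φ E₀) : ∃ S : ℕ → Set 𝔼, IsDiscreteFlow φ τ E₀ S := by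
  choose! next hnext using fun (E : Set 𝔼) (hE : IsAdmissible φ E) =>
    exists_isStepMinimizer hφ hτ hE.1 hE.2.1 hE.2.2
  have hadm : ∀ n, IsAdmissible φ (next^[n] E₀) := by
    intro n
    induction n with
    | zero => exact hE₀
    | succ n ih =>
      rw [Function.iterate_succ_apply']
      exact (hnext _ ih).isAdmissible hτ ih
  refine ⟨fun n => next^[n] E₀, rfl, fun n => ?_⟩
  simp only [Function.iterate_succ_apply']
  exact hnext _ (hadm n)

/-! ### Energy estimates for discrete flows -/

section Estimates

variable {φ : Seminorm ℝ (EuclideanSpace ℝ (Fin d))} {τ : ℝ}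
  {E₀ : Set (EuclideanSpace ℝ (Fin d))} {S : ℕ → Set (EuclideanSpace ℝ (Fin d))}

lemma IsDiscreteFlow.isAdmissible (hS : IsDiscreteFlow φ τ E₀ S) (hτ : 0 < τ)
    (hE₀ : IsAdmissible φ E₀) (n : ℕ) : IsAdmissible φ (S n) := by
  induction n with
  | zero => rw [hS.1]; exact hE₀
  | succ n ih => exact (hS.2 n).isAdmissible hτ ih

lemma IsDiscreteFlow.anisoPerimeter_le (hS : IsDiscreteFlow φ τ E₀ S) (hτ : 0 < τ)
    (hE₀ : IsAdmissible φ E₀) (n : ℕ) : anisoPerimeter φ (S n) ≤ anisoPerimeter φ E₀ := by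
  induction n with
  | zero => rw [hS.1]
  | succ n ih => exact ((hS.2 n).anisoPerimeter_le (hS.isAdmissible hτ hE₀ n).1).trans ih

lemma IsAdmissible.volume_symmDiff_ne_top {E F : Set 𝔼} (hE : IsAdmissible φ E)
    (hF : IsAdmissible φ F) : volume (symmDiff E F) ≠ ∞ := by
  refine (lt_of_le_of_lt (measure_mono ?_) (measure_union_lt_top hE.2.1 hF.2.1)).ne
  exact symmDiff_le_sup

/-- Comparison of a minimizer with a competitor, in terms of real numbers. -/
lemma IsStepMinimizer.toReal_le {E F G : Set 𝔼} (h : IsStepMinimizer φ τ E F) (hτ : 0 < τ)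
    (hE : IsAdmissible φ E) (hG : IsAdmissible φ G) :
    (anisoPerimeter φ F).toReal + volume.real (symmDiff E F) ^ 2 / (2 * τ)
      ≤ (anisoPerimeter φ G).toReal + volume.real (symmDiff E G) ^ 2 / (2 * τ) := by
  have hF := h.isAdmissible hτ hE
  have hc0 : ENNReal.ofReal (2 * τ) ≠ 0 := by simpa using hτ
  have e : ∀ H, IsAdmissible φ H → stepEnergy φ τ E H ≠ ∞ ∧ (stepEnergy φ τ E H).toReal =
      (anisoPerimeter φ H).toReal + volume.real (symmDiff E H) ^ 2 / (2 * τ) := by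
    intro H hH
    have h1 : volume (symmDiff E H) ^ 2 / ENNReal.ofReal (2 * τ) ≠ ∞ :=
      ENNReal.div_ne_top (ENNReal.pow_ne_top (hE.volume_symmDiff_ne_top hH)) hc0
    refine ⟨ENNReal.add_ne_top.2 ⟨hH.2.2, h1⟩, ?_⟩
    rw [stepEnergy, ENNReal.toReal_add hH.2.2 h1, ENNReal.toReal_div, ENNReal.toReal_pow,
      ENNReal.toReal_ofReal (by positivity)]
    rfl
  rw [← (e F hF).2, ← (e G hG).2]
  exact ENNReal.toReal_mono (e G hG).1 (h.2 G hG.1)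

/-- The competitor is `S n` itself, whose distance term vanishes. -/
lemma IsDiscreteFlow.sq_step_le (hS : IsDiscreteFlow φ τ E₀ S) (hτ : 0 < τ)
    (hE₀ : IsAdmissible φ E₀) (n : ℕ) :
    volume.real (symmDiff (S n) (S (n + 1))) ^ 2
      ≤ 2 * τ * ((anisoPerimeter φ (S n)).toReal - (anisoPerimeter φ (S (n + 1))).toReal) := by
  have hn := hS.isAdmissible hτ hE₀ n
  have h := (hS.2 n).toReal_le hτ hn hn
  have h0 : volume.real (symmDiff (S n) (S n)) = 0 := by simp
  rw [h0] at h
  have h1 : volume.real (symmDiff (S n) (S (n + 1))) ^ 2 / (2 * τ)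
      ≤ (anisoPerimeter φ (S n)).toReal - (anisoPerimeter φ (S (n + 1))).toReal := by
    simp at h; linarith
  rw [div_le_iff₀ (by positivity)] at h1
  linarith

lemma IsDiscreteFlow.sum_sq_step_le (hS : IsDiscreteFlow φ τ E₀ S) (hτ : 0 < τ)
    (hE₀ : IsAdmissible φ E₀) (m k : ℕ) :
    ∑ i ∈ Finset.range k, volume.real (symmDiff (S (m + i)) (S (m + i + 1))) ^ 2
      ≤ 2 * τ * (anisoPerimeter φ E₀).toReal := by
  have h1 : ∑ i ∈ Finset.range k, volume.real (symmDiff (S (m + i)) (S (m + i + 1))) ^ 2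
      ≤ 2 * τ * ((anisoPerimeter φ (S m)).toReal - (anisoPerimeter φ (S (m + k))).toReal) := by
    induction k with
    | zero => simp
    | succ k ih =>
      rw [Finset.sum_range_succ]
      have := hS.sq_step_le hτ hE₀ (m + k)
      rw [← add_assoc]
      linarith
  have h2 : (anisoPerimeter φ (S m)).toReal ≤ (anisoPerimeter φ E₀).toReal :=
    ENNReal.toReal_mono hE₀.2.2 (hS.anisoPerimeter_le hτ hE₀ m)
  have h3 : 0 ≤ (anisoPerimeter φ (S (m + k))).toReal := ENNReal.toReal_nonneg
  refine h1.trans ?_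
  gcongr
  linarith

lemma sum_le_sqrt_mul_sum_sq (f : ℕ → ℝ) (k : ℕ) {A : ℝ}
    (h : ∑ i ∈ Finset.range k, f i ^ 2 ≤ A) : ∑ i ∈ Finset.range k, f i ≤ √(k * A) := by
  refine Real.le_sqrt_of_sq_le ?_
  have := sq_sum_le_card_mul_sum_sq (s := Finset.range k) (f := f)
  rw [Finset.card_range] at this
  exact this.trans (by gcongr)

/-- Cauchy–Schwarz turns the telescoped bound on squares into one depending on τ only through k τ,
the elapsed time: the source of the exponent 1/2. -/
lemma IsDiscreteFlow.sum_step_le (hS : IsDiscreteFlow φ τ E₀ S) (hτ : 0 < τ)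
    (hE₀ : IsAdmissible φ E₀) (m k : ℕ) :
    ∑ i ∈ Finset.range k, volume.real (symmDiff (S (m + i)) (S (m + i + 1)))
      ≤ √(k * (2 * τ * (anisoPerimeter φ E₀).toReal)) :=
  sum_le_sqrt_mul_sum_sq _ k (hS.sum_sq_step_le hτ hE₀ m k)

lemma IsAdmissible.volume_real_symmDiff_triangle {E F G : Set 𝔼} (hE : IsAdmissible φ E)
    (hF : IsAdmissible φ F) (hG : IsAdmissible φ G) : volume.real (symmDiff E G) ≤
      volume.real (symmDiff E F) + volume.real (symmDiff F G) := by
  refine (measureReal_mono (symmDiff_triangle E F G) ?_).trans (measureReal_union_le _ _)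
  exact (measure_union_lt_top (hE.volume_symmDiff_ne_top hF).lt_top
    (hF.volume_symmDiff_ne_top hG).lt_top).ne

lemma IsDiscreteFlow.volume_real_symmDiff_le (hS : IsDiscreteFlow φ τ E₀ S) (hτ : 0 < τ)
    (hE₀ : IsAdmissible φ E₀) (m k : ℕ) :
    volume.real (symmDiff (S m) (S (m + k)))
      ≤ √(k * (2 * τ * (anisoPerimeter φ E₀).toReal)) := by
  refine le_trans ?_ (hS.sum_step_le hτ hE₀ m k)
  induction k with
  | zero => simp
  | succ k ih =>
    rw [Finset.sum_range_succ]
    refine (IsAdmissible.volume_real_symmDiff_triangle (hS.isAdmissible hτ hE₀ m)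
      (hS.isAdmissible hτ hE₀ (m + k)) (hS.isAdmissible hτ hE₀ (m + (k + 1)))).trans ?_
    exact add_le_add ih le_rfl

end Estimates

end

section
variable {d : ℕ}

local notation "𝔼" => EuclideanSpace ℝ (Fin d)

/-! ### Cutoff functions -/

/-- A smooth `1`-Lipschitz exhaustion function. -/
noncomputable def height (x : 𝔼) : ℝ := √(1 + ‖x‖ ^ 2)

lemma contDiff_height : ContDiff ℝ 1 (height (d := d)) :=
  (contDiff_const.add (contDiff_norm_sq ℝ)).sqrt fun x => by positivity

lemma continuous_height : Continuous (height (d := d)) := contDiff_height.continuous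

lemma measurableSet_height_le (s : ℝ) : MeasurableSet {x : 𝔼 | height x ≤ s} :=
  (isClosed_le continuous_height continuous_const).measurableSet

lemma norm_le_height (x : 𝔼) : ‖x‖ ≤ height x :=
  Real.le_sqrt_of_sq_le (by linarith)

/-- The gradient is x / `height x`, of norm at most one. -/
lemma abs_fderiv_height_le (x v : 𝔼) : |fderiv ℝ height x v| ≤ ‖v‖ := by
  have h1 : HasFDerivAt (fun x : 𝔼 => 1 + ‖x‖ ^ 2) (2 • innerSL ℝ x) x :=
    ((hasStrictFDerivAt_norm_sq x).hasFDerivAt).const_add 1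
  have h2 := h1.sqrt (by positivity)
  have h3 : fderiv ℝ height x v = inner ℝ x v / height x := by
    rw [show fderiv ℝ height x = _ from h2.fderiv]
    simp [height]
    field_simp
  have hpos : 0 < height x := Real.sqrt_pos.2 (by positivity)
  rw [h3, abs_div, abs_of_pos hpos, div_le_iff₀ hpos]
  calc |inner ℝ x v| ≤ ‖x‖ * ‖v‖ := abs_real_inner_le_norm x v
    _ ≤ ‖v‖ * height x := by
      rw [mul_comm]; gcongr; exact norm_le_height x

lemma deriv_smoothTransition_eq_zero {t : ℝ} (h : t < 0 ∨ 1 < t) :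
    deriv Real.smoothTransition t = 0 := by
  rcases h with h | h
  · have : Real.smoothTransition =ᶠ[𝓝 t] fun _ => 0 := by
      filter_upwards [gt_mem_nhds h] with y hy using Real.smoothTransition.zero_of_nonpos hy.le
    rw [this.deriv_eq, deriv_const]
  · have : Real.smoothTransition =ᶠ[𝓝 t] fun _ => 1 := by
      filter_upwards [lt_mem_nhds h] with y hy using Real.smoothTransition.one_of_one_le hy.le
    rw [this.deriv_eq, deriv_const]

lemma exists_deriv_smoothTransition_bound :
    ∃ L, 0 < L ∧ ∀ t, |deriv Real.smoothTransition t| ≤ L := by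
  have hc : Continuous (deriv Real.smoothTransition) :=
    (Real.smoothTransition.contDiff (n := 1)).continuous_deriv le_rfl
  have hs : HasCompactSupport (deriv Real.smoothTransition) := by
    refine HasCompactSupport.of_support_subset_isCompact (isCompact_Icc (a := (0 : ℝ)) (b := 1)) ?_
    intro t ht
    by_contra hcon
    refine ht (deriv_smoothTransition_eq_zero ?_)
    by_contra! h'
    exact hcon ⟨h'.1, h'.2⟩
  obtain ⟨L, hL⟩ := hs.exists_bound_of_continuous hc
  exact ⟨max L 1, by positivity, fun t => (hL t).trans (le_max_left _ _)⟩

/-- The cutoff function equal to `1` where `height ≤ s + ε` and to `0` where `height ≥ s + 2 ε`. -/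
noncomputable def cutoff (s ε : ℝ) (x : 𝔼) : ℝ :=
  1 - Real.smoothTransition ((height x - s - ε) / ε)

section Cutoff

variable {s ε : ℝ}

lemma contDiff_cutoff : ContDiff ℝ 1 (cutoff (d := d) s ε) := by
  refine contDiff_const.sub (Real.smoothTransition.contDiff.comp ?_)
  exact ((contDiff_height.sub contDiff_const).sub contDiff_const).div_const _

lemma cutoff_mem_Icc (x : 𝔼) : cutoff s ε x ∈ Icc (0 : ℝ) 1 :=
  ⟨sub_nonneg.2 (Real.smoothTransition.le_one _),
    sub_le_self _ (Real.smoothTransition.nonneg _)⟩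

lemma cutoff_eq_one (hε : 0 < ε) {x : 𝔼} (h : height x ≤ s + ε) : cutoff s ε x = 1 := by
  rw [cutoff, Real.smoothTransition.zero_of_nonpos, sub_zero]
  exact div_nonpos_of_nonpos_of_nonneg (by linarith) hε.le

lemma cutoff_eq_zero (hε : 0 < ε) {x : 𝔼} (h : s + 2 * ε ≤ height x) : cutoff s ε x = 0 := by
  rw [cutoff, Real.smoothTransition.one_of_one_le, sub_self]
  rw [le_div_iff₀ hε]; linarith

lemma fderiv_cutoff (x v : 𝔼) : fderiv ℝ (cutoff s ε) x v
    = -(deriv Real.smoothTransition ((height x - s - ε) / ε) * (fderiv ℝ height x v / ε)) := by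
  have h1 : HasFDerivAt (height (d := d)) (fderiv ℝ height x) x :=
    (contDiff_height.differentiable one_ne_zero x).hasFDerivAt
  have h2 : HasFDerivAt (fun x : 𝔼 => (height x - s - ε) / ε) (ε⁻¹ • fderiv ℝ height x) x := by
    simpa [div_eq_inv_mul] using ((h1.sub_const s).sub_const ε).const_mul ε⁻¹
  have h3 : HasDerivAt Real.smoothTransition (deriv Real.smoothTransition ((height x - s - ε) / ε))
      ((height x - s - ε) / ε) :=
    ((Real.smoothTransition.contDiff (n := 1)).differentiable one_ne_zero _).hasDerivAt
  have h4 := (h3.comp_hasFDerivAt x h2).const_sub 1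
  rw [show fderiv ℝ (cutoff s ε) x = _ from h4.fderiv]
  simp [div_eq_inv_mul]

lemma abs_fderiv_cutoff_le {L : ℝ} (hL : ∀ t, |deriv Real.smoothTransition t| ≤ L) (hε : 0 < ε)
    (x v : 𝔼) : |fderiv ℝ (cutoff s ε) x v| ≤ L / ε * ‖v‖ := by
  rw [fderiv_cutoff, abs_neg, abs_mul, abs_div, abs_of_pos hε]
  calc |deriv Real.smoothTransition ((height x - s - ε) / ε)| * (|fderiv ℝ height x v| / ε)
      ≤ L * (‖v‖ / ε) := by
        gcongr
        · exact (abs_nonneg _).trans (hL 0)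
        · exact hL _
        · exact abs_fderiv_height_le x v
    _ = _ := by ring

lemma fderiv_cutoff_eq_zero (hε : 0 < ε) {x : 𝔼} (h : height x ≤ s ∨ s + 2 * ε < height x)
    (v : 𝔼) : fderiv ℝ (cutoff s ε) x v = 0 := by
  rw [fderiv_cutoff, deriv_smoothTransition_eq_zero, zero_mul, neg_zero]
  refine h.imp (fun h => ?_) fun h => ?_
  · exact div_neg_of_neg_of_pos (by linarith) hε
  · rw [lt_div_iff₀ hε]; linarith

end Cutoff

/-! ### The variation outside of large sublevel sets -/

/-- The variation of `f` in `{height > s}`. -/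
noncomputable def outerVariation (K : Set 𝔼) (s : ℝ) (f : 𝔼 → ℝ) : ℝ≥0∞ :=
  ⨆ (X : 𝔼 → 𝔼) (_ : IsTestField K X ∧ ∃ s' > s, ∀ x, height x ≤ s' → X x = 0),
    ENNReal.ofReal (∫ x, f x * divergence X x)

lemma outerVariation_le_variationOver (K : Set 𝔼) (s : ℝ) (f : 𝔼 → ℝ) :
    outerVariation K s f ≤ variationOver K f :=
  iSup₂_le fun _ hX => hX.1.ofReal_integral_le f

lemma integral_le_outerVariation {K : Set 𝔼} {s s' : ℝ} {f : 𝔼 → ℝ}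
    (hf : variationOver K f ≠ ∞) {X : 𝔼 → 𝔼} (hX : IsTestField K X) (hs : s < s')
    (h0 : ∀ x, height x ≤ s' → X x = 0) :
    ∫ x, f x * divergence X x ≤ (outerVariation K s f).toReal := by
  have hf' : outerVariation K s f ≠ ∞ :=
    ((outerVariation_le_variationOver K s f).trans_lt hf.lt_top).ne
  refine (ENNReal.ofReal_le_iff_le_toReal hf').1 ?_
  exact le_iSup₂ (f := fun (X : 𝔼 → 𝔼)
    (_ : IsTestField K X ∧ ∃ s' > s, ∀ x, height x ≤ s' → X x = 0) =>
    ENNReal.ofReal (∫ x, f x * divergence X x)) X ⟨hX, s', hs, h0⟩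

lemma divergence_zero (x : 𝔼) : divergence (0 : 𝔼 → 𝔼) x = 0 :=
  divergence_eq_zero_of_fderiv (by simp)

lemma variationOver_le_ofReal {K : Set 𝔼} {f : 𝔼 → ℝ} {c : ℝ}
    (h : ∀ X, IsTestField K X → ∫ x, f x * divergence X x ≤ c) :
    variationOver K f ≤ ENNReal.ofReal c :=
  variationOver_le fun X hX => ENNReal.ofReal_le_ofReal (h X hX)

lemma outerVariation_le_ofReal {K : Set 𝔼} {f : 𝔼 → ℝ} {s c : ℝ}
    (h : ∀ X, IsTestField K X → ∀ s' > s, (∀ x, height x ≤ s' → X x = 0) →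
      ∫ x, f x * divergence X x ≤ c) :
    outerVariation K s f ≤ ENNReal.ofReal c :=
  iSup₂_le fun X ⟨hX, s', hs', h0⟩ => ENNReal.ofReal_le_ofReal (h X hX s' hs' h0)

lemma outerVariation_anti (K : Set 𝔼) {s t : ℝ} (h : s ≤ t) (f : 𝔼 → ℝ) :
    outerVariation K t f ≤ outerVariation K s f :=
  iSup₂_le fun X ⟨hX, s', hs', h0⟩ => le_iSup₂ (f := fun (X : 𝔼 → 𝔼)
    (_ : IsTestField K X ∧ ∃ s' > s, ∀ x, height x ≤ s' → X x = 0) =>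
    ENNReal.ofReal (∫ x, f x * divergence X x)) X ⟨hX, s', h.trans_lt hs', h0⟩

/-- The variation outside of large sublevel sets is small. -/
lemma exists_outerVariation_le {K : Set 𝔼} (hK0 : (0 : 𝔼) ∈ K) {E : Set 𝔼}
    (hE : NullMeasurableSet E) (hP : variationOver K (chi E) ≠ ∞) {ε : ℝ} (hε : 0 < ε) :
    ∃ R, (outerVariation K R (chi E)).toReal ≤ ε := by
  -- A field within ε of the supremum has compact support. Any field vanishing near and below the
  -- levels reached by that support can be added to it without breaking the constraint, so it gains
  -- at most ε.
  obtain ⟨X, hX, hXP⟩ : ∃ X, IsTestField K X ∧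
      (variationOver K (chi E)).toReal - ε < ∫ x, chi E x * divergence X x := by
    by_contra! hcon
    have h1 := hcon 0 (isTestField_zero hK0)
    simp only [divergence_zero, mul_zero, integral_zero] at h1
    have h2 := ENNReal.toReal_mono ENNReal.ofReal_ne_top (variationOver_le_ofReal hcon)
    rw [ENNReal.toReal_ofReal h1] at h2
    linarith
  obtain ⟨R, hR⟩ := (hX.2.1.isCompact.image (continuous_height (d := d))).bddAbove
  refine ⟨R, ?_⟩
  have h1 : outerVariation K R (chi E) ≤ ENNReal.ofReal ε := by
    refine outerVariation_le_ofReal fun Y hY s' hs' h0 => ?_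
    have hdisj : ∀ x, X x = 0 ∨ Y x = 0 := by
      intro x
      by_cases hx : height x ≤ s'
      · exact Or.inr (h0 x hx)
      · refine Or.inl (image_eq_zero_of_notMem_tsupport fun hmem => hx ?_)
        exact (hR (mem_image_of_mem _ hmem)).trans hs'.le
    have h2 := (hX.add_of_disjoint hY hdisj).integral_le hP
    simp only [divergence_add hX.differentiable hY.differentiable, mul_add] at h2
    rw [integral_add (hX.integrable_chi_mul hE) (hY.integrable_chi_mul hE)] at h2
    linarith
  have := ENNReal.toReal_mono ENNReal.ofReal_ne_top h1
  rwa [ENNReal.toReal_ofReal hε.le] at this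

/-! ### Gluing -/

lemma chi_ite (A F E : Set 𝔼) (x : 𝔼) :
    chi (Set.ite A F E) x = chi F x * chi A x + chi E x * (1 - chi A x) := by
  by_cases h : x ∈ A <;> by_cases h1 : x ∈ F <;> by_cases h2 : x ∈ E <;>
    simp [chi, Set.ite, h, h1, h2]

/-- Split X into ηX and (1 − η)X, where η is the cutoff. The supports of ηX and Y are disjoint
because s + 2ε ≤ s', so ηX + Y is one admissible field tested on F; (1 − η)X vanishes up to level s
+ ε and is an outer field tested on E. The gradients of η leave an error living on the symmetric
difference in the layer between s and s + 2ε and bounded there by CL/ε, which produces the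
difference quotient. -/
lemma glue_integral_le {K : Set 𝔼} (hK : StarConvex ℝ 0 K) {C : ℝ}
    (hKC : K ⊆ Metric.closedBall 0 C) {L : ℝ} (hL : ∀ t, |deriv Real.smoothTransition t| ≤ L)
    {E F : Set 𝔼} (hE : NullMeasurableSet E) (hF : NullMeasurableSet F)
    (hEF : volume (symmDiff E F) ≠ ∞)
    (hPE : variationOver K (chi E) ≠ ∞) (hPF : variationOver K (chi F) ≠ ∞)
    {s s' ε : ℝ} (hε : 0 < ε) (hs : s + 2 * ε ≤ s') {X Y : 𝔼 → 𝔼}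
    (hX : IsTestField K X) (hY : IsTestField K Y) (hY0 : ∀ x, height x ≤ s' → Y x = 0) :
    (∫ x, (chi F x * cutoff s ε x + chi E x * (1 - cutoff s ε x)) * divergence X x)
        + ∫ x, chi F x * divergence Y x
      ≤ (variationOver K (chi F)).toReal + (outerVariation K s (chi E)).toReal
        + C * L * ((volume.real (symmDiff E F ∩ {x | height x ≤ s + 2 * ε})
          - volume.real (symmDiff E F ∩ {x | height x ≤ s})) / ε) := by
  set η : 𝔼 → ℝ := cutoff s ε with hη
  have hηc : ContDiff ℝ 1 η := contDiff_cutoff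
  have hηd : Differentiable ℝ η := hηc.differentiable one_ne_zero
  have hη' : ContDiff ℝ 1 (fun x => 1 - η x) := contDiff_const.sub hηc
  have hX1 : IsTestField K (fun x => η x • X x) := hX.smul_cutoff hK hηc cutoff_mem_Icc
  have hX2 : IsTestField K (fun x => (1 - η x) • X x) := hX.smul_cutoff hK hη' fun x =>
    ⟨sub_nonneg.2 (cutoff_mem_Icc x).2, sub_le_self _ (cutoff_mem_Icc x).1⟩
  have hdisj : ∀ x, η x • X x = 0 ∨ Y x = 0 := by
    intro x
    by_cases hx : height x ≤ s'
    · exact Or.inr (hY0 x hx)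
    · left
      rw [hη, cutoff_eq_zero hε (by linarith), zero_smul]
  have h1 := (hX1.add_of_disjoint hY hdisj).integral_le hPF
  simp only [divergence_add hX1.differentiable hY.differentiable, mul_add] at h1
  rw [integral_add (hX1.integrable_chi_mul hF) (hY.integrable_chi_mul hF)] at h1
  have h2 := integral_le_outerVariation (s := s) (s' := s + ε) hPE hX2 (by linarith) fun x hx => by
    simp [hη, cutoff_eq_one hε hx]
  have hdiv1 : ∀ x, divergence (fun x => η x • X x) x = η x * divergence X x + fderiv ℝ η x (X x) :=
    fun x => divergence_smul hηd hX.differentiable x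
  have hdiv2 : ∀ x, divergence (fun x => (1 - η x) • X x) x
      = (1 - η x) * divergence X x - fderiv ℝ η x (X x) := by
    intro x
    rw [divergence_smul (hη'.differentiable one_ne_zero) hX.differentiable, fderiv_const_sub]
    simp [sub_eq_add_neg]
  set A : Set 𝔼 := symmDiff E F ∩ ({x | height x ≤ s + 2 * ε} \ {x | height x ≤ s}) with hA
  have hAm : NullMeasurableSet A := (nullMeasurableSet_symmDiff hE hF).inter
    ((measurableSet_height_le _).diff (measurableSet_height_le _)).nullMeasurableSet
  have hAf : volume A < ∞ := (measure_mono inter_subset_left).trans_lt hEF.lt_top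
  have hI1 := hX1.integrable_chi_mul hF
  have hI2 := hX2.integrable_chi_mul hE
  have hcorr : ∀ x, |(chi F x - chi E x) * fderiv ℝ η x (X x)| ≤ chi A x * (L / ε * C) := by
    intro x
    by_cases hx : x ∈ A
    · rw [chi_apply_of_mem hx, one_mul, abs_mul]
      have h3 : |chi F x - chi E x| ≤ 1 := by
        rw [abs_chi_sub]; exact (chi_mem_Icc _ _).2
      have h4 : ‖X x‖ ≤ C := by simpa using hKC (hX.2.2 x)
      calc |chi F x - chi E x| * |fderiv ℝ η x (X x)| ≤ |fderiv ℝ η x (X x)| :=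
            mul_le_of_le_one_left (abs_nonneg _) h3
        _ ≤ L / ε * ‖X x‖ := abs_fderiv_cutoff_le hL hε x _
        _ ≤ L / ε * C := by
            have : 0 ≤ L := (abs_nonneg _).trans (hL 0)
            gcongr
    · rw [chi_apply_of_notMem hx, zero_mul]
      by_cases hx' : x ∈ symmDiff E F
      · have : fderiv ℝ η x (X x) = 0 := by
          refine fderiv_cutoff_eq_zero hε ?_ _
          by_contra! hcon
          exact hx ⟨hx', hcon.2, not_le.2 hcon.1⟩
        simp [this]
      · have h5 := abs_chi_sub E F x
        rw [chi_apply_of_notMem hx', abs_eq_zero] at h5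
        have h6 : chi F x - chi E x = 0 := by linarith
        simp [h6]
  have hsplit : (∫ x, (chi F x * η x + chi E x * (1 - η x)) * divergence X x)
      = (∫ x, chi F x * divergence (fun x => η x • X x) x)
        + (∫ x, chi E x * divergence (fun x => (1 - η x) • X x) x)
        + ∫ x, -((chi F x - chi E x) * fderiv ℝ η x (X x)) := by
    have hI3 : Integrable fun x => -((chi F x - chi E x) * fderiv ℝ η x (X x)) := by
      refine Integrable.mono' ((integrable_chi hAm hAf).mul_const (L / ε * C)) ?_
        (Eventually.of_forall fun x => by rw [norm_neg]; exact hcorr x)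
      refine AEStronglyMeasurable.neg (((aestronglyMeasurable_chi hF).sub
        (aestronglyMeasurable_chi hE)).mul (Continuous.aestronglyMeasurable ?_))
      exact (hηc.continuous_fderiv one_ne_zero).clm_apply hX.1.continuous
    have hI12 : Integrable fun x => chi F x * divergence (fun x => η x • X x) x
        + chi E x * divergence (fun x => (1 - η x) • X x) x := hI1.add hI2
    rw [← integral_add hI1 hI2, ← integral_add hI12 hI3]
    refine integral_congr_ae (Eventually.of_forall fun x => ?_)
    simp only [hdiv1, hdiv2]
    ring
  have herr : ∫ x, -((chi F x - chi E x) * fderiv ℝ η x (X x))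
      ≤ C * L * ((volume.real (symmDiff E F ∩ {x | height x ≤ s + 2 * ε})
          - volume.real (symmDiff E F ∩ {x | height x ≤ s})) / ε) := by
    have h3 : ∫ x, -((chi F x - chi E x) * fderiv ℝ η x (X x)) ≤ ∫ x, chi A x * (L / ε * C) := by
      refine (Real.le_norm_self _).trans (norm_integral_le_of_norm_le
        ((integrable_chi hAm hAf).mul_const (L / ε * C)) (Eventually.of_forall fun x => ?_))
      rw [norm_neg]; exact hcorr x
    have h4 : ∫ x, chi A x = volume.real A := by
      rw [show chi A = A.indicator (fun _ => (1 : ℝ)) from rfl, integral_indicator₀ hAm]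
      simp
    have h5 : volume.real A = volume.real (symmDiff E F ∩ {x | height x ≤ s + 2 * ε})
          - volume.real (symmDiff E F ∩ {x | height x ≤ s}) := by
      have hsub : symmDiff E F ∩ {x | height x ≤ s} ⊆
          symmDiff E F ∩ {x | height x ≤ s + 2 * ε} := by
        refine inter_subset_inter_right _ fun x hx => ?_
        simp only [mem_ofPred_eq] at hx ⊢; linarith
      have hAeq : A = (symmDiff E F ∩ {x | height x ≤ s + 2 * ε}) \
          (symmDiff E F ∩ {x | height x ≤ s}) := by
        ext x; simp only [hA, mem_inter_iff, Set.mem_sdiff]; tauto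
      rw [hAeq, measureReal_def, measure_sdiff hsub ((nullMeasurableSet_symmDiff hE hF).inter
        (measurableSet_height_le _).nullMeasurableSet)
        ((measure_mono inter_subset_left).trans_lt hEF.lt_top).ne,
        ENNReal.toReal_sub_of_le (measure_mono hsub)
        ((measure_mono inter_subset_left).trans_lt hEF.lt_top).ne]
      rfl
    rw [integral_mul_const, h4, h5] at h3
    refine h3.trans (le_of_eq ?_)
    ring
  rw [hsplit]
  linarith

/-- Gluing `F` inside a sublevel set with `E` outside of it. -/
lemma glue_le {K : Set 𝔼} (hK : StarConvex ℝ 0 K) (hK0 : (0 : 𝔼) ∈ K) {C : ℝ}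
    (hKC : K ⊆ Metric.closedBall 0 C) {L : ℝ} (hL : ∀ t, |deriv Real.smoothTransition t| ≤ L)
    {E F : Set 𝔼} (hE : NullMeasurableSet E) (hF : NullMeasurableSet F)
    (hEF : volume (symmDiff E F) ≠ ∞)
    (hPE : variationOver K (chi E) ≠ ∞) (hPF : variationOver K (chi F) ≠ ∞) {s : ℝ}
    (hs : DifferentiableAt ℝ (fun r => volume.real (symmDiff E F ∩ {x | height x ≤ r})) s) :
    variationOver K (chi (Set.ite {x | height x ≤ s} F E)) ≠ ∞ ∧
    (variationOver K (chi (Set.ite {x | height x ≤ s} F E))).toReal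
        + (outerVariation K s (chi F)).toReal
      ≤ (variationOver K (chi F)).toReal + (outerVariation K s (chi E)).toReal
        + 2 * C * L * deriv (fun r => volume.real (symmDiff E F ∩ {x | height x ≤ r})) s := by
  set g := fun r => volume.real (symmDiff E F ∩ {x | height x ≤ r}) with hg
  set G := Set.ite {x | height x ≤ s} F E with hG
  set A := (variationOver K (chi F)).toReal + (outerVariation K s (chi E)).toReal
        + 2 * C * L * deriv g s with hA
  -- Let ε → 0 in `glue_integral_le` with X and Y fixed: the cutoff tends to the indicator of the
  -- sublevel set. The layer has width 2ε, whence the factor 2 before the derivative.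
  have key : ∀ X, IsTestField K X → ∀ Y, IsTestField K Y → ∀ s' > s,
      (∀ x, height x ≤ s' → Y x = 0) →
      (∫ x, chi G x * divergence X x) + ∫ x, chi F x * divergence Y x ≤ A := by
    intro X hX Y hY s' hs' hY0
    let ε : ℕ → ℝ := fun k => 1 / ((k : ℝ) + 1)
    have hε0 : ∀ k, 0 < ε k := fun k => by positivity
    have hεl : Tendsto ε atTop (𝓝 0) := tendsto_one_div_add_atTop_nhds_zero_nat
    have h2ε : Tendsto (fun k => s + 2 * ε k) atTop (𝓝 s) := by
      simpa using (hεl.const_mul 2).const_add s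
    have hev : ∀ᶠ k in atTop, s + 2 * ε k ≤ s' :=
      (h2ε.eventually_lt_const hs').mono fun k hk => hk.le
    have hlim1 : Tendsto (fun k => ∫ x, (chi F x * cutoff s (ε k) x
        + chi E x * (1 - cutoff s (ε k) x)) * divergence X x) atTop
        (𝓝 (∫ x, chi G x * divergence X x)) := by
      refine tendsto_integral_of_dominated_convergence (fun x => 2 * |divergence X x|)
        (fun k => ?_) (hX.integrable_divergence.abs.const_mul 2) (fun k => ?_) ?_
      · have hc : AEStronglyMeasurable (cutoff (d := d) s (ε k)) volume :=
          contDiff_cutoff.continuous.aestronglyMeasurable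
        exact (((aestronglyMeasurable_chi hF).mul hc).add ((aestronglyMeasurable_chi hE).mul
          (aestronglyMeasurable_const.sub hc))).mul hX.integrable_divergence.1
      · refine Eventually.of_forall fun x => ?_
        rw [norm_mul, Real.norm_eq_abs, Real.norm_eq_abs]
        gcongr
        have hc := cutoff_mem_Icc (s := s) (ε := ε k) x
        have hF' := chi_mem_Icc F x
        have hE' := chi_mem_Icc E x
        rw [abs_le]
        constructor <;> nlinarith [hc.1, hc.2, hF'.1, hF'.2, hE'.1, hE'.2]
      · refine Eventually.of_forall fun x => ?_
        refine Tendsto.mul_const _ (tendsto_const_nhds.congr' ?_)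
        rw [hG]
        by_cases hx : height x ≤ s
        · refine Eventually.of_forall fun k => ?_
          beta_reduce
          rw [chi_ite, chi_apply_of_mem (show x ∈ {x | height x ≤ s} from hx),
            cutoff_eq_one (hε0 k) (by linarith [hε0 k])]
        · filter_upwards [h2ε.eventually_lt_const (not_le.1 hx)] with k hk
          rw [chi_ite, chi_apply_of_notMem (show x ∉ {x | height x ≤ s} from hx),
            cutoff_eq_zero (hε0 k) hk.le]
    have hlim2 : Tendsto (fun k => (g (s + 2 * ε k) - g s) / ε k) atTop (𝓝 (2 * deriv g s)) := by
      have h1 := hs.hasDerivAt.tendsto_slope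
      have h2 : Tendsto (fun k => s + 2 * ε k) atTop (𝓝[≠] s) := by
        refine tendsto_nhdsWithin_iff.2 ⟨h2ε, Eventually.of_forall fun k => ?_⟩
        have := hε0 k
        simp [this.ne']
      refine ((h1.comp h2).const_mul 2).congr fun k => ?_
      have := (hε0 k).ne'
      simp only [Function.comp_apply, slope_def_field]
      field_simp
      ring
    have hR : Tendsto (fun k => (variationOver K (chi F)).toReal
        + (outerVariation K s (chi E)).toReal + C * L * ((g (s + 2 * ε k) - g s) / ε k)) atTop
        (𝓝 A) := by
      have := (hlim2.const_mul (C * L)).const_add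
        ((variationOver K (chi F)).toReal + (outerVariation K s (chi E)).toReal)
      convert this using 2
      rw [hA]; ring
    refine le_of_tendsto_of_tendsto (hlim1.add_const _) hR ?_
    filter_upwards [hev] with k hk
    exact glue_integral_le hK hKC hL hE hF hEF hPE hPF (hε0 k) hk hX hY hY0
  have hX0 : ∀ Y, IsTestField K Y → ∀ s' > s, (∀ x, height x ≤ s' → Y x = 0) →
      ∫ x, chi F x * divergence Y x ≤ A := by
    intro Y hY s' hs' hY0
    simpa [divergence_zero] using key 0 (isTestField_zero hK0) Y hY s' hs' hY0
  -- The supremum over X is taken with Y fixed, and then the supremum over Y. The choice Y = 0 gives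
  -- finiteness.
  have hPG : ∀ Y, IsTestField K Y → ∀ s' > s, (∀ x, height x ≤ s' → Y x = 0) →
      variationOver K (chi G) ≤ ENNReal.ofReal (A - ∫ x, chi F x * divergence Y x) :=
    fun Y hY s' hs' hY0 => variationOver_le_ofReal fun X hX => by
      linarith [key X hX Y hY s' hs' hY0]
  have hGtop : variationOver K (chi G) ≠ ∞ :=
    ((hPG 0 (isTestField_zero hK0) (s + 1) (by linarith) fun _ _ => rfl).trans_lt
      ENNReal.ofReal_lt_top).ne
  have hPG' : ∀ Y, IsTestField K Y → ∀ s' > s, (∀ x, height x ≤ s' → Y x = 0) →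
      (variationOver K (chi G)).toReal ≤ A - ∫ x, chi F x * divergence Y x := by
    intro Y hY s' hs' hY0
    have h1 := ENNReal.toReal_mono ENNReal.ofReal_ne_top (hPG Y hY s' hs' hY0)
    rwa [ENNReal.toReal_ofReal (by linarith [hX0 Y hY s' hs' hY0])] at h1
  refine ⟨hGtop, ?_⟩
  have h1 : outerVariation K s (chi F) ≤ ENNReal.ofReal (A - (variationOver K (chi G)).toReal) :=
    outerVariation_le_ofReal fun Y hY s' hs' hY0 => by linarith [hPG' Y hY s' hs' hY0]
  have h2 := ENNReal.toReal_mono ENNReal.ofReal_ne_top h1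
  have h3 := hPG' 0 (isTestField_zero hK0) (s + 1) (by linarith) fun _ _ => rfl
  simp only [divergence_zero, mul_zero, integral_zero, sub_zero] at h3
  rw [ENNReal.toReal_ofReal (by linarith)] at h2
  linarith

end

section
variable {d : ℕ}

local notation "𝔼" => EuclideanSpace ℝ (Fin d)

/-! ### Tightness of discrete flows -/

/-- Monotone functions are differentiable a.e., and the integral of the derivative of their sum is
at most its increment. The average over an interval of length R is thus at most D / R, and some
point off the exceptional null set does no worse. One level s serves all the functions at once. -/
lemma exists_sum_deriv_le {n : ℕ} {g : ℕ → ℝ → ℝ} (hg : ∀ i, Monotone (g i)) {D R : ℝ}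
    (hR : 0 < R) (hD : ∑ i ∈ Finset.range n, (g i (2 * R) - g i R) ≤ D) :
    ∃ s ∈ Icc R (2 * R), (∀ i, DifferentiableAt ℝ (g i) s) ∧
      ∑ i ∈ Finset.range n, deriv (g i) s ≤ D / R := by
  set G : ℝ → ℝ := fun r => ∑ i ∈ Finset.range n, g i r with hG
  have hGm : Monotone G := fun a b hab => Finset.sum_le_sum fun i _ => hg i hab
  have hle : R ≤ 2 * R := by linarith
  have hint : ∫ x in R..(2 * R), deriv G x ≤ D := by
    have h1 := (hGm.monotoneOn (uIcc R (2 * R))).intervalIntegral_deriv_mem_uIcc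
    have h2 : 0 ≤ G (2 * R) - G R := sub_nonneg.2 (hGm hle)
    rw [uIcc_of_le h2] at h1
    refine h1.2.trans ?_
    rw [hG, ← Finset.sum_sub_distrib]
    exact hD
  have hi := (hGm.monotoneOn (uIcc R (2 * R))).intervalIntegrable_deriv
  rw [intervalIntegral.integral_of_le hle] at hint
  rw [intervalIntegrable_iff_integrableOn_Ioc_of_le hle] at hi
  have hae : ∀ᵐ x ∂(volume.restrict (Ioc R (2 * R))),
      x ∈ Ioc R (2 * R) ∧ ∀ i, DifferentiableAt ℝ (g i) x :=
    (ae_restrict_mem measurableSet_Ioc).and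
      (ae_restrict_of_ae (ae_all_iff.2 fun i => (hg i).ae_differentiableAt))
  have hμ : volume.restrict (Ioc R (2 * R)) ≠ 0 := by
    rw [Ne, Measure.restrict_eq_zero, Real.volume_Ioc]
    simp; linarith
  obtain ⟨s, hsN, hs⟩ := exists_notMem_null_le_average hμ hi hae
  have hs' : s ∈ Ioc R (2 * R) ∧ ∀ i, DifferentiableAt ℝ (g i) s := by
    by_contra hcon; exact hsN hcon
  refine ⟨s, Ioc_subset_Icc_self hs'.1, hs'.2, ?_⟩
  have hder : deriv G s = ∑ i ∈ Finset.range n, deriv (g i) s :=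
    deriv_fun_sum fun i _ => hs'.2 i
  rw [← hder]
  refine hs.trans ?_
  rw [average_eq, measureReal_restrict_apply_univ, Real.volume_real_Ioc_of_le hle, smul_eq_mul,
    show 2 * R - R = R by ring, inv_mul_eq_div]
  gcongr

lemma symmDiff_ite (A E F : Set 𝔼) : symmDiff E (Set.ite A F E) = symmDiff E F ∩ A := by
  ext x
  by_cases h : x ∈ A <;> by_cases h1 : x ∈ F <;> by_cases h2 : x ∈ E <;>
    simp [Set.ite, mem_symmDiff, h, h1, h2]

/-- The competitor equals F in the sublevel set and E outside, so it saves the displacement outside.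
Since a² + b² ≤ (a + b)², the saving in the penalty is at least the square of that displacement, and
`glue_le` bounds the cost in perimeter. -/
lemma IsStepMinimizer.outerVariation_add_le {φ : Seminorm ℝ 𝔼} {C : ℝ}
    (hKC : wulffShape φ ⊆ Metric.closedBall 0 C) {L : ℝ}
    (hL : ∀ t, |deriv Real.smoothTransition t| ≤ L) {τ : ℝ} (hτ : 0 < τ) {E F : Set 𝔼}
    (h : IsStepMinimizer φ τ E F) (hE : IsAdmissible φ E) {s : ℝ}
    (hs : DifferentiableAt ℝ (fun r => volume.real (symmDiff E F ∩ {x | height x ≤ r})) s) :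
    (outerVariation (wulffShape φ) s (chi F)).toReal
        + volume.real (symmDiff E F \ {x | height x ≤ s}) ^ 2 / (2 * τ)
      ≤ (outerVariation (wulffShape φ) s (chi E)).toReal
        + 2 * C * L * deriv (fun r => volume.real (symmDiff E F ∩ {x | height x ≤ r})) s := by
  have hF := h.isAdmissible hτ hE
  have hEF := hE.volume_symmDiff_ne_top hF
  obtain ⟨hG1, hG2⟩ := glue_le (starConvex_wulffShape φ) (zero_mem_wulffShape φ) hKC hL hE.1 hF.1
    hEF hE.2.2 hF.2.2 hs
  have hA := measurableSet_height_le (d := d) s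
  have hG : IsAdmissible φ (Set.ite {x | height x ≤ s} F E) := by
    refine ⟨(hF.1.inter hA.nullMeasurableSet).union (hE.1.diff hA.nullMeasurableSet), ?_, hG1⟩
    exact (measure_mono (union_subset_union inter_subset_left sdiff_subset)).trans_lt
      (measure_union_lt_top hF.2.1 hE.2.1)
  have h1 := h.toReal_le hτ hE hG
  rw [symmDiff_ite] at h1
  have h2 : volume.real (symmDiff E F ∩ {x | height x ≤ s})
      + volume.real (symmDiff E F \ {x | height x ≤ s}) = volume.real (symmDiff E F) :=
    measureReal_inter_add_sdiff hA hEF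
  have h3 : volume.real (symmDiff E F ∩ {x | height x ≤ s}) ^ 2 / (2 * τ)
      + volume.real (symmDiff E F \ {x | height x ≤ s}) ^ 2 / (2 * τ)
      ≤ volume.real (symmDiff E F) ^ 2 / (2 * τ) := by
    rw [← add_div, ← h2]
    gcongr
    have e1 : 0 ≤ volume.real (symmDiff E F ∩ {x | height x ≤ s}) := measureReal_nonneg
    have e2 : 0 ≤ volume.real (symmDiff E F \ {x | height x ≤ s}) := measureReal_nonneg
    nlinarith [mul_nonneg e1 e2]
  simp only [anisoPerimeter] at h1
  linarith

lemma monotone_volume_real_inter {A : Set 𝔼} (hA : volume A ≠ ∞) :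
    Monotone fun r => volume.real (A ∩ {x | height x ≤ r}) := by
  intro a b hab
  refine measureReal_mono (inter_subset_inter_right _ fun x hx => ?_)
    ((measure_mono inter_subset_left).trans_lt hA.lt_top).ne
  exact le_trans (show height x ≤ a from hx) hab

lemma exists_volume_real_diff_le {E : Set 𝔼} (hE : NullMeasurableSet E) (hv : volume E < ∞)
    {ε : ℝ} (hε : 0 < ε) :
    ∃ R₀ : ℝ, ∀ R ≥ R₀, volume.real (E \ {x | height x ≤ R}) ≤ ε := by
  have hlim : Tendsto (fun n : ℕ => volume (E \ {x | height x ≤ (n : ℝ)})) atTop (𝓝 0) := by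
    have h := tendsto_measure_iInter_atTop (μ := (volume : Measure 𝔼))
      (s := fun n : ℕ => E \ {x | height x ≤ (n : ℝ)})
      (fun n => hE.diff (measurableSet_height_le _).nullMeasurableSet) ?_
      ⟨0, ((measure_mono sdiff_subset).trans_lt hv).ne⟩
    · have h0 : ⋂ n : ℕ, E \ {x | height x ≤ (n : ℝ)} = ∅ := by
        refine eq_empty_of_forall_notMem fun x hx => ?_
        obtain ⟨n, hn⟩ := exists_nat_ge (height x)
        exact (mem_iInter.1 hx n).2 hn
      rwa [h0, measure_empty] at h
    · intro a b hab
      refine sdiff_subset_sdiff_right fun x hx => ?_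
      have : (a : ℝ) ≤ b := by exact_mod_cast hab
      exact le_trans (show height x ≤ (a : ℝ) from hx) this
  obtain ⟨n, hn⟩ := (hlim.eventually_lt_const (ENNReal.ofReal_pos.2 hε)).exists
  refine ⟨n, fun R hR => ?_⟩
  have h1 : volume (E \ {x | height x ≤ R}) ≤ ENNReal.ofReal ε := by
    refine (measure_mono (sdiff_subset_sdiff_right fun x hx => ?_)).trans hn.le
    exact le_trans (show height x ≤ (n : ℝ) from hx) hR
  exact ENNReal.toReal_le_of_le_ofReal hε.le h1

lemma volume_real_diff_le_add {E F A : Set 𝔼} (hE : volume E ≠ ∞) (hEF : volume (symmDiff E F) ≠ ∞) :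
    volume.real (F \ A) ≤ volume.real (E \ A) + volume.real (symmDiff E F \ A) := by
  refine (measureReal_mono (fun x hx => ?_) ?_).trans (measureReal_union_le _ _)
  · by_cases h : x ∈ E
    · exact Or.inl ⟨h, hx.2⟩
    · exact Or.inr ⟨Or.inr ⟨hx.1, h⟩, hx.2⟩
  · exact (measure_union_lt_top ((measure_mono sdiff_subset).trans_lt hE.lt_top)
      ((measure_mono sdiff_subset).trans_lt hEF.lt_top)).ne

/-- The radius is uniform in the time step and in the choice of minimizers. The inequality of
`IsStepMinimizer.outerVariation_add_le` is summed over the steps at a common level s; the outer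
variations telescope and leave a bound on the sum of squared outer displacements. -/
lemma exists_tight_radius (φ : Seminorm ℝ 𝔼) {E₀ : Set 𝔼} (hE₀ : IsAdmissible φ E₀) {T : ℝ}
    (hT : 0 ≤ T) {ε : ℝ} (hε : 0 < ε) :
    ∃ R : ℝ, ∀ (τ : ℝ) (S : ℕ → Set 𝔼), 0 < τ → IsDiscreteFlow φ τ E₀ S → ∀ n : ℕ, n * τ ≤ T →
      volume.real (S n \ {x | height x ≤ R}) ≤ ε := by
  obtain ⟨C, hC, hKC⟩ := exists_wulffShape_subset φ
  obtain ⟨L, hL0, hL⟩ := exists_deriv_smoothTransition_bound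
  set P := (anisoPerimeter φ E₀).toReal with hP
  -- Chosen so that (T + 1) · 4ε' = (ε / 2)² in the final Cauchy–Schwarz estimate; T + 1 keeps the
  -- denominator positive when T = 0.
  set ε' := ε ^ 2 / (16 * (T + 1)) with hε'
  have hε'0 : 0 < ε' := by positivity
  obtain ⟨R₁, hR₁⟩ := exists_outerVariation_le (zero_mem_wulffShape φ) hE₀.1 hE₀.2.2 hε'0
  obtain ⟨R₂, hR₂⟩ := exists_volume_real_diff_le hE₀.1 hE₀.2.1 (half_pos hε)
  -- A bound for the total displacement up to time T, independent of τ.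
  set D := √(2 * T * P) with hD
  set R := max (max R₁ R₂) (max 1 (2 * C * L * D / ε')) with hR
  have hR0 : 0 < R := lt_of_lt_of_le one_pos ((le_max_left _ _).trans (le_max_right _ _))
  have hRD : 2 * C * L * (D / R) ≤ ε' := by
    have : 2 * C * L * D / ε' ≤ R := (le_max_right _ _).trans (le_max_right _ _)
    rw [div_le_iff₀ hε'0] at this
    rw [← mul_div_assoc, div_le_iff₀ hR0]
    linarith
  refine ⟨2 * R, fun τ S hτ hS n hn => ?_⟩
  have hadm := hS.isAdmissible hτ hE₀
  have hfin : ∀ i, volume (symmDiff (S i) (S (i + 1))) ≠ ∞ := fun i =>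
    (hadm i).volume_symmDiff_ne_top (hadm (i + 1))
  have hP0 : 0 ≤ P := ENNReal.toReal_nonneg
  have hnD : √(n * (2 * τ * P)) ≤ D := by
    refine Real.sqrt_le_sqrt ?_
    calc n * (2 * τ * P) = n * τ * (2 * P) := by ring
      _ ≤ T * (2 * P) := by gcongr
      _ = 2 * T * P := by ring
  obtain ⟨s, hs, hsd, hsD⟩ := exists_sum_deriv_le (n := n) (D := D)
    (g := fun i r => volume.real (symmDiff (S i) (S (i + 1)) ∩ {x | height x ≤ r}))
    (fun i => monotone_volume_real_inter (hfin i)) hR0 (by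
      refine le_trans (Finset.sum_le_sum fun i _ => ?_) ((hS.sum_step_le hτ hE₀ 0 n).trans hnD)
      rw [zero_add]
      refine (sub_le_self _ measureReal_nonneg).trans (measureReal_mono inter_subset_left (hfin i)))
  set κ : ℕ → ℝ := fun i => volume.real (symmDiff (S i) (S (i + 1)) \ {x | height x ≤ s}) with hκ
  set Q : ℕ → ℝ := fun i => (outerVariation (wulffShape φ) s (chi (S i))).toReal with hQ
  have hstep : ∀ m, (∑ i ∈ Finset.range m, κ i ^ 2) / (2 * τ) + Q m ≤ Q 0 + 2 * C * L *
      ∑ i ∈ Finset.range m,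
        deriv (fun r => volume.real (symmDiff (S i) (S (i + 1)) ∩ {x | height x ≤ r})) s := by
    intro m
    induction m with
    | zero => simp
    | succ m ih =>
      have := (hS.2 m).outerVariation_add_le hKC hL hτ (hadm m) (hsd m)
      rw [Finset.sum_range_succ, Finset.sum_range_succ, add_div, mul_add]
      simp only [hκ, hQ] at ih ⊢
      linarith
  have hQ0 : Q 0 ≤ ε' := by
    refine le_trans ?_ hR₁
    simp only [hQ, hS.1]
    refine ENNReal.toReal_mono ((outerVariation_le_variationOver _ _ _).trans_lt
      hE₀.2.2.lt_top).ne (outerVariation_anti _ ?_ _)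
    exact ((le_max_left _ _).trans (le_max_left _ _)).trans hs.1
  -- One ε' comes from the initial outer variation, the other from the averaged gluing error 2CLD /
  -- R.
  have hsum : ∑ i ∈ Finset.range n, κ i ^ 2 ≤ 2 * τ * (2 * ε') := by
    have h1 := hstep n
    have h2 : 0 ≤ Q n := ENNReal.toReal_nonneg
    have h3 := mul_le_mul_of_nonneg_left hsD (show 0 ≤ 2 * C * L by positivity)
    have h4 : (∑ i ∈ Finset.range n, κ i ^ 2) / (2 * τ) ≤ 2 * ε' := by linarith
    rw [div_le_iff₀ (by positivity)] at h4
    linarith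
  have hsumκ : ∑ i ∈ Finset.range n, κ i ≤ ε / 2 := by
    refine (sum_le_sqrt_mul_sum_sq κ n hsum).trans (Real.sqrt_le_iff.2 ⟨by positivity, ?_⟩)
    calc n * (2 * τ * (2 * ε')) = n * τ * (4 * ε') := by ring
      _ ≤ (T + 1) * (4 * ε') := by gcongr; linarith
      _ = (ε / 2) ^ 2 := by rw [hε']; field_simp; ring
  have htri : ∀ m, volume.real (S m \ {x | height x ≤ s}) ≤
      volume.real (S 0 \ {x | height x ≤ s}) + ∑ i ∈ Finset.range m, κ i := by
    intro m
    induction m with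
    | zero => simp
    | succ m ih =>
      rw [Finset.sum_range_succ]
      have := volume_real_diff_le_add (A := {x | height x ≤ s}) (hadm m).2.1.ne (hfin m)
      simp only [hκ] at ih ⊢
      linarith
  have h0 : volume.real (S 0 \ {x | height x ≤ s}) ≤ ε / 2 := by
    rw [hS.1]
    exact hR₂ s (((le_max_right _ _).trans (le_max_left _ _)).trans hs.1)
  calc volume.real (S n \ {x | height x ≤ 2 * R}) ≤ volume.real (S n \ {x | height x ≤ s}) := by
        refine measureReal_mono (sdiff_subset_sdiff_right fun x hx => ?_)
          ((measure_mono sdiff_subset).trans_lt (hadm n).2.1).ne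
        exact le_trans (show height x ≤ s from hx) hs.2
    _ ≤ ε := by linarith [htri n]

end

section
variable {d : ℕ}

local notation "𝔼" => EuclideanSpace ℝ (Fin d)

/-! ### Confinement on the line -/

/-- Gluing the empty set inside a sublevel set to E outside shows that the tail of E has small
perimeter at a well-chosen level; on the line such a tail is null by
`exists_volume_eq_zero_of_dim_one`. -/
lemma exists_volume_diff_eq_zero_of_dim_one (hd : d = 1) {φ : Seminorm ℝ 𝔼}
    (hφ : ∀ x, φ x = 0 → x = 0) {E : Set 𝔼} (hE : IsAdmissible φ E) :
    ∃ R : ℝ, volume (E \ {x | height x ≤ R}) = 0 := by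
  obtain ⟨C, hC, hKC⟩ := exists_wulffShape_subset φ
  obtain ⟨L, hL0, hL⟩ := exists_deriv_smoothTransition_bound
  obtain ⟨c, hc, hiso⟩ := exists_volume_eq_zero_of_dim_one hd
  obtain ⟨C', hC', hTV⟩ := exists_totalVariation_le φ hφ
  -- The tail will have anisotropic perimeter at most 2ε, hence total variation at most c / 2, below
  -- the threshold c.
  set ε := c / (4 * C') with hε
  have hε0 : 0 < ε := by positivity
  obtain ⟨R₁, hR₁⟩ := exists_outerVariation_le (zero_mem_wulffShape φ) hE.1 hE.2.2 hε0
  set D := volume.real E with hD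
  set R := max R₁ (max 1 (2 * C * L * D / ε)) with hR
  have hR0 : 0 < R := lt_of_lt_of_le one_pos ((le_max_left _ _).trans (le_max_right _ _))
  have hRD : 2 * C * L * (D / R) ≤ ε := by
    have : 2 * C * L * D / ε ≤ R := (le_max_right _ _).trans (le_max_right _ _)
    rw [div_le_iff₀ hε0] at this
    rw [← mul_div_assoc, div_le_iff₀ hR0]
    linarith
  have hsymm : symmDiff E ∅ = E := by rw [← bot_eq_empty, symmDiff_bot]
  obtain ⟨s, hs, hsd, hsD⟩ := exists_sum_deriv_le (n := 1) (D := D)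
    (g := fun _ r => volume.real (symmDiff E ∅ ∩ {x | height x ≤ r}))
    (fun _ => monotone_volume_real_inter (by rw [hsymm]; exact hE.2.1.ne)) hR0 (by
      rw [Finset.sum_range_one, hsymm]
      exact (sub_le_self _ measureReal_nonneg).trans (measureReal_mono inter_subset_left hE.2.1.ne))
  rw [Finset.sum_range_one] at hsD
  have hempty : variationOver (wulffShape φ) (chi ∅) = 0 :=
    le_antisymm (variationOver_le fun X _ => by simp [chi]) bot_le
  obtain ⟨h1, h2⟩ := glue_le (starConvex_wulffShape φ) (zero_mem_wulffShape φ) hKC hL hE.1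
    nullMeasurableSet_empty (by rw [hsymm]; exact hE.2.1.ne) hE.2.2 (by simp [hempty]) (hsd 0)
  have hite : Set.ite {x : 𝔼 | height x ≤ s} ∅ E = E \ {x | height x ≤ s} := by simp [Set.ite]
  rw [hite] at h1 h2
  refine ⟨s, hiso _ (hE.1.diff (measurableSet_height_le s).nullMeasurableSet)
    ((measure_mono sdiff_subset).trans_lt hE.2.1) ?_⟩
  have hQ : (outerVariation (wulffShape φ) s (chi E)).toReal ≤ ε := by
    refine le_trans (ENNReal.toReal_mono ((outerVariation_le_variationOver _ _ _).trans_lt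
      hE.2.2.lt_top).ne (outerVariation_anti _ ?_ _)) hR₁
    exact (le_max_left _ _).trans hs.1
  have h3 := mul_le_mul_of_nonneg_left hsD (show 0 ≤ 2 * C * L by positivity)
  have h4 : 0 ≤ (outerVariation (wulffShape φ) s (chi (∅ : Set 𝔼))).toReal :=
    ENNReal.toReal_nonneg
  have h5 : (variationOver (wulffShape φ) (chi (E \ {x | height x ≤ s}))).toReal ≤ 2 * ε := by
    rw [hempty, ENNReal.toReal_zero] at h2
    linarith
  have h6 : variationOver (wulffShape φ) (chi (E \ {x | height x ≤ s})) ≤ ENNReal.ofReal (2 * ε) :=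
    (ENNReal.le_ofReal_iff_toReal_le h1 (by positivity)).2 h5
  calc totalVariation (chi (E \ {x | height x ≤ s}))
      ≤ ENNReal.ofReal C' * ENNReal.ofReal (2 * ε) := (hTV _).trans (by gcongr; exact h6)
    _ = ENNReal.ofReal (c / 2) := by
        rw [← ENNReal.ofReal_mul hC'.le, hε]; congr 1; field_simp; ring
    _ < ENNReal.ofReal c := (ENNReal.ofReal_lt_ofReal_iff hc).2 (by linarith)

/-- A continuous approximation of the indicator function of `[-R, R]`. -/
noncomputable def trapezoid (R : ℝ) (k : ℕ) (u : ℝ) : ℝ :=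
  max 0 (1 - (k + 1) * max 0 (|u| - R))

lemma continuous_trapezoid (R : ℝ) (k : ℕ) : Continuous (trapezoid R k) := by
  unfold trapezoid; fun_prop

lemma trapezoid_mem_Icc (R : ℝ) (k : ℕ) (u : ℝ) : trapezoid R k u ∈ Icc (0 : ℝ) 1 := by
  refine ⟨le_max_left _ _, max_le zero_le_one (sub_le_self _ ?_)⟩
  positivity

lemma trapezoid_eq_one {R : ℝ} (k : ℕ) {u : ℝ} (h : |u| ≤ R) : trapezoid R k u = 1 := by
  rw [trapezoid, max_eq_left (a := (0 : ℝ)) (b := |u| - R) (by linarith)]; simp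

lemma tendsto_trapezoid {R u : ℝ} (h : R < |u|) :
    Tendsto (fun k => trapezoid R k u) atTop (𝓝 0) := by
  obtain ⟨n, hn⟩ := exists_nat_ge (1 / (|u| - R))
  have h0 : 0 < |u| - R := by linarith
  refine tendsto_const_nhds.congr' ?_
  filter_upwards [eventually_ge_atTop n] with k hk
  rw [trapezoid, max_eq_right h0.le, max_eq_left]
  rw [div_le_iff₀ h0] at hn
  have : (n : ℝ) ≤ k := by exact_mod_cast hk
  nlinarith

/-- A primitive of `trapezoid`, which approximates the projection onto `[-R, R]`. -/
noncomputable def clamp (R : ℝ) (k : ℕ) (t : ℝ) : ℝ := ∫ u in (0 : ℝ)..t, trapezoid R k u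

lemma hasDerivAt_clamp (R : ℝ) (k : ℕ) (t : ℝ) : HasDerivAt (clamp R k) (trapezoid R k t) t :=
  intervalIntegral.integral_hasDerivAt_right ((continuous_trapezoid R k).intervalIntegrable _ _)
    ((continuous_trapezoid R k).stronglyMeasurableAtFilter _ _) (continuous_trapezoid R k).continuousAt

lemma contDiff_clamp (R : ℝ) (k : ℕ) : ContDiff ℝ 1 (clamp R k) := by
  rw [contDiff_one_iff_deriv]
  refine ⟨fun t => (hasDerivAt_clamp R k t).differentiableAt, ?_⟩
  rw [show deriv (clamp R k) = trapezoid R k from funext fun t => (hasDerivAt_clamp R k t).deriv]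
  exact continuous_trapezoid R k

lemma clamp_eq {R : ℝ} (k : ℕ) {t : ℝ} (h : |t| ≤ R) : clamp R k t = t := by
  have : ∀ u ∈ uIcc 0 t, trapezoid R k u = 1 := by
    intro u hu
    refine trapezoid_eq_one k (le_trans ?_ h)
    have := abs_sub_left_of_mem_uIcc hu
    simpa using this
  rw [clamp, intervalIntegral.integral_congr this]
  simp

lemma hasCompactSupport_cutoff {s ε : ℝ} (hε : 0 < ε) :
    HasCompactSupport (cutoff (d := d) s ε) := by
  refine HasCompactSupport.of_support_subset_isCompact
    (isCompact_closedBall (0 : 𝔼) (s + 2 * ε)) fun x hx => ?_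
  rw [mem_closedBall_zero_iff]
  by_contra! hcon
  exact hx (cutoff_eq_zero hε (hcon.le.trans (norm_le_height x)))

end

/-! ### Truncation to an interval in dimension one -/

section Line

local notation "𝔼₁" => EuclideanSpace ℝ (Fin 1)

lemma norm_eq_abs_apply (x : 𝔼₁) : ‖x‖ = |x 0| := by
  rw [EuclideanSpace.norm_eq]
  simp [Real.sqrt_sq_eq_abs]

/-- The map `clamp` on the one-dimensional Euclidean space. -/
noncomputable def clampE (R : ℝ) (k : ℕ) (x : 𝔼₁) : 𝔼₁ :=
  clamp R k (x 0) • EuclideanSpace.single 0 1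

lemma contDiff_clampE (R : ℝ) (k : ℕ) : ContDiff ℝ 1 (clampE R k) := by
  refine ContDiff.smul ((contDiff_clamp R k).comp ?_) contDiff_const
  exact (EuclideanSpace.proj (0 : Fin 1) : 𝔼₁ →L[ℝ] ℝ).contDiff

lemma clampE_eq {R : ℝ} (k : ℕ) {x : 𝔼₁} (h : ‖x‖ ≤ R) : clampE R k x = x := by
  rw [norm_eq_abs_apply] at h
  rw [clampE, clamp_eq k h]
  ext i
  fin_cases i
  simp

/-- In one dimension the divergence is an ordinary derivative, so composition on the right
multiplies it by the scalar derivative of the clamp. -/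
lemma divergence_comp_clampE {X : 𝔼₁ → 𝔼₁} (hX : Differentiable ℝ X) (R : ℝ) (k : ℕ) (x : 𝔼₁) :
    divergence (fun x => X (clampE R k x)) x
      = trapezoid R k (x 0) * divergence X (clampE R k x) := by
  have h1 : HasFDerivAt (fun x : 𝔼₁ => x 0) (EuclideanSpace.proj (0 : Fin 1) : 𝔼₁ →L[ℝ] ℝ) x :=
    (EuclideanSpace.proj (0 : Fin 1) : 𝔼₁ →L[ℝ] ℝ).hasFDerivAt
  have h2 := ((hasDerivAt_clamp R k (x 0)).comp_hasFDerivAt x h1).smul_const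
    (EuclideanSpace.single (0 : Fin 1) (1 : ℝ))
  have h3 := (hX (clampE R k x)).hasFDerivAt.comp x h2
  have h4 : fderiv ℝ (fun x => X (clampE R k x)) x = _ := h3.fderiv
  simp [divergence, h4]

/-- Composing a test field X with an approximate projection onto [−R, R] keeps its values in K and,
in the limit, its divergence inside the interval, so that testing F with it amounts to testing the
truncated set with X. The composition need not have compact support; a cutoff at scale M restores it
at a cost LC|F| / M. First k → ∞, then M → ∞. -/
lemma variationOver_inter_closedBall_le {K : Set 𝔼₁} (hK : StarConvex ℝ 0 K) {C : ℝ}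
    (hKC : K ⊆ Metric.closedBall 0 C) {F : Set 𝔼₁} (hF : NullMeasurableSet F)
    (hv : volume F < ∞) (hP : variationOver K (chi F) ≠ ∞) {R : ℝ} (hR : 0 ≤ R) :
    variationOver K (chi (F ∩ Metric.closedBall 0 R)) ≤ variationOver K (chi F) := by
  obtain ⟨L, hL0, hL⟩ := exists_deriv_smoothTransition_bound
  set P := (variationOver K (chi F)).toReal with hPdef
  rw [← ENNReal.ofReal_toReal hP]
  refine variationOver_le_ofReal fun X hX => ?_
  obtain ⟨B, hB⟩ := hX.exists_divergence_bound
  have hB0 : 0 ≤ B := (abs_nonneg _).trans (hB 0)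
  have hchiI := integrable_chi hF hv
  set I : Set 𝔼₁ := Metric.closedBall 0 R with hI
  have key : ∀ M : ℝ, 1 + R ≤ M →
      ∫ x, chi (F ∩ I) x * divergence X x ≤ P + L * C * volume.real F / M := by
    intro M hM
    have hM0 : 0 < M := by linarith
    -- Equal to 1 up to height 2M, which covers the ball of radius R, with slope at most L / M.
    set η : 𝔼₁ → ℝ := cutoff M M with hη
    have hηc : ContDiff ℝ 1 η := contDiff_cutoff
    have hZc : ∀ k, ContDiff ℝ 1 fun x => X (clampE R k x) := fun k =>
      hX.1.comp (contDiff_clampE R k)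
    have hZ : ∀ k, IsTestField K fun x => η x • X (clampE R k x) := fun k =>
      ⟨hηc.smul (hZc k), (hasCompactSupport_cutoff hM0).smul_right, fun x =>
        starConvex_zero_iff.1 hK (hX.2.2 _) (cutoff_mem_Icc x).1 (cutoff_mem_Icc x).2⟩
    have hdiv : ∀ k x, divergence (fun x => η x • X (clampE R k x)) x
        = η x * (trapezoid R k (x 0) * divergence X (clampE R k x))
          + fderiv ℝ η x (X (clampE R k x)) := by
      intro k x
      rw [divergence_smul (hηc.differentiable one_ne_zero) ((hZc k).differentiable one_ne_zero),
        divergence_comp_clampE hX.differentiable]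
    have hcont1 : ∀ k, Continuous fun x : 𝔼₁ =>
        η x * (trapezoid R k (x 0) * divergence X (clampE R k x)) := by
      intro k
      have hp : Continuous fun x : 𝔼₁ => x 0 :=
        (EuclideanSpace.proj (0 : Fin 1) : 𝔼₁ →L[ℝ] ℝ).continuous
      exact hηc.continuous.mul (((continuous_trapezoid R k).comp hp).mul
        (hX.continuous_divergence.comp (contDiff_clampE R k).continuous))
    have hb1 : ∀ k (x : 𝔼₁), |η x * (trapezoid R k (x 0) * divergence X (clampE R k x))| ≤ B := by
      intro k x
      have e1 := cutoff_mem_Icc (s := M) (ε := M) x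
      have e2 := trapezoid_mem_Icc R k (x 0)
      rw [abs_mul, abs_mul, abs_of_nonneg e1.1, abs_of_nonneg e2.1]
      calc η x * (trapezoid R k (x 0) * |divergence X (clampE R k x)|)
          ≤ 1 * (1 * B) := by
            gcongr
            · exact mul_nonneg e2.1 (abs_nonneg _)
            · exact e1.2
            · exact e2.2
            · exact hB _
        _ = B := by ring
    have hb2 : ∀ k (x : 𝔼₁), |fderiv ℝ η x (X (clampE R k x))| ≤ L / M * C := by
      intro k x
      refine (abs_fderiv_cutoff_le hL hM0 x _).trans ?_
      gcongr
      simpa using hKC (hX.2.2 (clampE R k x))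
    have hi1 : ∀ k, Integrable fun x =>
        chi F x * (η x * (trapezoid R k (x 0) * divergence X (clampE R k x))) := fun k =>
      hchiI.mul_bdd (c := B) (hcont1 k).aestronglyMeasurable (Eventually.of_forall (hb1 k))
    have hi2 : ∀ k, Integrable fun x => chi F x * fderiv ℝ η x (X (clampE R k x)) := fun k =>
      hchiI.mul_bdd (c := L / M * C) (Continuous.aestronglyMeasurable
        ((hηc.continuous_fderiv one_ne_zero).clm_apply (hZc k).continuous))
        (Eventually.of_forall (hb2 k))
    have hk : ∀ k, ∫ x, chi F x * (η x * (trapezoid R k (x 0) * divergence X (clampE R k x)))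
        ≤ P + L * C * volume.real F / M := by
      intro k
      have h1 := (hZ k).integral_le hP
      simp only [hdiv, mul_add] at h1
      rw [integral_add (hi1 k) (hi2 k)] at h1
      have h2 : -∫ x, chi F x * fderiv ℝ η x (X (clampE R k x)) ≤ ∫ x, chi F x * (L / M * C) := by
        refine ((neg_le_abs _).trans (Real.norm_eq_abs _).ge).trans (norm_integral_le_of_norm_le (hchiI.mul_const _)
          (Eventually.of_forall fun x => ?_))
        rw [norm_mul, Real.norm_of_nonneg (chi_mem_Icc F x).1]
        exact mul_le_mul_of_nonneg_left (hb2 k x) (chi_mem_Icc F x).1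
      have h3 : ∫ x, chi F x = volume.real F := by
        rw [show chi F = F.indicator (fun _ => (1 : ℝ)) from rfl, integral_indicator₀ hF]
        simp
      rw [integral_mul_const, h3] at h2
      have h4 : volume.real F * (L / M * C) = L * C * volume.real F / M := by ring
      linarith
    refine le_of_tendsto' (tendsto_integral_of_dominated_convergence (fun x => chi F x * B)
      (fun k => (hi1 k).1) (hchiI.mul_const B) (fun k => ?_) ?_) hk
    · refine Eventually.of_forall fun x => ?_
      rw [norm_mul, Real.norm_of_nonneg (chi_mem_Icc F x).1]
      exact mul_le_mul_of_nonneg_left (hb1 k x) (chi_mem_Icc F x).1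
    · refine Eventually.of_forall fun x => ?_
      by_cases hx : ‖x‖ ≤ R
      · refine tendsto_const_nhds.congr fun k => ?_
        have hx' : x ∈ I := by rw [hI, mem_closedBall_zero_iff]; exact hx
        have e1 : chi (F ∩ I) x = chi F x := by
          by_cases h : x ∈ F <;> simp [chi, h, hx']
        have e2 : η x = 1 := by
          refine cutoff_eq_one hM0 ?_
          refine (Real.sqrt_le_left (by linarith)).2 ?_
          nlinarith [norm_nonneg x]
        rw [clampE_eq k hx, trapezoid_eq_one k (by rwa [← norm_eq_abs_apply]), e1, e2]
        ring
      · have hx' : x ∉ I := by rw [hI, mem_closedBall_zero_iff]; exact hx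
        rw [chi_apply_of_notMem (E := F ∩ I) fun h => hx' h.2, zero_mul]
        have ht := tendsto_trapezoid (R := R) (u := x 0)
          (by rw [← norm_eq_abs_apply]; exact not_le.1 hx)
        refine squeeze_zero_norm (a := fun k => trapezoid R k (x 0) * B) (fun k => ?_) ?_
        · have e1 := cutoff_mem_Icc (s := M) (ε := M) x
          have e2 := trapezoid_mem_Icc R k (x 0)
          rw [Real.norm_eq_abs, abs_mul, abs_mul, abs_mul, abs_of_nonneg e1.1, abs_of_nonneg e2.1]
          calc |chi F x| * (η x * (trapezoid R k (x 0) * |divergence X (clampE R k x)|))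
              ≤ 1 * (1 * (trapezoid R k (x 0) * B)) := by
                have e3 := e2.1
                have e4 := abs_chi_le F x
                have e5 := hB (clampE R k x)
                have e6 := e1.2
                gcongr
                exact mul_nonneg e1.1 (mul_nonneg e3 (abs_nonneg _))
            _ = _ := by ring
        · simpa using ht.mul_const B
  have hlim : Tendsto (fun M : ℝ => P + L * C * volume.real F / M) atTop (𝓝 P) := by
    simpa using (tendsto_const_nhds.div_atTop tendsto_id).const_add P
  refine ge_of_tendsto hlim ?_
  filter_upwards [eventually_ge_atTop (1 + R)] with M hM using key M hM

lemma symmDiff_inter_subset {α : Type*} (E F I : Set α) :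
    symmDiff E (F ∩ I) ⊆ (symmDiff E F ∩ I) ∪ (E \ I) := by
  intro x hx
  by_cases hxI : x ∈ I <;> by_cases hxE : x ∈ E <;> by_cases hxF : x ∈ F <;>
    simp_all [mem_symmDiff]

/-- Truncating F to the interval does not increase its perimeter and, as E lies in the interval up
to a null set, removes the part of the distance to E lying outside it. Minimality forces that part
to vanish. -/
lemma IsStepMinimizer.volume_diff_closedBall_eq_zero {φ : Seminorm ℝ 𝔼₁} {τ : ℝ} (hτ : 0 < τ)
    {E F : Set 𝔼₁} (h : IsStepMinimizer φ τ E F) (hE : IsAdmissible φ E) {R : ℝ} (hR : 0 ≤ R)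
    (hER : volume (E \ Metric.closedBall 0 R) = 0) :
    volume (F \ Metric.closedBall 0 R) = 0 := by
  obtain ⟨C, hC, hKC⟩ := exists_wulffShape_subset φ
  have hF := h.isAdmissible hτ hE
  set I : Set 𝔼₁ := Metric.closedBall 0 R with hI
  have hIm : MeasurableSet I := Metric.isClosed_closedBall.measurableSet
  have hPG := variationOver_inter_closedBall_le (starConvex_wulffShape φ) hKC hF.1 hF.2.1
    hF.2.2 hR
  have hG : IsAdmissible φ (F ∩ I) := ⟨hF.1.inter hIm.nullMeasurableSet,
    (measure_mono inter_subset_left).trans_lt hF.2.1, (hPG.trans_lt hF.2.2.lt_top).ne⟩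
  have h1 := h.toReal_le hτ hE hG
  have h2 : (anisoPerimeter φ (F ∩ I)).toReal ≤ (anisoPerimeter φ F).toReal :=
    ENNReal.toReal_mono hF.2.2 hPG
  have h3 : volume.real (symmDiff E F) ^ 2 ≤ volume.real (symmDiff E (F ∩ I)) ^ 2 := by
    have : volume.real (symmDiff E F) ^ 2 / (2 * τ)
      ≤ volume.real (symmDiff E (F ∩ I)) ^ 2 / (2 * τ) := by linarith
    rwa [div_le_div_iff_of_pos_right (by positivity)] at this
  have h4 : volume.real (symmDiff E F) ≤ volume.real (symmDiff E (F ∩ I)) :=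
    (sq_le_sq₀ measureReal_nonneg measureReal_nonneg).1 h3
  have hEF := hE.volume_symmDiff_ne_top hF
  have h5 : volume.real (symmDiff E F ∩ I) + volume.real (symmDiff E F \ I)
      = volume.real (symmDiff E F) := measureReal_inter_add_sdiff hIm hEF
  have hER' : volume.real (E \ I) = 0 := by rw [measureReal_def, hER, ENNReal.toReal_zero]
  have h6 : volume.real (symmDiff E (F ∩ I)) ≤ volume.real (symmDiff E F ∩ I) := by
    refine (measureReal_mono (symmDiff_inter_subset E F I) ?_).trans ((measureReal_union_le _ _).trans ?_)
    · exact (measure_union_lt_top ((measure_mono inter_subset_left).trans_lt hEF.lt_top)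
        ((measure_mono sdiff_subset).trans_lt hE.2.1)).ne
    · rw [hER', add_zero]
  have h7 := volume_real_diff_le_add (A := I) hE.2.1.ne hEF
  have h8 : volume.real (F \ I) = 0 := le_antisymm (by linarith) measureReal_nonneg
  exact (measureReal_eq_zero_iff ((measure_mono sdiff_subset).trans_lt hF.2.1).ne).1 h8

end Line

/-! ### Uniform bounds on the volume -/

section VolumeBound

variable {d : ℕ}

local notation "𝔼" => EuclideanSpace ℝ (Fin d)

lemma exists_totalVariation_bound {φ : Seminorm ℝ 𝔼} (hφ : ∀ x, φ x = 0 → x = 0) {E₀ : Set 𝔼}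
    (hE₀ : IsAdmissible φ E₀) : ∃ M : ℝ≥0, ∀ (τ : ℝ) (S : ℕ → Set 𝔼), 0 < τ →
      IsDiscreteFlow φ τ E₀ S → ∀ n, totalVariation (chi (S n)) ≤ M := by
  obtain ⟨C, hC, hTV⟩ := exists_totalVariation_le φ hφ
  refine ⟨(ENNReal.ofReal C * anisoPerimeter φ E₀).toNNReal, fun τ S hτ hS n => ?_⟩
  rw [ENNReal.coe_toNNReal (ENNReal.mul_ne_top ENNReal.ofReal_ne_top hE₀.2.2)]
  refine (hTV _).trans ?_
  gcongr
  exact hS.anisoPerimeter_le hτ hE₀ n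

/-- In dimension zero the whole space has finite measure. On the line perimeter does not control
volume, and confinement to a fixed interval is used instead. For d ≥ 2 the isoperimetric bound
applies. -/
lemma exists_volume_bound_flow {φ : Seminorm ℝ 𝔼} (hφ : ∀ x, φ x = 0 → x = 0) {E₀ : Set 𝔼}
    (hE₀ : IsAdmissible φ E₀) : ∃ V : ℝ≥0, ∀ (τ : ℝ) (S : ℕ → Set 𝔼), 0 < τ →
      IsDiscreteFlow φ τ E₀ S → ∀ n, volume (S n) ≤ V := by
  rcases Nat.lt_or_ge d 2 with hd | hd
  · interval_cases d
    · refine ⟨(volume (univ : Set (EuclideanSpace ℝ (Fin 0)))).toNNReal, fun τ S _ _ n => ?_⟩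
      have hfin : volume (univ : Set (EuclideanSpace ℝ (Fin 0))) ≠ ∞ :=
        (isCompact_univ.measure_lt_top).ne
      rw [ENNReal.coe_toNNReal hfin]
      exact measure_mono (subset_univ _)
    · obtain ⟨R, hR⟩ := exists_volume_diff_eq_zero_of_dim_one rfl hφ hE₀
      have hR' : volume (E₀ \ Metric.closedBall 0 (max R 0)) = 0 := by
        refine measure_mono_null (sdiff_subset_sdiff_right fun x hx => ?_) hR
        rw [mem_closedBall_zero_iff]
        exact (norm_le_height x).trans (le_max_of_le_left hx)
      refine ⟨(volume (Metric.closedBall (0 : EuclideanSpace ℝ (Fin 1)) (max R 0))).toNNReal,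
        fun τ S hτ hS n => ?_⟩
      rw [ENNReal.coe_toNNReal measure_closedBall_lt_top.ne]
      have hnull : volume (S n \ Metric.closedBall 0 (max R 0)) = 0 := by
        induction n with
        | zero => rw [hS.1]; exact hR'
        | succ n ih =>
          exact (hS.2 n).volume_diff_closedBall_eq_zero hτ (hS.isAdmissible hτ hE₀ n)
            (le_max_right _ _) ih
      exact measure_mono_ae (ae_le_set.2 hnull)
  · obtain ⟨M, hM⟩ := exists_totalVariation_bound hφ hE₀
    obtain ⟨V, hV⟩ := exists_volume_bound hd M
    refine ⟨V, fun τ S hτ hS n => hV _ (hS.isAdmissible hτ hE₀ n).1 (hS.isAdmissible hτ hE₀ n).2.1 ?_⟩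
    rw [ENNReal.ofReal_coe_nnreal]
    exact hM τ S hτ hS n

end VolumeBound

section
variable {d : ℕ}

local notation "𝔼" => EuclideanSpace ℝ (Fin d)

/-! ### Compactness in `L¹` -/

lemma tendsto_volume_symmDiff_inter {F : ℕ → Set 𝔼} {G B : Set 𝔼}
    (hF : ∀ n, NullMeasurableSet (F n)) (hG : NullMeasurableSet G) (hB : MeasurableSet B)
    (hBv : volume B ≠ ∞)
    (hlim : ∀ᵐ x, Tendsto (fun n => chi (F n) x) atTop (𝓝 (chi G x))) :
    Tendsto (fun n => volume (symmDiff (F n) G ∩ B)) atTop (𝓝 0) := by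
  have h1 : ∀ n, volume (symmDiff (F n) G ∩ B) = ∫⁻ x in B, ‖chi (F n) x - chi G x‖ₑ := by
    intro n
    simp only [enorm_chi_sub]
    rw [lintegral_indicator_one₀ ((nullMeasurableSet_symmDiff (hF n) hG).mono_ac
      Measure.restrict_le_self.absolutelyContinuous), Measure.restrict_apply' hB]
  simp only [h1]
  have h2 : Tendsto (fun n => ∫⁻ x in B, ‖chi (F n) x - chi G x‖ₑ) atTop
      (𝓝 (∫⁻ x in B, (0 : ℝ≥0∞))) := by
    refine tendsto_lintegral_of_dominated_convergence' (fun _ => 1) (fun n => ?_) (fun n => ?_) ?_ ?_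
    · exact (((aestronglyMeasurable_chi (hF n)).sub (aestronglyMeasurable_chi hG)).enorm).restrict
    · refine Eventually.of_forall fun x => ?_
      beta_reduce
      rw [enorm_chi_sub]
      exact indicator_le_self' (fun _ _ => zero_le_one) x
    · rw [lintegral_const, one_mul, Measure.restrict_apply_univ]
      exact hBv
    · filter_upwards [ae_restrict_of_ae hlim] with x hx
      simpa using (hx.sub_const (chi G x)).enorm
  simpa using h2

lemma volume_height_le_lt_top (R : ℝ) : volume {x : 𝔼 | height x ≤ R} < ∞ := by
  refine (measure_mono fun x hx => ?_).trans_lt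
    (measure_closedBall_lt_top (x := (0 : 𝔼)) (r := R))
  rw [mem_closedBall_zero_iff]
  exact (norm_le_height x).trans hx

/-- Convergence holds on each sublevel set, which has finite volume, by dominated convergence;
tightness makes the two tails small uniformly in n. -/
lemma tendsto_volume_symmDiff_of_tight {F : ℕ → Set 𝔼} {G : Set 𝔼}
    (hF : ∀ n, NullMeasurableSet (F n)) (hG : NullMeasurableSet G) {R : ℕ → ℝ}
    (hFR : ∀ n k, volume (F n \ {x | height x ≤ R k}) ≤ ENNReal.ofReal (1 / ((k : ℝ) + 1)))
    (hGR : ∀ k, volume (G \ {x | height x ≤ R k}) ≤ ENNReal.ofReal (1 / ((k : ℝ) + 1)))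
    (hlim : ∀ᵐ x, Tendsto (fun n => chi (F n) x) atTop (𝓝 (chi G x))) :
    Tendsto (fun n => volume (symmDiff (F n) G)) atTop (𝓝 0) := by
  rw [ENNReal.tendsto_nhds_zero]
  intro ε hε
  have hε3 : 0 < ε / 3 := ENNReal.div_pos hε.ne' (by norm_num)
  have hk0 : Tendsto (fun k : ℕ => ENNReal.ofReal (1 / ((k : ℝ) + 1))) atTop (𝓝 0) := by
    have := ENNReal.continuous_ofReal.continuousAt.tendsto.comp
      (tendsto_one_div_add_atTop_nhds_zero_nat (𝕜 := ℝ))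
    rwa [ENNReal.ofReal_zero] at this
  obtain ⟨k, hk⟩ := (ENNReal.tendsto_nhds_zero.1 hk0 _ hε3).exists
  filter_upwards [ENNReal.tendsto_nhds_zero.1 (tendsto_volume_symmDiff_inter hF hG
    (measurableSet_height_le (R k)) (volume_height_le_lt_top _).ne hlim) _ hε3] with n hn
  calc volume (symmDiff (F n) G)
      ≤ volume ((symmDiff (F n) G ∩ {x | height x ≤ R k})
        ∪ ((F n \ {x | height x ≤ R k}) ∪ (G \ {x | height x ≤ R k}))) := by
        refine measure_mono fun x hx => ?_
        by_cases h : x ∈ {x : 𝔼 | height x ≤ R k}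
        · exact Or.inl ⟨hx, h⟩
        · rcases hx with hx | hx
          · exact Or.inr (Or.inl ⟨hx.1, h⟩)
          · exact Or.inr (Or.inr ⟨hx.1, h⟩)
    _ ≤ ε / 3 + (ε / 3 + ε / 3) := by
        refine (measure_union_le _ _).trans (add_le_add hn ?_)
        exact (measure_union_le _ _).trans
          (add_le_add ((hFR n k).trans hk) ((hGR k).trans hk))
    _ = ε := by rw [← add_assoc, ENNReal.add_thirds]

/-- Sets with bounds on volume, perimeter, and on the volume outside of large sublevel sets. -/
structure IsTightBounded (V M : ℝ≥0) (R : ℕ → ℝ) (F : Set 𝔼) : Prop where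
  nullMeasurable : NullMeasurableSet F
  volume_le : volume F ≤ V
  totalVariation_le : totalVariation (chi F) ≤ M
  tight : ∀ k : ℕ, volume (F \ {x | height x ≤ R k}) ≤ ENNReal.ofReal (1 / ((k : ℝ) + 1))

lemma IsTightBounded.memLp {V M : ℝ≥0} {R : ℕ → ℝ} {F : Set 𝔼} (h : IsTightBounded V M R F) :
    MemLp (chi F) 1 volume :=
  memLp_one_iff_integrable.2
    (integrable_chi h.nullMeasurable (h.volume_le.trans_lt ENNReal.coe_lt_top))

lemma IsTightBounded.edist_toLp {V M : ℝ≥0} {R : ℕ → ℝ} {F G : Set 𝔼}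
    (hF : IsTightBounded V M R F) (hG : IsTightBounded V M R G) :
    edist (hF.memLp.toLp (chi F)) (hG.memLp.toLp (chi G)) = volume (symmDiff F G) := by
  rw [Lp.edist_toLp_toLp, eLpNorm_chi_sub hF.nullMeasurable hG.nullMeasurable]

/-- All the defining bounds pass to an a.e. limit by lower semicontinuity, and tightness upgrades
a.e. convergence to convergence in volume. -/
lemma IsTightBounded.exists_subseq {V M : ℝ≥0} {R : ℕ → ℝ} {F : ℕ → Set 𝔼}
    (hF : ∀ n, IsTightBounded V M R (F n)) : ∃ (G : Set 𝔼) (φ : ℕ → ℕ), StrictMono φ ∧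
      IsTightBounded V M R G ∧ Tendsto (fun n => volume (symmDiff (F (φ n)) G)) atTop (𝓝 0) := by
  obtain ⟨G, φ, hφ, hG, hlim⟩ := exists_subseq_tendsto_ae (fun n => (hF n).nullMeasurable)
    (fun n => (hF n).volume_le) (fun n => (hF n).totalVariation_le)
  have hGb : IsTightBounded V M R G := by
    refine ⟨hG.nullMeasurableSet, ?_, ?_, fun k => ?_⟩
    · exact volume_le_of_tendsto (fun n => (hF (φ n)).nullMeasurable) hG.nullMeasurableSet hlim
        (fun n => (hF _).volume_le) tendsto_const_nhds
    · exact variationOver_chi_le_of_tendsto (fun n => (hF (φ n)).nullMeasurable) hlim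
        (fun n => (hF _).totalVariation_le) tendsto_const_nhds
    · refine volume_le_of_tendsto (F := fun n => F (φ n) \ {x | height x ≤ R k})
        (fun n => (hF (φ n)).nullMeasurable.diff (measurableSet_height_le _).nullMeasurableSet)
        (hG.nullMeasurableSet.diff (measurableSet_height_le _).nullMeasurableSet) ?_
        (fun n => (hF _).tight k) tendsto_const_nhds
      filter_upwards [hlim] with x hx
      simpa only [sdiff_eq] using tendsto_chi_inter hx
  exact ⟨G, φ, hφ, hGb, tendsto_volume_symmDiff_of_tight (fun n => (hF (φ n)).nullMeasurable)
    hG.nullMeasurableSet (fun n => (hF _).tight) hGb.tight hlim⟩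

lemma isCompact_setOf_isTightBounded (V M : ℝ≥0) (R : ℕ → ℝ) :
    IsCompact {f : Lp ℝ 1 (volume : Measure 𝔼) |
      ∃ (F : Set 𝔼) (hF : IsTightBounded V M R F), f = hF.memLp.toLp (chi F)} := by
  refine IsSeqCompact.isCompact ?_
  intro f hf
  choose F hF hfF using hf
  obtain ⟨G, φ, hφ, hG, hlim⟩ := IsTightBounded.exists_subseq hF
  refine ⟨hG.memLp.toLp (chi G), ⟨G, hG, rfl⟩, φ, hφ, ?_⟩
  rw [tendsto_iff_edist_tendsto_0]
  refine hlim.congr fun n => ?_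
  rw [Function.comp_apply, hfF, (hF _).edist_toLp hG]

/-- Diagonal extraction for countably many sequences of sets. -/
lemma exists_subseq_cauchy {ι : Type*} [Countable ι] {V M : ℝ≥0} {R : ι → ℕ → ℝ}
    {A : ℕ → ι → Set 𝔼} (hA : ∀ j q, IsTightBounded V M (R q) (A j q)) :
    ∃ ψ : ℕ → ℕ, StrictMono ψ ∧ ∀ q, ∀ ε : ℝ≥0∞, 0 < ε → ∃ J, ∀ i ≥ J, ∀ j ≥ J,
      volume (symmDiff (A (ψ i) q) (A (ψ j) q)) < ε := by
  -- Tychonoff performs the diagonal argument: a countable product of metric spaces is first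
  -- countable, so its compact subsets are sequentially compact.
  have hK : IsCompact (Set.pi univ fun q : ι => {f : Lp ℝ 1 (volume : Measure 𝔼) |
      ∃ (F : Set 𝔼) (hF : IsTightBounded V M (R q) F), f = hF.memLp.toLp (chi F)}) :=
    isCompact_univ_pi fun q => isCompact_setOf_isTightBounded V M (R q)
  obtain ⟨a, -, ψ, hψ, hlim⟩ := hK.tendsto_subseq
    (x := fun j q => (hA j q).memLp.toLp (chi (A j q))) fun j q _ => ⟨A j q, hA j q, rfl⟩
  refine ⟨ψ, hψ, fun q ε hε => ?_⟩
  have hq := (tendsto_pi_nhds.1 hlim q).cauchySeq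
  obtain ⟨J, hJ⟩ := EMetric.cauchySeq_iff.1 hq ε hε
  refine ⟨J, fun i hi j hj => ?_⟩
  have := hJ i hi j hj
  simp only [Function.comp_apply] at this
  rwa [(hA _ q).edist_toLp (hA _ q)] at this

/-! ### Fast Cauchy sequences of sets -/

/-- A point avoiding all consecutive symmetric differences from index k on belongs to every later
set or to none, so the liminf agrees with `B k` there; the exceptional measures sum geometrically.
-/
lemma measure_symmDiff_liminf_le {α : Type*} [MeasurableSpace α] {μ : Measure α} {B : ℕ → Set α}
    {k : ℕ} (h : ∀ j ≥ k, μ (symmDiff (B j) (B (j + 1))) ≤ 2⁻¹ ^ j) :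
    μ (symmDiff {x | ∃ m, ∀ j ≥ m, x ∈ B j} (B k)) ≤ 2 * 2⁻¹ ^ k := by
  have hsub : symmDiff {x | ∃ m, ∀ j ≥ m, x ∈ B j} (B k)
      ⊆ ⋃ i : ℕ, symmDiff (B (k + i)) (B (k + i + 1)) := by
    intro x hx
    by_contra hcon
    simp only [mem_iUnion, not_exists] at hcon
    have hstep : ∀ i, x ∈ B (k + i) ↔ x ∈ B k := by
      intro i
      induction i with
      | zero => simp
      | succ i ih =>
        rw [← ih, ← add_assoc]
        have := hcon i
        rw [mem_symmDiff] at this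
        tauto
    rcases hx with ⟨⟨m, hm⟩, hxk⟩ | ⟨hxk, hx⟩
    · exact hxk ((hstep m).1 (hm (k + m) (Nat.le_add_left _ _)))
    · refine hx ⟨k, fun j hj => ?_⟩
      obtain ⟨i, rfl⟩ := Nat.exists_eq_add_of_le hj
      exact (hstep i).2 hxk
  calc μ (symmDiff {x | ∃ m, ∀ j ≥ m, x ∈ B j} (B k))
      ≤ ∑' i : ℕ, μ (symmDiff (B (k + i)) (B (k + i + 1))) :=
        (measure_mono hsub).trans (measure_iUnion_le _)
    _ ≤ ∑' i : ℕ, 2⁻¹ ^ k * 2⁻¹ ^ i := by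
        refine ENNReal.tsum_le_tsum fun i => ?_
        rw [← pow_add]
        exact h _ (Nat.le_add_right _ _)
    _ = 2 * 2⁻¹ ^ k := by
        rw [ENNReal.tsum_mul_left, ENNReal.tsum_geometric, ENNReal.one_sub_inv_two, inv_inv,
          mul_comm]

lemma exists_subseq_tendsto_ae_of_symmDiff {F : ℕ → Set 𝔼} {G : Set 𝔼}
    (hF : ∀ n, NullMeasurableSet (F n)) (hG : NullMeasurableSet G)
    (h : Tendsto (fun n => volume (symmDiff (F n) G)) atTop (𝓝 0)) :
    ∃ φ : ℕ → ℕ, StrictMono φ ∧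
      ∀ᵐ x, Tendsto (fun n => chi (F (φ n)) x) atTop (𝓝 (chi G x)) := by
  have hmeas : TendstoInMeasure volume (fun n => chi (F n)) atTop (chi G) := by
    refine tendstoInMeasure_of_tendsto_eLpNorm one_ne_zero
      (fun n => aestronglyMeasurable_chi (hF n)) (aestronglyMeasurable_chi hG) ?_
    simpa only [eLpNorm_chi_sub (hF _) hG] using h
  exact hmeas.exists_seq_tendsto_ae

end

section
variable {d : ℕ}

local notation "𝔼" => EuclideanSpace ℝ (Fin d)

/-! ### Passage to the limit -/

/-- The number k of steps between the two times satisfies k τ ≤ |s − t| + τ; the extra τ is the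
rounding error. -/
lemma IsDiscreteFlow.volume_symmDiff_floor_le {φ : Seminorm ℝ 𝔼} {τ : ℝ} {E₀ : Set 𝔼}
    {S : ℕ → Set 𝔼} (hS : IsDiscreteFlow φ τ E₀ S) (hτ : 0 < τ) (hE₀ : IsAdmissible φ E₀)
    {s t : ℝ} (hs : 0 ≤ s) (ht : 0 ≤ t) :
    volume (symmDiff (S ⌊s / τ⌋₊) (S ⌊t / τ⌋₊))
      ≤ ENNReal.ofReal √(2 * (anisoPerimeter φ E₀).toReal * (|s - t| + τ)) := by
  wlog hst : s ≤ t generalizing s t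
  · rw [symmDiff_comm, abs_sub_comm]
    exact this ht hs (le_of_not_ge hst)
  obtain ⟨k, hk⟩ := Nat.exists_eq_add_of_le
    (Nat.floor_mono (div_le_div_of_nonneg_right hst hτ.le) : ⌊s / τ⌋₊ ≤ ⌊t / τ⌋₊)
  have hkτ : k * τ ≤ |s - t| + τ := by
    have h1 : (⌊t / τ⌋₊ : ℝ) ≤ t / τ := Nat.floor_le (by positivity)
    have h2 : s / τ < ⌊s / τ⌋₊ + 1 := Nat.lt_floor_add_one _
    rw [le_div_iff₀ hτ, hk] at h1
    rw [div_lt_iff₀ hτ] at h2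
    push_cast at h1
    rw [abs_sub_comm, abs_of_nonneg (sub_nonneg.2 hst)]
    linarith
  rw [hk, ← ENNReal.ofReal_toReal ((hS.isAdmissible hτ hE₀ _).volume_symmDiff_ne_top
    (hS.isAdmissible hτ hE₀ _))]
  refine ENNReal.ofReal_le_ofReal ((hS.volume_real_symmDiff_le hτ hE₀ _ k).trans
    (Real.sqrt_le_sqrt ?_))
  calc (k : ℝ) * (2 * τ * (anisoPerimeter φ E₀).toReal)
      = 2 * (anisoPerimeter φ E₀).toReal * (k * τ) := by ring
    _ ≤ _ := mul_le_mul_of_nonneg_left hkτ (by positivity)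

lemma tendsto_ofReal_sqrt_mul (c : ℝ) {α : Type*} {l : Filter α} {h : α → ℝ} {a : ℝ}
    (hh : Tendsto h l (𝓝 a)) :
    Tendsto (fun x => ENNReal.ofReal √(c * h x)) l (𝓝 (ENNReal.ofReal √(c * a))) :=
  ENNReal.tendsto_ofReal ((hh.const_mul c).sqrt)

/-- A sequence of approximately equicontinuous families of sets which is Cauchy at rational times
is Cauchy uniformly on bounded time intervals. -/
lemma uniform_cauchy_of_grid {α : Type*} [MeasurableSpace α] {μ : Measure α} {c : ℝ} (hc : 0 ≤ c)
    {τ : ℕ → ℝ} (hτ : Tendsto τ atTop (𝓝 0)) {A : ℕ → ℝ → Set α}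
    (hA : ∀ j s t, 0 ≤ s → 0 ≤ t →
      μ (symmDiff (A j s) (A j t)) ≤ ENNReal.ofReal √(c * (|s - t| + τ j)))
    (hgrid : ∀ q : ℚ, 0 ≤ q → ∀ ε : ℝ≥0∞, 0 < ε → ∃ J, ∀ i ≥ J, ∀ j ≥ J,
      μ (symmDiff (A i q) (A j q)) < ε) (T : ℕ) {ε : ℝ≥0∞} (hε : 0 < ε) :
    ∃ J, ∀ i ≥ J, ∀ j ≥ J, ∀ t : ℝ, 0 ≤ t → t ≤ T → μ (symmDiff (A i t) (A j t)) ≤ ε := by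
  have hε3 : 0 < ε / 3 := ENNReal.div_pos hε.ne' (by norm_num)
  have hlim := tendsto_ofReal_sqrt_mul c (tendsto_id (x := 𝓝 (0 : ℝ)))
  rw [mul_zero, Real.sqrt_zero, ENNReal.ofReal_zero, ENNReal.tendsto_nhds_zero] at hlim
  obtain ⟨δ, hδ, hδε⟩ := Metric.eventually_nhds_iff.1 (hlim _ hε3)
  -- Mesh of the time grid: half of δ goes to rounding t to the grid, the other half to the time
  -- step.
  obtain ⟨m, hm⟩ := exists_nat_one_div_lt (half_pos hδ)
  obtain ⟨J₁, hJ₁⟩ := eventually_atTop.1 (hτ.eventually_lt_const (half_pos hδ))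
  choose J hJ using fun q : ℕ => hgrid ((q : ℚ) / ((m : ℚ) + 1)) (by positivity) _ hε3
  -- Only finitely many grid points lie in [0, T], so one index works for all of them.
  refine ⟨max J₁ ((Finset.range (T * (m + 1) + 1)).sup J), fun i hi j hj t ht htT => ?_⟩
  have hm0 : (0 : ℝ) < (m : ℝ) + 1 := by positivity
  set q := ⌊t * ((m : ℝ) + 1)⌋₊ with hq
  have hqT : q ∈ Finset.range (T * (m + 1) + 1) := by
    rw [Finset.mem_range, Nat.lt_succ_iff]
    refine Nat.floor_le_of_le ?_
    push_cast
    gcongr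
  have hJq := Finset.le_sup (f := J) hqT
  set r : ℝ := (((q : ℚ) / ((m : ℚ) + 1) : ℚ) : ℝ) with hr
  have hr' : r = q / ((m : ℝ) + 1) := by rw [hr]; push_cast; rfl
  have hr0 : 0 ≤ r := by rw [hr']; positivity
  have htr : |t - r| ≤ 1 / ((m : ℝ) + 1) := by
    have h1 : (q : ℝ) ≤ t * ((m : ℝ) + 1) := Nat.floor_le (by positivity)
    have h2 : t * ((m : ℝ) + 1) < q + 1 := Nat.lt_floor_add_one _
    have h3 : t - r = (t * ((m : ℝ) + 1) - q) / ((m : ℝ) + 1) := by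
      rw [hr']; field_simp
    rw [h3, abs_of_nonneg (by apply div_nonneg <;> linarith)]
    gcongr
    linarith
  have hstep : ∀ i ≥ J₁, μ (symmDiff (A i t) (A i r)) ≤ ε / 3 := by
    intro i hi
    have h1 := hJ₁ i hi
    calc μ (symmDiff (A i t) (A i r)) ≤ ENNReal.ofReal √(c * (|t - r| + τ i)) := hA i t r ht hr0
      -- No sign is assumed on `τ i`; the maximum with 0 places the argument within δ of 0.
      _ ≤ ENNReal.ofReal √(c * max 0 (|t - r| + τ i)) := by gcongr; exact le_max_right _ _
      _ ≤ ε / 3 := by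
        refine hδε ?_
        rw [Real.dist_0_eq_abs, abs_of_nonneg (le_max_left _ _)]
        exact max_lt hδ (by linarith)
  calc μ (symmDiff (A i t) (A j t))
      ≤ μ (symmDiff (A i t) (A i r)) + μ (symmDiff (A i r) (A j t)) := measure_symmDiff_le _ _ _
    _ ≤ μ (symmDiff (A i t) (A i r)) + (μ (symmDiff (A i r) (A j r)) + μ (symmDiff (A j r) (A j t)))
        := add_le_add le_rfl (measure_symmDiff_le _ _ _)
    _ ≤ ε / 3 + (ε / 3 + ε / 3) := by
        refine add_le_add (hstep i ((le_max_left _ _).trans hi)) (add_le_add ?_ ?_)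
        · exact (hJ q i (hJq.trans ((le_max_right _ _).trans hi)) j
            (hJq.trans ((le_max_right _ _).trans hj))).le
        · rw [symmDiff_comm]
          exact hstep j ((le_max_left _ _).trans hj)
    _ = ε := by rw [← add_assoc, ENNReal.add_thirds]

/-- One subsequence serves all times, with control on [0, k] from index k on. The limit is given by
an explicit set formula rather than chosen separately at each time, which makes its joint
measurability accessible. -/
lemma exists_subseq_fast_cauchy {α : Type*} [MeasurableSpace α] {μ : Measure α}
    {A : ℕ → ℝ → Set α}
    (hA : ∀ T : ℕ, ∀ ε : ℝ≥0∞, 0 < ε → ∃ J, ∀ i ≥ J, ∀ j ≥ J, ∀ t : ℝ, 0 ≤ t → t ≤ T →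
      μ (symmDiff (A i t) (A j t)) ≤ ε) :
    ∃ θ : ℕ → ℕ, StrictMono θ ∧ ∀ k : ℕ, ∀ t : ℝ, 0 ≤ t → t ≤ k →
      μ (symmDiff {x | ∃ m, ∀ j ≥ m, x ∈ A (θ j) t} (A (θ k) t)) ≤ 2 * 2⁻¹ ^ k := by
  obtain ⟨θ, hθ, hθA⟩ := extraction_forall_of_eventually'
    (P := fun n k => ∀ i ≥ k, ∀ t : ℝ, 0 ≤ t → t ≤ n → μ (symmDiff (A k t) (A i t)) ≤ 2⁻¹ ^ n)
    (fun n => by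
      obtain ⟨J, hJ⟩ := hA n (2⁻¹ ^ n) (ENNReal.pow_pos (by simp) n)
      exact ⟨J, fun k hk i hi => hJ k hk i (hk.trans hi)⟩)
  refine ⟨θ, hθ, fun k t ht htk => measure_symmDiff_liminf_le (B := fun j => A (θ j) t)
    fun j hj => hθA j _ (hθ.monotone j.le_succ) t ht (htk.trans (by exact_mod_cast hj))⟩

/-- The space-time graph of a discrete flow is a countable union of slabs, hence jointly measurable.
-/
lemma setOf_mem_floor_eq {α : Type*} {τ : ℝ} (hτ : 0 < τ) (S : ℕ → Set α) :
    {p : ℝ × α | 0 ≤ p.1 ∧ p.2 ∈ S ⌊p.1 / τ⌋₊}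
      = ⋃ n : ℕ, Ico (n * τ) ((n + 1) * τ) ×ˢ S n := by
  ext ⟨t, x⟩
  simp only [mem_ofPred_eq, mem_iUnion, mem_prod, mem_Ico]
  constructor
  · rintro ⟨ht, hx⟩
    refine ⟨_, ⟨?_, ?_⟩, hx⟩
    · exact (le_div_iff₀ hτ).1 (Nat.floor_le (by positivity))
    · exact (div_lt_iff₀ hτ).1 (Nat.lt_floor_add_one _)
  · rintro ⟨n, ⟨h1, h2⟩, hx⟩
    have ht : 0 ≤ t := le_trans (by positivity) h1
    refine ⟨ht, ?_⟩
    rwa [(Nat.floor_eq_iff (by positivity)).2 ⟨(le_div_iff₀ hτ).2 h1, (div_lt_iff₀ hτ).2 h2⟩]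

lemma nullMeasurableSet_setOf_mem_floor {τ : ℝ} (hτ : 0 < τ) {S : ℕ → Set 𝔼}
    (hS : ∀ n, NullMeasurableSet (S n)) :
    NullMeasurableSet {p : ℝ × 𝔼 | 0 ≤ p.1 ∧ p.2 ∈ S ⌊p.1 / τ⌋₊} := by
  rw [setOf_mem_floor_eq hτ]
  exact NullMeasurableSet.iUnion fun n => measurableSet_Ico.nullMeasurableSet.prod (hS n)

lemma nullMeasurableSet_liminf {α : Type*} [MeasurableSpace α] {μ : Measure α} {B : ℕ → Set α}
    (hB : ∀ n, NullMeasurableSet (B n) μ) : NullMeasurableSet {x | ∃ m, ∀ j ≥ m, x ∈ B j} μ := by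
  have : {x | ∃ m, ∀ j ≥ m, x ∈ B j} = ⋃ m : ℕ, ⋂ j : ℕ, ⋂ _ : j ≥ m, B j := by
    ext x; simp
  rw [this]
  exact .iUnion fun m => .iInter fun j => .iInter fun _ => hB j

/-- Along a sequence of time steps, the discrete flows converge locally uniformly in time. -/
lemma exists_subseq_flow {φ : Seminorm ℝ 𝔼} (hφ : ∀ x, φ x = 0 → x = 0) {E₀ : Set 𝔼}
    (hE₀ : IsAdmissible φ E₀) {S : ℝ → ℕ → Set 𝔼}
    (hS : ∀ τ, 0 < τ → IsDiscreteFlow φ τ E₀ (S τ)) :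
    ∃ τ : ℕ → ℝ, (∀ k, 0 < τ k) ∧ Tendsto τ atTop (𝓝 0) ∧ ∀ k : ℕ, ∀ t : ℝ, 0 ≤ t → t ≤ k →
      volume (symmDiff {x | ∃ m, ∀ j ≥ m, x ∈ S (τ j) ⌊t / τ j⌋₊} (S (τ k) ⌊t / τ k⌋₊))
        ≤ 2 * 2⁻¹ ^ k := by
  obtain ⟨M, hM⟩ := exists_totalVariation_bound hφ hE₀
  obtain ⟨V, hV⟩ := exists_volume_bound_flow hφ hE₀
  have hadm : ∀ τ, 0 < τ → ∀ n, IsAdmissible φ (S τ n) := fun τ hτ n =>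
    (hS τ hτ).isAdmissible hτ hE₀ n
  set σ : ℕ → ℝ := fun j => 1 / ((j : ℝ) + 1) with hσ
  have hσ0 : ∀ j, 0 < σ j := fun j => by positivity
  have hσlim : Tendsto σ atTop (𝓝 0) := tendsto_one_div_add_atTop_nhds_zero_nat
  -- The tightness radii may depend on the rational time q; this is harmless because compactness is
  -- used separately at each q.
  choose R hR using fun (q : {q : ℚ // 0 ≤ q}) (k : ℕ) => exists_tight_radius φ hE₀
    (T := ((q : ℚ) : ℝ)) (by exact_mod_cast q.2) (ε := 1 / ((k : ℝ) + 1)) (by positivity)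
  have htight : ∀ (j : ℕ) (q : {q : ℚ // 0 ≤ q}),
      IsTightBounded V M (R q) (S (σ j) ⌊((q : ℚ) : ℝ) / σ j⌋₊) := by
    intro j q
    have hq : (0 : ℝ) ≤ ((q : ℚ) : ℝ) := by exact_mod_cast q.2
    refine ⟨(hadm _ (hσ0 j) _).1, hV _ _ (hσ0 j) (hS _ (hσ0 j)) _,
      hM _ _ (hσ0 j) (hS _ (hσ0 j)) _, fun k => ?_⟩
    have h := hR q k _ _ (hσ0 j) (hS _ (hσ0 j)) ⌊((q : ℚ) : ℝ) / σ j⌋₊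
      ((le_div_iff₀ (hσ0 j)).1 (Nat.floor_le (div_nonneg hq (hσ0 j).le)))
    rw [← ENNReal.ofReal_toReal
      ((measure_mono sdiff_subset).trans_lt (hadm _ (hσ0 j) _).2.1).ne]
    exact ENNReal.ofReal_le_ofReal h
  obtain ⟨ψ, hψ, hcauchy⟩ := exists_subseq_cauchy htight
  have hunif : ∀ T : ℕ, ∀ ε : ℝ≥0∞, 0 < ε → ∃ J, ∀ i ≥ J, ∀ j ≥ J, ∀ t : ℝ, 0 ≤ t → t ≤ T →
      volume (symmDiff (S (σ (ψ i)) ⌊t / σ (ψ i)⌋₊) (S (σ (ψ j)) ⌊t / σ (ψ j)⌋₊)) ≤ ε := by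
    intro T ε hε
    refine uniform_cauchy_of_grid (c := 2 * (anisoPerimeter φ E₀).toReal) (by positivity)
      (τ := fun j => σ (ψ j)) (A := fun j t => S (σ (ψ j)) ⌊t / σ (ψ j)⌋₊)
      (hσlim.comp hψ.tendsto_atTop) ?_ ?_ T hε
    · intro j s t hs ht
      exact (hS _ (hσ0 _)).volume_symmDiff_floor_le (hσ0 _) hE₀ hs ht
    · intro q hq ε hε
      exact hcauchy ⟨q, hq⟩ ε hε
  obtain ⟨θ, hθ, hlim⟩ := exists_subseq_fast_cauchy
    (A := fun j t => S (σ (ψ j)) ⌊t / σ (ψ j)⌋₊) hunif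
  exact ⟨fun k => σ (ψ (θ k)), fun k => hσ0 _,
    hσlim.comp (hψ.tendsto_atTop.comp hθ.tendsto_atTop), hlim⟩

lemma tendsto_two_mul_inv_two_pow : Tendsto (fun k : ℕ => 2 * (2⁻¹ : ℝ≥0∞) ^ k) atTop (𝓝 0) := by
  have := ENNReal.Tendsto.const_mul (a := 2)
    (ENNReal.tendsto_pow_atTop_nhds_zero_of_lt_one (r := 2⁻¹) (by simp)) (Or.inr (by simp))
  rwa [mul_zero] at this

end

end L1Flow

/-! ### The main theorem -/

open L1Flow in
theorem mainTheorem11 (d : ℕ) (φ : Seminorm ℝ (EuclideanSpace ℝ (Fin d)))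
    (hφ : ∀ x, φ x = 0 → x = 0)
    (E₀ : Set (EuclideanSpace ℝ (Fin d)))
    (hE₀ : L1Flow.HasFinitePerimeter E₀) (hvol : volume E₀ < ∞) :
    (∀ τ : ℝ, 0 < τ → ∃ S : ℕ → Set (EuclideanSpace ℝ (Fin d)),
      L1Flow.IsDiscreteFlow φ τ E₀ S) ∧
    ∀ S : ℝ → ℕ → Set (EuclideanSpace ℝ (Fin d)),
      (∀ τ : ℝ, 0 < τ → L1Flow.IsDiscreteFlow φ τ E₀ (S τ)) →
      ∃ (τ : ℕ → ℝ) (E : ℝ → Set (EuclideanSpace ℝ (Fin d))),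
        (∀ k, 0 < τ k) ∧ Tendsto τ atTop (𝓝 0) ∧
        -- `u(x,t) = χ_{E(t)}(x)` is measurable, in `(t,x)` and in `x` for every `t`
        NullMeasurableSet
          {p : ℝ × EuclideanSpace ℝ (Fin d) | 0 ≤ p.1 ∧ p.2 ∈ E p.1} volume ∧
        (∀ t : ℝ, 0 ≤ t → NullMeasurableSet (E t) volume) ∧
        -- bounded in `BV`, uniformly in time
        (∃ C : ℝ≥0, ∀ t : ℝ, 0 ≤ t → L1Flow.bvNorm (L1Flow.chi (E t)) ≤ C) ∧
        -- Hölder continuous in time with exponent `1/2`, with values in `L¹`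
        (∃ C : ℝ≥0, ∀ s t : ℝ, 0 ≤ s → 0 ≤ t →
          eLpNorm (L1Flow.chi (E s) - L1Flow.chi (E t)) 1 volume
            ≤ C * ENNReal.ofReal (|s - t| ^ (1 / 2 : ℝ))) ∧
        -- convergence of the discrete flows in `L¹`, uniformly on bounded time intervals
        ∀ T : ℝ, 0 < T →
          Tendsto (fun k : ℕ => ⨆ t ∈ Set.Icc (0 : ℝ) T,
            eLpNorm (L1Flow.chi (E t) - L1Flow.chi (S (τ k) ⌊t / τ k⌋₊)) 1 volume)
            atTop (𝓝 0) := by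
  have hE := hE₀.isAdmissible φ hvol
  refine ⟨fun τ hτ => exists_isDiscreteFlow hφ hτ hE, fun S hS => ?_⟩
  obtain ⟨τ, hτ0, hτ, hlim⟩ := exists_subseq_flow hφ hE hS
  obtain ⟨M, hM⟩ := exists_totalVariation_bound hφ hE
  obtain ⟨V, hV⟩ := exists_volume_bound_flow hφ hE
  have hSm : ∀ j n, NullMeasurableSet (S (τ j) n) := fun j n =>
    ((hS _ (hτ0 j)).isAdmissible (hτ0 j) hE n).1
  have hGm : ∀ t : ℝ, NullMeasurableSet {x | ∃ m, ∀ j ≥ m, x ∈ S (τ j) ⌊t / τ j⌋₊} := fun t =>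
    nullMeasurableSet_liminf fun j => hSm j _
  have htend : ∀ t : ℝ, 0 ≤ t → Tendsto (fun k => volume (symmDiff (S (τ k) ⌊t / τ k⌋₊)
      {x | ∃ m, ∀ j ≥ m, x ∈ S (τ j) ⌊t / τ j⌋₊})) atTop (𝓝 0) := by
    intro t ht
    refine tendsto_of_tendsto_of_tendsto_of_le_of_le' tendsto_const_nhds
      tendsto_two_mul_inv_two_pow (Eventually.of_forall fun _ => zero_le) ?_
    filter_upwards [eventually_ge_atTop ⌈t⌉₊] with k hk
    rw [symmDiff_comm]
    exact hlim k t ht (Nat.ceil_le.1 hk)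
  refine ⟨τ, fun t => {x | ∃ m, ∀ j ≥ m, x ∈ S (τ j) ⌊t / τ j⌋₊}, hτ0, hτ, ?_, fun t _ => hGm t,
    ⟨V + M, fun t ht => ?_⟩, ⟨NNReal.sqrt (2 * (anisoPerimeter φ E₀).toNNReal),
      fun s t hs ht => ?_⟩, fun T _ => ?_⟩
  · have heq : {p : ℝ × EuclideanSpace ℝ (Fin d) |
        0 ≤ p.1 ∧ ∃ m, ∀ j ≥ m, p.2 ∈ S (τ j) ⌊p.1 / τ j⌋₊} = {p | ∃ m, ∀ j ≥ m,
          p ∈ {p : ℝ × EuclideanSpace ℝ (Fin d) | 0 ≤ p.1 ∧ p.2 ∈ S (τ j) ⌊p.1 / τ j⌋₊}} := by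
      ext ⟨t, x⟩
      exact ⟨fun ⟨ht, m, hm⟩ => ⟨m, fun j hj => ⟨ht, hm j hj⟩⟩,
        fun ⟨m, hm⟩ => ⟨(hm m le_rfl).1, m, fun j hj => (hm j hj).2⟩⟩
    have hnull := nullMeasurableSet_liminf fun j =>
      nullMeasurableSet_setOf_mem_floor (hτ0 j) fun n => hSm j n
    rw [← heq] at hnull
    exact hnull
  -- This further subsequence depends on t, but the bounds V and M do not.
  · obtain ⟨θ, -, hae⟩ := exists_subseq_tendsto_ae_of_symmDiff (fun k => hSm k _) (hGm t)
      (htend t ht)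
    rw [bvNorm, eLpNorm_chi (hGm t), ENNReal.coe_add]
    refine add_le_add ?_ ?_
    · exact volume_le_of_tendsto (fun n => hSm (θ n) _) (hGm t) hae
        (fun n => hV _ _ (hτ0 _) (hS _ (hτ0 _)) _) tendsto_const_nhds
    · exact variationOver_chi_le_of_tendsto (fun n => hSm (θ n) _) hae
        (fun n => hM _ _ (hτ0 _) (hS _ (hτ0 _)) _) tendsto_const_nhds
  · rw [eLpNorm_chi_sub (hGm s) (hGm t)]
    have hrhs : ((NNReal.sqrt (2 * (anisoPerimeter φ E₀).toNNReal) : ℝ≥0) : ℝ≥0∞)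
        * ENNReal.ofReal (|s - t| ^ (1 / 2 : ℝ))
        = ENNReal.ofReal √(2 * (anisoPerimeter φ E₀).toReal * (|s - t| + 0)) := by
      rw [← Real.sqrt_eq_rpow, add_zero, Real.sqrt_mul (by positivity),
        ENNReal.ofReal_mul (Real.sqrt_nonneg _), ← ENNReal.ofReal_coe_nnreal, Real.coe_sqrt]
      rfl
    rw [hrhs]
    -- Triangle inequality through the discrete flows at times s and t; the rounding term τ k
    -- disappears in the limit, leaving a true Hölder bound.
    have h1 := (((htend s hs).congr fun k => by rw [symmDiff_comm]).add
      (tendsto_ofReal_sqrt_mul (2 * (anisoPerimeter φ E₀).toReal) (hτ.const_add |s - t|))).add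
      (htend t ht)
    rw [zero_add, add_zero] at h1
    refine ge_of_tendsto' h1 fun k => ?_
    refine (measure_symmDiff_le _ (S (τ k) ⌊t / τ k⌋₊) _).trans (add_le_add ?_ le_rfl)
    exact (measure_symmDiff_le _ (S (τ k) ⌊s / τ k⌋₊) _).trans
      (add_le_add le_rfl ((hS _ (hτ0 k)).volume_symmDiff_floor_le (hτ0 k) hE hs ht))
  · refine tendsto_of_tendsto_of_tendsto_of_le_of_le' tendsto_const_nhds
      tendsto_two_mul_inv_two_pow (Eventually.of_forall fun _ => zero_le) ?_
    filter_upwards [eventually_ge_atTop ⌈T⌉₊] with k hk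
    refine iSup₂_le fun t ht => ?_
    rw [eLpNorm_chi_sub (hGm t) (hSm k _)]
    exact hlim k t ht.1 (ht.2.trans (Nat.ceil_le.1 hk))
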